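/- Let $(M,g)$ be a connected (Hausdorff, smooth, without boundary) Riemannian manifold of dimension $n>2$, let $\pi:T^*M\to M$ be its cotangent bundle, and let $t=\tfrac12 g^{-1}_{\pi(p)}(p,p)$ be the energy density at $p\in T^*M$. For a vector $X$ and a covector $\theta$ at $\pi(p)$ let $X^H_p$ be the horizontal lift of $X$ with respect to the Levi-Civita connection of $g$, and $\theta^V_p$ the vertical lift of $\theta$; write $g_X=g(X,\cdot)$, let $\theta^\sharp$ be the vector with $g(\theta^\sharp,\cdot)=\theta$, and let $p^V_p$, $(p^\sharp)^H_p$ be the corresponding lifts of $p$ itself. Let $a_1,\dots,a_4,b_1,\dots,b_4:[0,\infty)\to\mathbb R$ be smooth functions and let $J$ be the general natural tensor field of type $(1,1)$ on $T^*M$ given by $$JX^H_p=a_1(t)(g_X)^V_p+b_1(t)\,p(X)\,p^V_p+a_4(t)X^H_p+b_4(t)\,p(X)\,(p^\sharp)^H_p,$$ $$J\theta^V_p=a_3(t)\theta^V_p+b_3(t)\,g^{-1}_{\pi(p)}(p,\theta)\,p^V_p-a_2(t)(\theta^\sharp)^H_p-b_2(t)\,g^{-1}_{\pi(p)}(p,\theta)\,(p^\sharp)^H_p.$$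 Assume that $J$ is an almost complex structure, i.e. $J^2=-\mathrm{id}$. Then $J$ is integrable, i.e. its Nijenhuis tensor $$N_J(X,Y)=[JX,JY]-J[JX,Y]-J[X,JY]-[X,Y]$$ vanishes for all smooth vector fields $X,Y$ on $T^*M$, if and only if there is a constant $c\in\mathbb R$ such that $(M,g)$ has constant sectional curvature $c$ and, for all $t\ge 0$, the number $$D=a_1-2ta_1'-2cta_2-4ct^2a_2'$$ is non-zero and $$b_1=\frac{2c^2ta_2^2+2cta_1a_2'+a_1a_1'-c+3ca_3^2}{D},\qquad b_2=\frac{2ta_3'^2-2ta_1'a_2'+ca_2^2+2cta_2a_2'+a_1a_2'}{D},$$ $$b_3=\frac{a_1a_3'+2ca_2a_3+4cta_2'a_3-2cta_2a_3'}{D},$$ where the functions $a_i$, $b_i$ and the derivatives $a_i'$ are evaluated at $t$ (with the one-sided derivative at $t=0$). -/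

import Mathlib

open scoped Manifold ContDiff

noncomputable section

namespace GeneralNaturalLift

open Bundle

/-! ### Tensor fields of type `(1,1)` and the Nijenhuis tensor on an arbitrary manifold -/

section Nijenhuis

variable {F : Type*} [NormedAddCommGroup F] [NormedSpace ℝ F] {H : Type*} [TopologicalSpace H]
  (I : ModelWithCorners ℝ F H) {N : Type*} [TopologicalSpace N] [ChartedSpace H N]

/-- `N_J(X, Y) = [JX, JY] - J[JX, Y] - J[X, JY] - [X, Y]`, evaluated at the point `p`. -/
def nijenhuis (J : ∀ p : N, TangentSpace I p → TangentSpace I p)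
    (X Y : ∀ p : N, TangentSpace I p) (p : N) : TangentSpace I p :=
  VectorField.mlieBracket I (fun q => J q (X q)) (fun q => J q (Y q)) p
    - J p (VectorField.mlieBracket I (fun q => J q (X q)) Y p)
    - J p (VectorField.mlieBracket I X (fun q => J q (Y q)) p)
    - VectorField.mlieBracket I X Y p

/-- `J` is an almost complex structure: `J² = -1` on every tangent space. -/
def IsAlmostComplex (J : ∀ p : N, TangentSpace I p → TangentSpace I p) : Prop :=
  ∀ (p : N) (v : TangentSpace I p), J p (J p v) = -v

/-- `J` is integrable: `N_J(X, Y) = 0` for all smooth vector fields `X`, `Y`. -/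
def IsIntegrable [IsManifold I 1 N]
    (J : ∀ p : N, TangentSpace I p → TangentSpace I p) : Prop :=
  ∀ X Y : ∀ p : N, TangentSpace I p,
    ContMDiff I I.tangent ∞ (fun p => (⟨p, X p⟩ : TangentBundle I N)) →
    ContMDiff I I.tangent ∞ (fun p => (⟨p, Y p⟩ : TangentBundle I N)) →
    ∀ p : N, nijenhuis I J X Y p = 0

end Nijenhuis

/-! ### Linear algebra and Christoffel symbols on a vector space -/

section VectorSpace

variable {E : Type*} [NormedAddCommGroup E] [NormedSpace ℝ E]

set_option synthInstance.maxHeartbeats 200000 in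
/-- The Christoffel symbols `(u, v) ↦ Γ(u, v)`, `Γ(u, v)^k = Γ^k_{ij} u^i v^j`, of a metric `G` on
an open set of `E`: `Γ(u, v)` is metrically dual to
`w ↦ ½ (∂_u G(v, w) + ∂_v G(u, w) - ∂_w G(u, v))`. -/
def christoffelOf (G : E → E →L[ℝ] E →L[ℝ] ℝ) (y u : E) : E →L[ℝ] E :=
  (G y).inverse.comp
    ((1 / 2 : ℝ) • (fderiv ℝ G y u + (fderiv ℝ G y).flip u - ((fderiv ℝ G y).flip u).flip))

set_option synthInstance.maxHeartbeats 200000 in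
/-- The linear form `G(Γ(u, v), ·)`. -/
theorem christoffelOf_apply (G : E → E →L[ℝ] E →L[ℝ] ℝ) (y u v : E) (hG : (G y).IsInvertible)
    (w : E) : G y (christoffelOf G y u v) w =
      1 / 2 * (fderiv ℝ G y u v w + fderiv ℝ G y v u w - fderiv ℝ G y w u v) := by
  simp [christoffelOf, hG.self_apply_inverse]

/-- A positive definite bilinear form on a finite-dimensional space is invertible as a map to the
dual space. -/
theorem isInvertible_of_pos [FiniteDimensional ℝ E] (B : E →L[ℝ] E →L[ℝ] ℝ)
    (hB : ∀ v, v ≠ 0 → 0 < B v v) : B.IsInvertible := by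
  have hinj : Function.Injective (B : E →ₗ[ℝ] E →L[ℝ] ℝ) := by
    rw [← LinearMap.ker_eq_bot, LinearMap.ker_eq_bot']
    intro v hv
    by_contra h
    have h2 : B v = 0 := hv
    have := hB v h
    rw [h2] at this
    simp at this
  have e1 : (E →ₗ[ℝ] ℝ) ≃ₗ[ℝ] (E →L[ℝ] ℝ) := LinearMap.toContinuousLinearMap
  have hdim : Module.finrank ℝ E = Module.finrank ℝ (E →L[ℝ] ℝ) := by
    rw [← e1.finrank_eq]
    exact (Subspace.dual_finrank_eq (K := ℝ) (V := E)).symm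
  have : FiniteDimensional ℝ (E →L[ℝ] ℝ) := e1.finiteDimensional
  refine ⟨((B : E →ₗ[ℝ] E →L[ℝ] ℝ).linearEquivOfInjective hinj hdim).toContinuousLinearEquiv, ?_⟩
  ext v w
  simp

end VectorSpace

/-! ### Riemannian geometry of the base -/

section Base

variable {E : Type*} [NormedAddCommGroup E] [NormedSpace ℝ E]
  {M : Type*} [TopologicalSpace M] [ChartedSpace E M]
  [IsManifold 𝓘(ℝ, E) ∞ M]

/-- Smooth Riemannian metrics on `M`. -/
abbrev SmoothMetric (E : Type*) [NormedAddCommGroup E] [NormedSpace ℝ E]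
    (M : Type*) [TopologicalSpace M]
    [ChartedSpace E M] [IsManifold 𝓘(ℝ, E) ∞ M] :=
  ContMDiffRiemannianMetric 𝓘(ℝ, E) ∞ E
    (fun x : M => TangentSpace 𝓘(ℝ, E) x)

/-- The musical isomorphism `θ ↦ θ♯` from `T_x^*M` to `T_xM`, inverse of `X ↦ g_X = g(X, ·)`. -/
def sharp (g : SmoothMetric E M) (x : M) :
    (TangentSpace 𝓘(ℝ, E) x →L[ℝ] ℝ) →L[ℝ] TangentSpace 𝓘(ℝ, E) x :=
  (g.inner x).inverse

/-- `sharp` is the inverse of `X ↦ g(X, ·)`. -/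
theorem inner_sharp [FiniteDimensional ℝ E] (g : SmoothMetric E M) (x : M) (θ : TangentSpace 𝓘(ℝ, E) x →L[ℝ] ℝ)
    (Y : TangentSpace 𝓘(ℝ, E) x) : g.inner x (sharp g x θ) Y = θ Y := by
  exact congrArg (fun f : E →L[ℝ] ℝ => f Y) ((isInvertible_of_pos (E := E) (g.inner x)
    (g.pos x)).self_apply_inverse θ)

/-- The coordinate expression of `g` in the preferred chart `φ` around `x₀`, at the point `y` of
the model space: `(u, v) ↦ g_{φ⁻¹ y}(dφ⁻¹ u, dφ⁻¹ v)`. -/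
def metricInChart (g : SmoothMetric E M) (x₀ : M) (y : E) :
    E →L[ℝ] E →L[ℝ] ℝ :=
  let A : E →L[ℝ] TangentSpace 𝓘(ℝ, E) ((extChartAt 𝓘(ℝ, E) x₀).symm y) :=
    mfderiv 𝓘(ℝ, E) 𝓘(ℝ, E) (extChartAt 𝓘(ℝ, E) x₀).symm y
  (ContinuousLinearMap.precomp ℝ A).comp ((g.inner ((extChartAt 𝓘(ℝ, E) x₀).symm y)).comp A)

/-- The Christoffel symbols of the Levi-Civita connection of `g` in the preferred chart around
`x₀`. -/
def christoffel (g : SmoothMetric E M) (x₀ : M) (y u : E) : E →L[ℝ] E :=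
  christoffelOf (metricInChart g x₀) y u

/-- The curvature tensor `R(u, v)w = ∇_u∇_v w - ∇_v∇_u w - ∇_{[u,v]} w` at `x`, computed in the
preferred chart around `x`; in Mathlib a vector of `TangentSpace 𝓘(ℝ, E) x` is by definition the
vector of its coordinates in that chart. -/
def curvature (g : SmoothMetric E M) (x : M) (u v w : TangentSpace 𝓘(ℝ, E) x) : TangentSpace 𝓘(ℝ, E) x :=
  let y : E := extChartAt 𝓘(ℝ, E) x x
  let u' : E := u
  let v' : E := v
  let w' : E := w
  fderiv ℝ (fun z => christoffel g x z v' w') y u' - fderiv ℝ (fun z => christoffel g x z u' w') y v'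
    + christoffel g x y u' (christoffel g x y v' w')
    - christoffel g x y v' (christoffel g x y u' w')

/-- The sectional curvature of the plane spanned by `u`, `v` (linearly independent). -/
def sectionalCurvature (g : SmoothMetric E M) (x : M) (u v : TangentSpace 𝓘(ℝ, E) x) : ℝ :=
  g.inner x (curvature g x u v v) u /
    (g.inner x u u * g.inner x v v - g.inner x u v ^ 2)

/-- `(M, g)` has constant sectional curvature `c`. -/
def HasConstantSectionalCurvature (g : SmoothMetric E M) (c : ℝ) : Prop :=
  ∀ (x : M) (u v : TangentSpace 𝓘(ℝ, E) x), LinearIndependent ℝ ![u, v] →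
    sectionalCurvature g x u v = c

end Base

/-! ### The cotangent bundle and the general natural tensor field `J` -/

section Cotangent

/-- The cotangent bundle `T^*M`, with Mathlib's manifold structure on the total space. -/
abbrev CotangentBundle (E : Type*) [NormedAddCommGroup E] [NormedSpace ℝ E]
    (M : Type*) [TopologicalSpace M]
    [ChartedSpace E M] :=
  TotalSpace (E →L[ℝ] ℝ) (fun x : M => TangentSpace 𝓘(ℝ, E) x →L[ℝ] ℝ)

/-- The model with corners of `T^*M`. -/
abbrev cotangentModel (E : Type*) [NormedAddCommGroup E] [NormedSpace ℝ E] :=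
  𝓘(ℝ, E).prod 𝓘(ℝ, E →L[ℝ] ℝ)

variable {E : Type*} [NormedAddCommGroup E] [NormedSpace ℝ E]
  {M : Type*} [TopologicalSpace M] [ChartedSpace E M]
  [IsManifold 𝓘(ℝ, E) ∞ M]

/-- `g⁻¹_x(θ, η)`, the metric induced by `g` on cotangent vectors. -/
def cometric (g : SmoothMetric E M) (x : M) (θ η : TangentSpace 𝓘(ℝ, E) x →L[ℝ] ℝ) : ℝ :=
  θ (sharp g x η)

/-- The energy density `t = ½ g⁻¹(p, p)`. -/
def energy (g : SmoothMetric E M) (p : CotangentBundle E M) : ℝ :=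
  1 / 2 * cometric g p.1 p.2 p.2

/-- The covector `p_k Γ^k_{ih} X^i dx^h`, the vertical part of the horizontal lift of `X` to `p`. -/
def connectionTerm (g : SmoothMetric E M) (p : CotangentBundle E M) (X : TangentSpace 𝓘(ℝ, E) p.1) :
    TangentSpace 𝓘(ℝ, E) p.1 →L[ℝ] ℝ :=
  let ξ : E →L[ℝ] ℝ := p.2
  let X' : E := X
  let Γ : E →L[ℝ] E := christoffel g p.1 (extChartAt 𝓘(ℝ, E) p.1 p.1) X'
  ξ.comp Γ

/-- The vertical lift `θ^V = θ_i ∂/∂p_i` at `p`. In Mathlib a tangent vector of `T^*M` at `p` is by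
definition the pair of its `∂/∂q` and `∂/∂p` coordinates in the chart of `T^*M` induced by the
preferred chart of `M` around `π(p)`. -/
def vLift (p : CotangentBundle E M) (θ : TangentSpace 𝓘(ℝ, E) p.1 →L[ℝ] ℝ) :
    TangentSpace (cotangentModel E) p :=
  ((0, θ) : E × (E →L[ℝ] ℝ))

/-- The horizontal lift `X^H = X^i δ/δq^i`, `δ/δq^i = ∂/∂q^i + p_k Γ^k_{ih} ∂/∂p_h`, at `p`. -/
def hLift (g : SmoothMetric E M) (p : CotangentBundle E M) (X : TangentSpace 𝓘(ℝ, E) p.1) :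
    TangentSpace (cotangentModel E) p :=
  ((X, connectionTerm g p X) : E × (E →L[ℝ] ℝ))

/-- The `X` in the decomposition `v = X^H + θ^V` of a tangent vector `v` of `T^*M`. -/
def hPart (p : CotangentBundle E M) (v : TangentSpace (cotangentModel E) p) :
    TangentSpace 𝓘(ℝ, E) p.1 :=
  Prod.fst (α := E) (β := E →L[ℝ] ℝ) v

/-- The `θ` in the decomposition `v = X^H + θ^V` of a tangent vector `v` of `T^*M`. -/
def vPart (g : SmoothMetric E M) (p : CotangentBundle E M) (v : TangentSpace (cotangentModel E) p) :
    TangentSpace 𝓘(ℝ, E) p.1 →L[ℝ] ℝ :=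
  let ξ : TangentSpace 𝓘(ℝ, E) p.1 →L[ℝ] ℝ := Prod.snd (α := E) (β := E →L[ℝ] ℝ) v
  ξ - connectionTerm g p (hPart p v)

/-- Every tangent vector of `T^*M` is the sum of its horizontal and vertical parts. -/
theorem hLift_add_vLift (g : SmoothMetric E M) (p : CotangentBundle E M)
    (v : TangentSpace (cotangentModel E) p) :
    hLift g p (hPart p v) + vLift p (vPart g p v) = v := by
  refine Prod.ext (α := E) (β := E →L[ℝ] ℝ) ?_ ?_
  · exact add_zero (M := E) (hPart p v)
  · exact add_sub_cancel (G := E →L[ℝ] ℝ) (connectionTerm g p (hPart p v)) _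

/-- The eight coefficients `a₁, …, a₄, b₁, …, b₄` of a general natural tensor field of type
`(1,1)` on `T^*M`: functions on `[0, ∞)` (values at negative arguments are never used), smooth up
to the boundary point `0`. -/
structure Coefficients where
  (a₁ a₂ a₃ a₄ b₁ b₂ b₃ b₄ : ℝ → ℝ)
  smooth_a₁ : ContDiffOn ℝ ∞ a₁ (Set.Ici 0)
  smooth_a₂ : ContDiffOn ℝ ∞ a₂ (Set.Ici 0)
  smooth_a₃ : ContDiffOn ℝ ∞ a₃ (Set.Ici 0)
  smooth_a₄ : ContDiffOn ℝ ∞ a₄ (Set.Ici 0)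
  smooth_b₁ : ContDiffOn ℝ ∞ b₁ (Set.Ici 0)
  smooth_b₂ : ContDiffOn ℝ ∞ b₂ (Set.Ici 0)
  smooth_b₃ : ContDiffOn ℝ ∞ b₃ (Set.Ici 0)
  smooth_b₄ : ContDiffOn ℝ ∞ b₄ (Set.Ici 0)

/-- `J X^H = a₁ (g_X)^V + b₁ p(X) p^V + a₄ X^H + b₄ p(X) (p♯)^H`. -/
def JHor (g : SmoothMetric E M) (C : Coefficients) (p : CotangentBundle E M)
    (X : TangentSpace 𝓘(ℝ, E) p.1) : TangentSpace (cotangentModel E) p :=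
  let t := energy g p
  C.a₁ t • vLift p (g.inner p.1 X) + (C.b₁ t * p.2 X) • vLift p p.2
    + C.a₄ t • hLift g p X + (C.b₄ t * p.2 X) • hLift g p (sharp g p.1 p.2)

/-- `J θ^V = a₃ θ^V + b₃ g⁻¹(p, θ) p^V - a₂ (θ♯)^H - b₂ g⁻¹(p, θ) (p♯)^H`. -/
def JVer (g : SmoothMetric E M) (C : Coefficients) (p : CotangentBundle E M)
    (θ : TangentSpace 𝓘(ℝ, E) p.1 →L[ℝ] ℝ) : TangentSpace (cotangentModel E) p :=
  let t := energy g p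
  C.a₃ t • vLift p θ + (C.b₃ t * cometric g p.1 p.2 θ) • vLift p p.2
    - C.a₂ t • hLift g p (sharp g p.1 θ)
    - (C.b₂ t * cometric g p.1 p.2 θ) • hLift g p (sharp g p.1 p.2)

/-- The general natural tensor field `J` of type `(1,1)` on `T^*M`. -/
def naturalJ (g : SmoothMetric E M) (C : Coefficients) (p : CotangentBundle E M)
    (v : TangentSpace (cotangentModel E) p) : TangentSpace (cotangentModel E) p :=
  JHor g C p (hPart p v) + JVer g C p (vPart g p v)

end Cotangent

end GeneralNaturalLift

end

open GeneralNaturalLift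

/-!
The proof computes the Nijenhuis tensor `N` of `J` in the coordinates of `T^*M` induced by a chart
of `M`. There `J` is an explicit map `localJ` of the metric in the chart, the Lie brackets are those
of vector fields on a vector space, and `N` becomes the tensorial expression `flatNijenhuis`
(`nijenhuis_naturalJ`). The definition of `J` at a point uses the preferred chart at that point, so
this rests on the invariance of `localJ` under changes of coordinates, which is the transformation
law of the Christoffel symbols (`IsChartChange.localJ_natural`, `mfderiv_localJ`).

Evaluating `J² = -1` on vertical vectors gives `a₄ = -a₃`, `a₁a₂ = 1 + a₃²` and
`(a₁ + 2tb₁)(a₂ + 2tb₂) = 1 + (a₃ + 2tb₃)²` (`IsMetricOn.isComplex`). In particular `a₂` and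
`a₂ + 2tb₂` never vanish, so every horizontal vector is the horizontal part of `J θ^V` for some
`θ`; as `N(Jv, w) = -J N(v, w)`, the tensor `N` is determined by its values on pairs of vertical
vectors. With `ω = g⁻¹(p, θ) η - g⁻¹(p, η) θ`, the horizontal part of `N(θ^V, η^V)` is `h(t) ω♯` and
its vertical part is `k(t) ω + p ∘ R(X, Y)`, where `h` and `k` are explicit in the coefficients and
`X`, `Y` are the horizontal parts of `J θ^V`, `J η^V`
(`IsMetricOn.flatNijenhuis_localJ_vertical`).

If `N = 0`, then `h = 0`, and the vertical equation forces `p(R(X, Y)w)` to be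
`κ(t) (p(X) g(Y, w) - p(Y) g(X, w))`. The curvature does not depend on `p`, so comparing the
covectors on a ray shows that `κ` is a constant `c`, which is the sectional curvature at the point
(`IsMetricOn.exists_integrability`). It is determined by the coefficients, `a₂(a₂ + 2tb₂)` being
nonzero, hence it is the same at all points. Conversely, over a metric of constant curvature `c` the
equations `h = 0` and `k + c a₂(a₂ + 2tb₂) = 0` (`Coefficients.Integrability`) give `N = 0`.

It remains to solve these two equations. They are linear in `b₂` and `b₃`, with determinant `D` up
to the nonvanishing factor `a₂`, and the formula for `b₁` follows from
`(a₁ + 2tb₁)(a₂ + 2tb₂) = 1 + (a₃ + 2tb₃)²` for `t > 0` and by continuity for `t = 0`. That `D` does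
not vanish (`Coefficients.denom_ne_zero`) is a global fact: at a zero of `D` the functions `a₃` and
`1 + a₃² - 2cta₂²` both vanish, and since they solve a homogeneous linear system of differential
equations for `t > 0`, they would vanish on the way down to `t = 0`, where the second is at
least `1`.
-/

open scoped Manifold ContDiff

noncomputable section

namespace GeneralNaturalLift

open Bundle

/-! ### The Nijenhuis tensor of an almost complex structure on a vector space -/

section FlatNijenhuis

variable {V : Type*} [NormedAddCommGroup V] [NormedSpace ℝ V]

/-- The tensorial expression
`(D_{Jv} J) w - (D_{Jw} J) v + J (D_w J) v - J (D_v J) w` of the Nijenhuis tensor of `J` at `z`. -/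
def flatNijenhuis (J : V → V →L[ℝ] V) (z v w : V) : V :=
  fderiv ℝ J z (J z v) w - fderiv ℝ J z (J z w) v + J z (fderiv ℝ J z w v)
    - J z (fderiv ℝ J z v w)

/-- In the bracket expression of the Nijenhuis tensor the derivatives of the fields `X` and `Y`
cancel. -/
theorem lieBracket_nijenhuis_eq {J : V → V →L[ℝ] V} {X Y : V → V} {z : V}
    (hJ : DifferentiableAt ℝ J z) (hsq : ∀ v, J z (J z v) = -v)
    (hX : DifferentiableAt ℝ X z) (hY : DifferentiableAt ℝ Y z) :
    VectorField.lieBracket ℝ (fun q => J q (X q)) (fun q => J q (Y q)) z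
      - J z (VectorField.lieBracket ℝ (fun q => J q (X q)) Y z)
      - J z (VectorField.lieBracket ℝ X (fun q => J q (Y q)) z)
      - VectorField.lieBracket ℝ X Y z = flatNijenhuis J z (X z) (Y z) := by
  have hJX : ∀ v, fderiv ℝ (fun q => J q (X q)) z v
      = fderiv ℝ J z v (X z) + J z (fderiv ℝ X z v) := fun v => by
    rw [fderiv_clm_apply hJ hX]
    simp [add_comm]
  have hJY : ∀ v, fderiv ℝ (fun q => J q (Y q)) z v
      = fderiv ℝ J z v (Y z) + J z (fderiv ℝ Y z v) := fun v => by
    rw [fderiv_clm_apply hJ hY]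
    simp [add_comm]
  simp only [VectorField.lieBracket, hJX, hJY, map_sub, map_add, hsq, flatNijenhuis]
  abel

variable {J : V → V →L[ℝ] V} {z : V}

theorem flatNijenhuis_swap (v w : V) : flatNijenhuis J z w v = -flatNijenhuis J z v w := by
  simp only [flatNijenhuis]
  abel

theorem flatNijenhuis_add_left (v v' w : V) :
    flatNijenhuis J z (v + v') w = flatNijenhuis J z v w + flatNijenhuis J z v' w := by
  simp only [flatNijenhuis, map_add, add_apply]
  abel

theorem fderiv_comp_eq_neg_of_sq_eq_neg (hJ : DifferentiableAt ℝ J z)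
    (hsq : ∀ᶠ q in nhds z, ∀ v, J q (J q v) = -v) (v w : V) :
    fderiv ℝ J z v (J z w) = -J z (fderiv ℝ J z v w) := by
  have h1 : HasFDerivAt (fun q => J q (J q w)) (0 : V →L[ℝ] V) z :=
    (hasFDerivAt_const (-w) z).congr_of_eventuallyEq (hsq.mono fun q hq => hq w)
  have h2 := hJ.hasFDerivAt.clm_apply (hJ.hasFDerivAt.clm_apply (hasFDerivAt_const w z))
  have h3 := congrArg (fun f : V →L[ℝ] V => f v) (h2.unique h1)
  simp at h3
  rw [eq_neg_iff_add_eq_zero, add_comm]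
  exact h3

theorem flatNijenhuis_J_left (hJ : DifferentiableAt ℝ J z)
    (hsq : ∀ᶠ q in nhds z, ∀ v, J q (J q v) = -v) (v w : V) :
    flatNijenhuis J z (J z v) w = -J z (flatNijenhuis J z v w) := by
  have h0 := hsq.self_of_nhds
  simp only [flatNijenhuis, map_add, map_sub, h0, fderiv_comp_eq_neg_of_sq_eq_neg hJ hsq,
    map_neg, neg_apply]
  abel

/-- Since `N(Jv, w) = -J N(v, w)`, the tensor `N` is determined by its values on any set of
vectors `v` such that the `v + Jv'` exhaust the space. -/
theorem flatNijenhuis_eq_zero_of_span (hJ : DifferentiableAt ℝ J z)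
    (hsq : ∀ᶠ q in nhds z, ∀ v, J q (J q v) = -v) (S : Set V)
    (hS : ∀ v, ∃ a ∈ S, ∃ b ∈ S, v = a + J z b)
    (h : ∀ a ∈ S, ∀ b ∈ S, flatNijenhuis J z a b = 0) (v w : V) : flatNijenhuis J z v w = 0 := by
  have step : ∀ u, (∀ a ∈ S, flatNijenhuis J z a u = 0) → ∀ v, flatNijenhuis J z v u = 0 := by
    intro u hu v
    obtain ⟨a, ha, b, hb, rfl⟩ := hS v
    rw [flatNijenhuis_add_left, flatNijenhuis_J_left hJ hsq, hu a ha, hu b hb, map_zero, neg_zero,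
      add_zero]
  refine step w (fun a ha => ?_) v
  rw [flatNijenhuis_swap, neg_eq_zero]
  exact step a (fun b hb => h b hb a ha) w

end FlatNijenhuis

/-! ### Smooth metrics on open subsets of a vector space -/

section LocalMetric

variable {E : Type*} [NormedAddCommGroup E] [NormedSpace ℝ E]

section Instances

-- Typeclass search for norms on spaces of multilinear maps is slow without these shortcuts.

variable (E)

instance normedAddCommGroupDual : NormedAddCommGroup (E →L[ℝ] ℝ) := inferInstance

instance normedSpaceDual : NormedSpace ℝ (E →L[ℝ] ℝ) := inferInstance

instance normedAddCommGroupBilin : NormedAddCommGroup (E →L[ℝ] E →L[ℝ] ℝ) := inferInstance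

instance normedSpaceBilin : NormedSpace ℝ (E →L[ℝ] E →L[ℝ] ℝ) := inferInstance

instance normedAddCommGroupTrilin : NormedAddCommGroup (E →L[ℝ] E →L[ℝ] E →L[ℝ] ℝ) :=
  inferInstance

instance normedSpaceTrilin : NormedSpace ℝ (E →L[ℝ] E →L[ℝ] E →L[ℝ] ℝ) := inferInstance

instance normedAddCommGroupBilinEnd : NormedAddCommGroup (E →L[ℝ] E →L[ℝ] E) := inferInstance

instance normedSpaceBilinEnd : NormedSpace ℝ (E →L[ℝ] E →L[ℝ] E) := inferInstance

end Instances

/-- `G` is a smooth Riemannian metric on the open subset `U` of the vector space `E`. -/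
structure IsMetricOn (G : E → E →L[ℝ] E →L[ℝ] ℝ) (U : Set E) : Prop where
  isOpen : IsOpen U
  contDiffOn : ContDiffOn ℝ ∞ G U
  symm : ∀ y ∈ U, ∀ u v, G y u v = G y v u
  pos : ∀ y ∈ U, ∀ v, v ≠ 0 → 0 < G y v v

/-- The Christoffel symbols of `G` at `y`, as a continuous bilinear map. -/
def christoffelL (G : E → E →L[ℝ] E →L[ℝ] ℝ) (y : E) : E →L[ℝ] E →L[ℝ] E :=
  (ContinuousLinearMap.compL ℝ E (E →L[ℝ] ℝ) E (G y).inverse).comp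
    ((1 / 2 : ℝ) • (fderiv ℝ G y + (fderiv ℝ G y).flip
      - ((ContinuousLinearMap.flipₗᵢ ℝ E E ℝ).toContinuousLinearEquiv :
          (E →L[ℝ] E →L[ℝ] ℝ) →L[ℝ] (E →L[ℝ] E →L[ℝ] ℝ)).comp (fderiv ℝ G y).flip))

theorem christoffelL_apply (G : E → E →L[ℝ] E →L[ℝ] ℝ) (y u : E) :
    christoffelL G y u = christoffelOf G y u := by
  ext v
  simp [christoffelL, christoffelOf]

namespace IsMetricOn

variable {G : E → E →L[ℝ] E →L[ℝ] ℝ} {U : Set E} {y : E} [FiniteDimensional ℝ E]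

omit [FiniteDimensional ℝ E] in
theorem contDiffAt (h : IsMetricOn G U) (hy : y ∈ U) : ContDiffAt ℝ ∞ G y :=
  h.contDiffOn.contDiffAt (h.isOpen.mem_nhds hy)

theorem isInvertible (h : IsMetricOn G U) (hy : y ∈ U) : (G y).IsInvertible :=
  isInvertible_of_pos (G y) (h.pos y hy)

theorem apply_inverse (h : IsMetricOn G U) (hy : y ∈ U) (θ : E →L[ℝ] ℝ) :
    G y ((G y).inverse θ) = θ :=
  (h.isInvertible hy).self_apply_inverse θ

theorem inverse_apply (h : IsMetricOn G U) (hy : y ∈ U) (u : E) :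
    (G y).inverse (G y u) = u :=
  (h.isInvertible hy).inverse_apply_self u

theorem ext_inner (h : IsMetricOn G U) (hy : y ∈ U) {u v : E} (huv : ∀ w, G y u w = G y v w) :
    u = v := by
  rw [← h.inverse_apply hy u, ← h.inverse_apply hy v]
  congr 1
  ext w
  exact huv w

theorem apply_inverse_comm (h : IsMetricOn G U) (hy : y ∈ U) (θ η : E →L[ℝ] ℝ) :
    θ ((G y).inverse η) = η ((G y).inverse θ) := by
  conv_lhs => rw [← h.apply_inverse hy θ]
  conv_rhs => rw [← h.apply_inverse hy η]
  exact h.symm y hy _ _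

theorem apply_inverse_self_pos (h : IsMetricOn G U) (hy : y ∈ U) {θ : E →L[ℝ] ℝ} (hθ : θ ≠ 0) :
    0 < θ ((G y).inverse θ) := by
  have h0 : (G y).inverse θ ≠ 0 := by
    intro h0
    apply hθ
    rw [← h.apply_inverse hy θ, h0, map_zero]
  have := h.pos y hy _ h0
  rwa [h.apply_inverse hy θ] at this

theorem apply_inverse_self_nonneg (h : IsMetricOn G U) (hy : y ∈ U) (θ : E →L[ℝ] ℝ) :
    0 ≤ θ ((G y).inverse θ) := by
  by_cases hθ : θ = 0
  · simp [hθ]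
  · exact (h.apply_inverse_self_pos hy hθ).le

theorem contDiffAt_inverse (h : IsMetricOn G U) (hy : y ∈ U) :
    ContDiffAt ℝ ∞ (fun z => (G z).inverse) y := by
  have : CompleteSpace E := FiniteDimensional.complete ℝ E
  obtain ⟨e, he⟩ := h.isInvertible hy
  have h1 := contDiffAt_map_inverse (n := ∞) e
  rw [he] at h1
  exact h1.comp y (h.contDiffAt hy)

omit [FiniteDimensional ℝ E] in
theorem contDiffAt_fderiv (h : IsMetricOn G U) (hy : y ∈ U) :
    ContDiffAt ℝ ∞ (fderiv ℝ G) y :=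
  (h.contDiffAt hy).fderiv_right (m := ∞) (by simp)

theorem contDiffAt_christoffelL (h : IsMetricOn G U) (hy : y ∈ U) :
    ContDiffAt ℝ ∞ (christoffelL G) y := by
  have h1 := h.contDiffAt_inverse hy
  have h2 := h.contDiffAt_fderiv hy
  have h3 : ContDiffAt ℝ ∞ (fun z => (fderiv ℝ G z).flip) y :=
    (ContinuousLinearMap.flipₗᵢ ℝ E E (E →L[ℝ] ℝ)).contDiff.contDiffAt.comp y h2
  unfold christoffelL
  refine ContDiffAt.clm_comp ?_ (ContDiffAt.const_smul _ (ContDiffAt.sub (h2.add h3) ?_))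
  · exact (ContinuousLinearMap.compL ℝ E (E →L[ℝ] ℝ) E).contDiff.contDiffAt.comp y h1
  · exact contDiffAt_const.clm_comp h3

theorem inner_christoffel (h : IsMetricOn G U) (hy : y ∈ U) (u v w : E) :
    G y (christoffelL G y u v) w =
      1 / 2 * (fderiv ℝ G y u v w + fderiv ℝ G y v u w - fderiv ℝ G y w u v) := by
  rw [christoffelL_apply]
  exact christoffelOf_apply G y u v (h.isInvertible hy) w

omit [FiniteDimensional ℝ E] in
theorem fderiv_symm (h : IsMetricOn G U) (hy : y ∈ U) (w u v : E) :
    fderiv ℝ G y w u v = fderiv ℝ G y w v u := by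
  have hd : HasFDerivAt G (fderiv ℝ G y) y :=
    ((h.contDiffAt hy).differentiableAt (by simp)).hasFDerivAt
  have h1 : ∀ a b : E, HasFDerivAt (fun z => G z a b)
      (((ContinuousLinearMap.apply ℝ ℝ b).comp
        (ContinuousLinearMap.apply ℝ (E →L[ℝ] ℝ) a)).comp (fderiv ℝ G y)) y := fun a b =>
    ((ContinuousLinearMap.apply ℝ ℝ b).comp
      (ContinuousLinearMap.apply ℝ (E →L[ℝ] ℝ) a)).hasFDerivAt.comp y hd
  have h2 := (h1 v u).congr_of_eventuallyEq (f₁ := fun z => G z u v)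
    (Filter.eventually_of_mem (h.isOpen.mem_nhds hy) fun z hz => h.symm z hz u v)
  exact congrArg (fun f : E →L[ℝ] ℝ => f w) ((h1 u v).unique h2)

theorem christoffel_symm (h : IsMetricOn G U) (hy : y ∈ U) (u v : E) :
    christoffelL G y u v = christoffelL G y v u := by
  refine h.ext_inner hy fun w => ?_
  rw [h.inner_christoffel hy, h.inner_christoffel hy, h.fderiv_symm hy w u v]
  ring

/-- The Levi-Civita connection is metric: `∂_w G(u, v) = G(Γ(w, u), v) + G(u, Γ(w, v))`. -/
theorem fderiv_eq_christoffel (h : IsMetricOn G U) (hy : y ∈ U) (w u v : E) :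
    fderiv ℝ G y w u v = G y (christoffelL G y w u) v + G y u (christoffelL G y w v) := by
  rw [h.symm y hy u, h.inner_christoffel hy, h.inner_christoffel hy, h.fderiv_symm hy w u v,
    h.fderiv_symm hy u w v, h.fderiv_symm hy v w u]
  ring

/-- The derivative of the musical isomorphism `θ ↦ θ♯` along a curve. -/
theorem hasDerivAt_inverse (h : IsMetricOn G U) {c : ℝ → E} {s : ℝ} {u : E}
    (hc : HasDerivAt c u s) (hy : c s ∈ U) (θ : E →L[ℝ] ℝ) :
    HasDerivAt (fun r => (G (c r)).inverse θ)
      (-christoffelL G (c s) u ((G (c s)).inverse θ)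
        - (G (c s)).inverse (θ.comp (christoffelL G (c s) u))) s := by
  have hS : HasFDerivAt (fun z => (G z).inverse) _ (c s) :=
    ((h.contDiffAt_inverse hy).differentiableAt (by simp)).hasFDerivAt
  have hG : HasFDerivAt G (fderiv ℝ G (c s)) (c s) :=
    ((h.contDiffAt hy).differentiableAt (by simp)).hasFDerivAt
  have h1 := (hS.comp_hasDerivAt s hc).clm_apply (hasDerivAt_const s θ)
  have h2 := (hG.comp_hasDerivAt s hc).clm_apply h1
  have h3 : HasDerivAt (fun r => G (c r) ((G (c r)).inverse θ)) 0 s := by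
    refine (hasDerivAt_const s θ).congr_of_eventuallyEq ?_
    filter_upwards [hc.continuousAt.preimage_mem_nhds (h.isOpen.mem_nhds hy)] with r hr
    exact h.apply_inverse hr θ
  have h4 := h2.unique h3
  simp only [Function.comp_apply] at h1 h4
  convert h1 using 1
  refine (h.ext_inner hy fun w => ?_).symm
  have h5 := congrArg (fun f : E →L[ℝ] ℝ => f w) h4
  simp only [add_apply, h.fderiv_eq_christoffel hy, h.apply_inverse hy, zero_apply] at h5
  simp only [map_sub, map_neg, sub_apply, neg_apply, h.apply_inverse hy,
    ContinuousLinearMap.comp_apply]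
  linarith

end IsMetricOn

end LocalMetric

/-! ### The curvature tensor of a metric on an open subset of a vector space -/

section LocalCurvature

set_option synthInstance.maxHeartbeats 200000

variable {E : Type*} [NormedAddCommGroup E] [NormedSpace ℝ E]

instance normedAddCommGroupTrilinEnd : NormedAddCommGroup (E →L[ℝ] E →L[ℝ] E →L[ℝ] E) :=
  inferInstance

instance normedSpaceTrilinEnd : NormedSpace ℝ (E →L[ℝ] E →L[ℝ] E →L[ℝ] E) := inferInstance

/-- The curvature tensor `R(u, v)w` of the metric `G` at `y`. -/
def localCurvature (G : E → E →L[ℝ] E →L[ℝ] ℝ) (y u v w : E) : E :=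
  fderiv ℝ (christoffelL G) y u v w - fderiv ℝ (christoffelL G) y v u w
    + christoffelL G y u (christoffelL G y v w) - christoffelL G y v (christoffelL G y u w)

/-- An algebraic curvature tensor all of whose sectional values `B(u, v, v, u)` vanish is zero. -/
theorem eq_zero_of_algebraic_curvature {V : Type*} [AddCommGroup V] {B : V → V → V → V → ℝ}
    (add₂ : ∀ u v v' w z, B u (v + v') w z = B u v w z + B u v' w z)
    (add₄ : ∀ u v w z z', B u v w (z + z') = B u v w z + B u v w z')
    (anti₁₂ : ∀ u v w z, B u v w z = -B v u w z) (anti₃₄ : ∀ u v w z, B u v w z = -B u v z w)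
    (bianchi : ∀ u v w z, B u v w z + B v w u z + B w u v z = 0)
    (hB : ∀ u v, B u v v u = 0) (u v w z : V) : B u v w z = 0 := by
  have add₁ : ∀ u u' v w z, B (u + u') v w z = B u v w z + B u' v w z := fun u u' v w z => by
    rw [anti₁₂, add₂, anti₁₂ u, anti₁₂ u']; ring
  have add₃ : ∀ u v w w' z, B u v (w + w') z = B u v w z + B u v w' z := fun u v w w' z => by
    rw [anti₃₄, add₄, anti₃₄ u v w, anti₃₄ u v w']; ring
  have pair : ∀ u v w z, B u v w z = B w z u v := fun u v w z => by
    linarith [bianchi u v w z, bianchi v w z u, bianchi w z u v, bianchi z u v w,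
      anti₃₄ u v w z, anti₃₄ v w u z, anti₃₄ w u v z, anti₃₄ v w z u, anti₃₄ w z v u,
      anti₃₄ z v w u, anti₃₄ w z u v, anti₃₄ z u w v, anti₃₄ u w z v, anti₃₄ z u v w,
      anti₃₄ u v z w, anti₃₄ v z u w, anti₁₂ u v w z, anti₁₂ v w u z, anti₁₂ w u v z,
      anti₁₂ z v w u, anti₁₂ u w z v, anti₁₂ v z u w, anti₁₂ w z v u, anti₁₂ z u w v,
      anti₁₂ w z u v, anti₁₂ u w v z, anti₁₂ v z w u]
  have h1 : ∀ u v z, B u v v z = 0 := fun u v z => by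
    have h := hB (u + z) v
    rw [add₁, add₄, add₄, hB u v, hB z v] at h
    have h2 : B z v v u = B u v v z := by rw [pair, anti₁₂, anti₃₄]; ring
    linarith
  have h2 : ∀ u v w z, B u v w z = -B u w v z := fun u v w z => by
    have h := h1 u (v + w) z
    rw [add₂, add₃, add₃, h1 u v z, h1 u w z] at h
    linarith
  linarith [bianchi u v w z, h2 u v w z, anti₁₂ w u v z, h2 v w u z, anti₁₂ v u w z]

namespace IsMetricOn

variable {G : E → E →L[ℝ] E →L[ℝ] ℝ} {U : Set E} {y : E} [FiniteDimensional ℝ E]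

theorem hasFDerivAt_christoffelL (h : IsMetricOn G U) (hy : y ∈ U) :
    HasFDerivAt (christoffelL G) (fderiv ℝ (christoffelL G) y) y :=
  ((h.contDiffAt_christoffelL hy).differentiableAt (by simp)).hasFDerivAt

omit [FiniteDimensional ℝ E] in
theorem hasFDerivAt_self (h : IsMetricOn G U) (hy : y ∈ U) :
    HasFDerivAt G (fderiv ℝ G y) y :=
  ((h.contDiffAt hy).differentiableAt (by simp)).hasFDerivAt

theorem fderiv_christoffelL_symm (h : IsMetricOn G U) (hy : y ∈ U) (w u v : E) :
    fderiv ℝ (christoffelL G) y w u v = fderiv ℝ (christoffelL G) y w v u := by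
  have h1 : ∀ a b : E, HasFDerivAt (fun z => christoffelL G z a b) _ y := fun a b =>
    ((h.hasFDerivAt_christoffelL hy).clm_apply (hasFDerivAt_const a y)).clm_apply
      (hasFDerivAt_const b y)
  have h2 := (h1 v u).congr_of_eventuallyEq (f₁ := fun z => christoffelL G z u v)
    (Filter.eventually_of_mem (h.isOpen.mem_nhds hy) fun z hz => h.christoffel_symm hz u v)
  simpa using congrArg (fun f : E →L[ℝ] E => f w) ((h1 u v).unique h2)

theorem localCurvature_bianchi (h : IsMetricOn G U) (hy : y ∈ U) (u v w : E) :
    localCurvature G y u v w + localCurvature G y v w u + localCurvature G y w u v = 0 := by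
  simp only [localCurvature]
  rw [h.fderiv_christoffelL_symm hy u w v, h.fderiv_christoffelL_symm hy v u w,
    h.fderiv_christoffelL_symm hy w v u, h.christoffel_symm hy w v, h.christoffel_symm hy u w,
    h.christoffel_symm hy v u]
  abel

omit [FiniteDimensional ℝ E] in
theorem localCurvature_antisymm (u v w : E) :
    localCurvature G y u v w = -localCurvature G y v u w := by
  simp only [localCurvature]
  abel

/-- `G(R(u, v)w, w) = 0`: commuting second derivatives of the function `z ↦ G_z(w, w)`. -/
theorem inner_localCurvature_self (h : IsMetricOn G U) (hy : y ∈ U) (u v w : E) :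
    G y (localCurvature G y u v w) w = 0 := by
  set f : E → ℝ := fun z => G z w w
  have hf : ContDiffAt ℝ ∞ f y :=
    ((h.contDiffAt hy).clm_apply contDiffAt_const).clm_apply contDiffAt_const
  have hf' : ∀ z ∈ U, ∀ a, fderiv ℝ f z a = 2 * G z (christoffelL G z a w) w := by
    intro z hz a
    have h1 : HasFDerivAt f _ z := ((h.hasFDerivAt_self hz).clm_apply
      (hasFDerivAt_const w z)).clm_apply (hasFDerivAt_const w z)
    rw [h1.fderiv]
    simp only [add_apply, ContinuousLinearMap.flip_apply, ContinuousLinearMap.comp_apply,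
      zero_apply, map_zero, zero_add, h.fderiv_eq_christoffel hz, h.symm z hz w]
    ring
  have hf2 : ∀ a b, fderiv ℝ (fderiv ℝ f) y a b = 2 * (G y (christoffelL G y a
      (christoffelL G y b w)) w + G y (christoffelL G y b w) (christoffelL G y a w)
      + G y (fderiv ℝ (christoffelL G) y a b w) w) := by
    intro a b
    have h1 : HasFDerivAt (fderiv ℝ f) _ y :=
      ((hf.fderiv_right (m := ∞) (by simp)).differentiableAt (by simp)).hasFDerivAt
    have h2 := h1.clm_apply (hasFDerivAt_const b y)
    have h3 : HasFDerivAt (fun z => 2 * G z (christoffelL G z b w) w) _ y :=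
      (((h.hasFDerivAt_self hy).clm_apply (((h.hasFDerivAt_christoffelL hy).clm_apply
        (hasFDerivAt_const b y)).clm_apply (hasFDerivAt_const w y))).clm_apply
        (hasFDerivAt_const w y)).const_mul 2
    have h4 := h3.congr_of_eventuallyEq (f₁ := fun z => fderiv ℝ f z b)
      (Filter.eventually_of_mem (h.isOpen.mem_nhds hy) fun z hz => hf' z hz b)
    have h5 := congrArg (fun l : E →L[ℝ] ℝ => l a) (h2.unique h4)
    simp [h.fderiv_eq_christoffel hy] at h5
    rw [h5]
    ring
  have hs : fderiv ℝ (fderiv ℝ f) y u v = fderiv ℝ (fderiv ℝ f) y v u :=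
    (hf.isSymmSndFDerivAt (by simpa using ENat.LEInfty.out)).eq u v
  rw [hf2, hf2, h.symm y hy (christoffelL G y v w)] at hs
  simp only [localCurvature, map_add, map_sub, add_apply, sub_apply]
  linarith

theorem inner_localCurvature_antisymm (h : IsMetricOn G U) (hy : y ∈ U) (u v w z : E) :
    G y (localCurvature G y u v w) z = -G y (localCurvature G y u v z) w := by
  have h1 := h.inner_localCurvature_self hy u v (w + z)
  have h2 : localCurvature G y u v (w + z) =
      localCurvature G y u v w + localCurvature G y u v z := by
    simp only [localCurvature, map_add]
    abel
  rw [h2] at h1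
  simp only [map_add, add_apply, h.inner_localCurvature_self hy] at h1
  linarith

omit [FiniteDimensional ℝ E] in
theorem gram_ne_zero (h : IsMetricOn G U) (hy : y ∈ U) {u v : E}
    (hli : LinearIndependent ℝ ![u, v]) : G y u u * G y v v - G y u v ^ 2 ≠ 0 := by
  have hv : v ≠ 0 := by simpa using hli.ne_zero 1
  have hvv := h.pos y hy v hv
  have hw : G y v v • u - G y u v • v ≠ 0 := by
    intro h0
    have h1 := LinearIndependent.pair_iff.1 hli (G y v v) (-G y u v)
      (by rw [neg_smul, ← sub_eq_add_neg]; exact h0)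
    exact hvv.ne' h1.1
  have hww := h.pos y hy _ hw
  simp only [map_smul, map_sub, smul_apply, sub_apply, smul_eq_mul, h.symm y hy v u] at hww
  intro h0
  have : G y v v * (G y u u * G y v v - G y u v ^ 2) = 0 := by rw [h0, mul_zero]
  nlinarith

/-- A metric of constant sectional curvature `c` has curvature tensor
`R(u, v)w = c (G(v, w) u - G(u, w) v)`. -/
theorem localCurvature_eq_of_sectional (h : IsMetricOn G U) (hy : y ∈ U) {c : ℝ}
    (hc : ∀ u v, LinearIndependent ℝ ![u, v] → G y (localCurvature G y u v v) u /
      (G y u u * G y v v - G y u v ^ 2) = c) (u v w : E) :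
    localCurvature G y u v w = c • (G y v w • u - G y u w • v) := by
  refine h.ext_inner hy fun z => ?_
  rw [← sub_eq_zero]
  refine eq_zero_of_algebraic_curvature (B := fun u v w z => G y (localCurvature G y u v w) z
    - G y (c • (G y v w • u - G y u w • v)) z) ?_ ?_ ?_ ?_ ?_ ?_ u v w z
  · intro u v v' w z
    have : localCurvature G y u (v + v') w
        = localCurvature G y u v w + localCurvature G y u v' w := by
      simp only [localCurvature, map_add, add_apply]
      abel
    simp only [this, map_add, map_smul, map_sub, add_apply, smul_apply, sub_apply, smul_eq_mul]
    ring
  · intro u v w z z'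
    simp only [map_add]
    ring
  · intro u v w z
    rw [localCurvature_antisymm]
    simp only [map_neg, map_smul, map_sub, neg_apply, smul_apply, sub_apply, smul_eq_mul]
    ring
  · intro u v w z
    rw [h.inner_localCurvature_antisymm hy]
    simp only [map_smul, map_sub, smul_apply, sub_apply, smul_eq_mul]
    ring
  · intro u v w z
    have h1 := congrArg (fun a => G y a z) (h.localCurvature_bianchi hy u v w)
    simp only [map_add, add_apply, map_zero, zero_apply] at h1
    simp only [map_smul, map_sub, smul_apply, sub_apply, smul_eq_mul]
    rw [h.symm y hy w v, h.symm y hy w u, h.symm y hy v u]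
    linarith
  · intro u v
    by_cases hli : LinearIndependent ℝ ![u, v]
    · have hne := h.gram_ne_zero hy hli
      have h1 := hc u v hli
      rw [div_eq_iff hne] at h1
      simp only [h1, map_smul, map_sub, smul_apply, sub_apply, smul_eq_mul, h.symm y hy v u]
      ring
    · have hR : ∀ (a : ℝ) (x z : E), localCurvature G y x (a • x) z = 0 := fun a x z => by
        simp only [localCurvature, map_smul, smul_apply]
        abel
      by_cases hu : u = 0
      · subst hu
        simp
      · rw [LinearIndependent.pair_iff' hu] at hli
        push Not at hli
        obtain ⟨a, rfl⟩ := hli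
        simp only [hR, map_smul, map_sub, map_zero, zero_apply, smul_apply, sub_apply, smul_eq_mul]
        ring

omit [FiniteDimensional ℝ E] in
theorem sectional_of_localCurvature_eq (h : IsMetricOn G U) (hy : y ∈ U) {c : ℝ}
    (hR : ∀ u v w, localCurvature G y u v w = c • (G y v w • u - G y u w • v)) {u v : E}
    (hli : LinearIndependent ℝ ![u, v]) :
    G y (localCurvature G y u v v) u / (G y u u * G y v v - G y u v ^ 2) = c := by
  rw [div_eq_iff (h.gram_ne_zero hy hli), hR]
  simp only [map_smul, map_sub, smul_apply, sub_apply, smul_eq_mul, h.symm y hy v u]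
  ring

end IsMetricOn

end LocalCurvature

/-! ### The natural tensor field `J` over an open subset of a vector space -/

section LocalJ

set_option synthInstance.maxHeartbeats 200000

variable {E : Type*} [NormedAddCommGroup E] [NormedSpace ℝ E]

/-- The energy density `½ B⁻¹(ξ, ξ)` of the covector `ξ` for the scalar product `B`. -/
def fibreEnergy (B : E →L[ℝ] E →L[ℝ] ℝ) (ξ : E →L[ℝ] ℝ) : ℝ := 1 / 2 * ξ (B.inverse ξ)

/-- The horizontal component of `J (X^H + θ^V)` at the covector `ξ`, for the scalar product `B`. -/
def fibreH (B : E →L[ℝ] E →L[ℝ] ℝ) (C : Coefficients) (ξ : E →L[ℝ] ℝ) (X : E) (θ : E →L[ℝ] ℝ) :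
    E :=
  C.a₄ (fibreEnergy B ξ) • X + (C.b₄ (fibreEnergy B ξ) * ξ X) • B.inverse ξ
    - C.a₂ (fibreEnergy B ξ) • B.inverse θ
    - (C.b₂ (fibreEnergy B ξ) * ξ (B.inverse θ)) • B.inverse ξ

/-- The vertical component of `J (X^H + θ^V)` at the covector `ξ`, for the scalar product `B`. -/
def fibreV (B : E →L[ℝ] E →L[ℝ] ℝ) (C : Coefficients) (ξ : E →L[ℝ] ℝ) (X : E) (θ : E →L[ℝ] ℝ) :
    E →L[ℝ] ℝ :=
  C.a₁ (fibreEnergy B ξ) • B X + (C.b₁ (fibreEnergy B ξ) * ξ X) • ξ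
    + C.a₃ (fibreEnergy B ξ) • θ + (C.b₃ (fibreEnergy B ξ) * ξ (B.inverse θ)) • ξ

/-- The natural tensor field `J` in the cotangent coordinates `z = (y, ξ)` of a metric `G`, as a
linear map. A tangent vector `(X, ζ)` has horizontal part `X` and vertical part
`ζ - ξ ∘ Γ(X, ·)`. -/
def localJLin (G : E → E →L[ℝ] E →L[ℝ] ℝ) (C : Coefficients) (z : E × (E →L[ℝ] ℝ)) :
    E × (E →L[ℝ] ℝ) →ₗ[ℝ] E × (E →L[ℝ] ℝ) where
  toFun v := (fibreH (G z.1) C z.2 v.1 (v.2 - z.2.comp (christoffelL G z.1 v.1)),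
    fibreV (G z.1) C z.2 v.1 (v.2 - z.2.comp (christoffelL G z.1 v.1)) + z.2.comp
      (christoffelL G z.1 (fibreH (G z.1) C z.2 v.1 (v.2 - z.2.comp (christoffelL G z.1 v.1)))))
  map_add' v w := by
    have h1 : ∀ a b, z.2.comp (christoffelL G z.1 (a + b))
        = z.2.comp (christoffelL G z.1 a) + z.2.comp (christoffelL G z.1 b) := fun a b => by
      ext; simp
    have h2 : ∀ X X' θ θ', fibreH (G z.1) C z.2 (X + X') (θ + θ')
        = fibreH (G z.1) C z.2 X θ + fibreH (G z.1) C z.2 X' θ' := fun X X' θ θ' => by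
      simp only [fibreH, map_add]
      module
    have h3 : ∀ X X' θ θ', fibreV (G z.1) C z.2 (X + X') (θ + θ')
        = fibreV (G z.1) C z.2 X θ + fibreV (G z.1) C z.2 X' θ' := fun X X' θ θ' => by
      simp only [fibreV, map_add]
      module
    have h4 : (v + w).2 - z.2.comp (christoffelL G z.1 (v + w).1)
        = (v.2 - z.2.comp (christoffelL G z.1 v.1))
          + (w.2 - z.2.comp (christoffelL G z.1 w.1)) := by
      rw [Prod.fst_add, Prod.snd_add, h1]; abel
    rw [h4, Prod.fst_add, h2, h3, h1]
    ext1
    · rfl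
    · simp only [Prod.snd_add]; abel
  map_smul' k v := by
    have h1 : ∀ a, z.2.comp (christoffelL G z.1 (k • a)) = k • z.2.comp (christoffelL G z.1 a) :=
      fun a => by ext; simp
    have h2 : ∀ X θ, fibreH (G z.1) C z.2 (k • X) (k • θ) = k • fibreH (G z.1) C z.2 X θ :=
      fun X θ => by
        simp only [fibreH, map_smul, smul_eq_mul]
        module
    have h3 : ∀ X θ, fibreV (G z.1) C z.2 (k • X) (k • θ) = k • fibreV (G z.1) C z.2 X θ :=
      fun X θ => by
        simp only [fibreV, map_smul, smul_eq_mul]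
        module
    have h4 : (k • v).2 - z.2.comp (christoffelL G z.1 (k • v).1)
        = k • (v.2 - z.2.comp (christoffelL G z.1 v.1)) := by
      rw [Prod.smul_fst, Prod.smul_snd, h1, smul_sub]
    rw [h4, Prod.smul_fst, h2, h3, h1]
    ext1
    · rfl
    · simp only [Prod.smul_snd, RingHom.id_apply, smul_add]

variable [FiniteDimensional ℝ E]

/-- The natural tensor field `J` in the cotangent coordinates `z = (y, ξ)` of a metric `G`. -/
def localJ (G : E → E →L[ℝ] E →L[ℝ] ℝ) (C : Coefficients) (z : E × (E →L[ℝ] ℝ)) :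
    E × (E →L[ℝ] ℝ) →L[ℝ] E × (E →L[ℝ] ℝ) :=
  LinearMap.toContinuousLinearMap (localJLin G C z)

theorem localJ_apply (G : E → E →L[ℝ] E →L[ℝ] ℝ) (C : Coefficients) (z v : E × (E →L[ℝ] ℝ)) :
    localJ G C z v = (fibreH (G z.1) C z.2 v.1 (v.2 - z.2.comp (christoffelL G z.1 v.1)),
    fibreV (G z.1) C z.2 v.1 (v.2 - z.2.comp (christoffelL G z.1 v.1)) + z.2.comp
      (christoffelL G z.1 (fibreH (G z.1) C z.2 v.1 (v.2 - z.2.comp (christoffelL G z.1 v.1))))) :=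
  rfl

variable {G : E → E →L[ℝ] E →L[ℝ] ℝ} {U : Set E}

theorem IsMetricOn.fibreEnergy_nonneg (h : IsMetricOn G U) {y : E} (hy : y ∈ U) (ξ : E →L[ℝ] ℝ) :
    0 ≤ fibreEnergy (G y) ξ :=
  mul_nonneg (by norm_num) (h.apply_inverse_self_nonneg hy ξ)

theorem IsMetricOn.contDiffOn_localJ (h : IsMetricOn G U) (C : Coefficients) :
    ContDiffOn ℝ ∞ (localJ G C) (U ×ˢ Set.univ) := by
  rw [contDiffOn_clm_apply]
  intro v
  set W : Set (E × (E →L[ℝ] ℝ)) := U ×ˢ Set.univ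
  have hm : Set.MapsTo Prod.fst W U := fun z hz => hz.1
  have hfst : ContDiffOn ℝ ∞ (Prod.fst : E × (E →L[ℝ] ℝ) → E) W := contDiff_fst.contDiffOn
  have hξ : ContDiffOn ℝ ∞ (Prod.snd : E × (E →L[ℝ] ℝ) → E →L[ℝ] ℝ) W := contDiff_snd.contDiffOn
  have hG : ContDiffOn ℝ ∞ (fun z : E × (E →L[ℝ] ℝ) => G z.1) W := h.contDiffOn.comp hfst hm
  have hS : ContDiffOn ℝ ∞ (fun z : E × (E →L[ℝ] ℝ) => (G z.1).inverse) W :=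
    ContDiffOn.comp (g := fun y => (G y).inverse)
      (fun y hy => (h.contDiffAt_inverse hy).contDiffWithinAt) hfst hm
  have hΓ : ContDiffOn ℝ ∞ (fun z : E × (E →L[ℝ] ℝ) => christoffelL G z.1) W :=
    ContDiffOn.comp (g := christoffelL G)
      (fun y hy => (h.contDiffAt_christoffelL hy).contDiffWithinAt) hfst hm
  have ht : ContDiffOn ℝ ∞ (fun z : E × (E →L[ℝ] ℝ) => fibreEnergy (G z.1) z.2) W :=
    contDiffOn_const.mul (hξ.clm_apply (hS.clm_apply hξ))
  have ht0 : Set.MapsTo (fun z : E × (E →L[ℝ] ℝ) => fibreEnergy (G z.1) z.2) W (Set.Ici 0) :=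
    fun z hz => h.fibreEnergy_nonneg hz.1 z.2
  have a1 := C.smooth_a₁.comp ht ht0
  have a2 := C.smooth_a₂.comp ht ht0
  have a3 := C.smooth_a₃.comp ht ht0
  have a4 := C.smooth_a₄.comp ht ht0
  have b1 := C.smooth_b₁.comp ht ht0
  have b2 := C.smooth_b₂.comp ht ht0
  have b3 := C.smooth_b₃.comp ht ht0
  have b4 := C.smooth_b₄.comp ht ht0
  have hθ : ContDiffOn ℝ ∞
      (fun z : E × (E →L[ℝ] ℝ) => v.2 - z.2.comp (christoffelL G z.1 v.1)) W :=
    contDiffOn_const.sub (hξ.clm_comp (hΓ.clm_apply contDiffOn_const))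
  have hH : ContDiffOn ℝ ∞ (fun z : E × (E →L[ℝ] ℝ) => fibreH (G z.1) C z.2 v.1
      (v.2 - z.2.comp (christoffelL G z.1 v.1))) W :=
    (((a4.smul contDiffOn_const).add ((b4.mul (hξ.clm_apply contDiffOn_const)).smul
      (hS.clm_apply hξ))).sub (a2.smul (hS.clm_apply hθ))).sub
      ((b2.mul (hξ.clm_apply (hS.clm_apply hθ))).smul (hS.clm_apply hξ))
  have hV : ContDiffOn ℝ ∞ (fun z : E × (E →L[ℝ] ℝ) => fibreV (G z.1) C z.2 v.1
      (v.2 - z.2.comp (christoffelL G z.1 v.1))) W :=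
    (((a1.smul (hG.clm_apply contDiffOn_const)).add ((b1.mul (hξ.clm_apply contDiffOn_const)).smul
      hξ)).add (a3.smul hθ)).add ((b3.mul (hξ.clm_apply (hS.clm_apply hθ))).smul hξ)
  exact hH.prodMk (hV.add (hξ.clm_comp (hΓ.clm_apply hH)))

theorem IsMetricOn.differentiableAt_localJ (h : IsMetricOn G U) (C : Coefficients)
    {z : E × (E →L[ℝ] ℝ)} (hz : z.1 ∈ U) : DifferentiableAt ℝ (localJ G C) z :=
  ((h.contDiffOn_localJ C).contDiffAt
    ((h.isOpen.prod isOpen_univ).mem_nhds ⟨hz, Set.mem_univ _⟩)).differentiableAt (by simp)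

end LocalJ

/-! ### Derivatives of the natural tensor field on vertical vectors -/

section VerticalDerivative

set_option synthInstance.maxHeartbeats 200000

variable {E : Type*} [NormedAddCommGroup E] [NormedSpace ℝ E]

/-- Chain rule for a function on `[0, ∞)` composed with a nonnegative function `f`: the one-sided
derivative suffices, also where `f` vanishes. -/
theorem hasDerivAt_comp_nonneg {a : ℝ → ℝ} (ha : ContDiffOn ℝ ∞ a (Set.Ici 0)) {f : ℝ → ℝ}
    {f' s : ℝ} (hf : HasDerivAt f f' s) (h0 : ∀ᶠ r in nhds s, 0 ≤ f r) :
    HasDerivAt (fun r => a (f r)) (derivWithin a (Set.Ici 0) (f s) * f') s := by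
  have h1 : HasDerivWithinAt a (derivWithin a (Set.Ici 0) (f s)) (Set.Ici 0) (f s) :=
    ((ha.differentiableOn (by simp)) (f s) h0.self_of_nhds).hasDerivWithinAt
  have h2 := h1.comp (s := f ⁻¹' Set.Ici 0) s hf.hasDerivWithinAt (Set.mapsTo_preimage _ _)
  exact h2.hasDerivAt h0

/-- The derivative of the horizontal component of `J η^V` in the direction of the vertical vector
`ζ^V`. -/
def fibreDH (B : E →L[ℝ] E →L[ℝ] ℝ) (C : Coefficients) (ξ η ζ : E →L[ℝ] ℝ) : E :=
  -(derivWithin C.a₂ (Set.Ici 0) (fibreEnergy B ξ) * ζ (B.inverse ξ)) • B.inverse η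
    - (derivWithin C.b₂ (Set.Ici 0) (fibreEnergy B ξ) * ζ (B.inverse ξ) * ξ (B.inverse η)
      + C.b₂ (fibreEnergy B ξ) * ζ (B.inverse η)) • B.inverse ξ
    - (C.b₂ (fibreEnergy B ξ) * ξ (B.inverse η)) • B.inverse ζ

/-- The derivative of the vertical component of `J η^V` in the direction of the vertical vector
`ζ^V`. -/
def fibreDV (B : E →L[ℝ] E →L[ℝ] ℝ) (C : Coefficients) (ξ η ζ : E →L[ℝ] ℝ) : E →L[ℝ] ℝ :=
  (derivWithin C.a₃ (Set.Ici 0) (fibreEnergy B ξ) * ζ (B.inverse ξ)) • η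
    + (derivWithin C.b₃ (Set.Ici 0) (fibreEnergy B ξ) * ζ (B.inverse ξ) * ξ (B.inverse η)
      + C.b₃ (fibreEnergy B ξ) * ζ (B.inverse η)) • ξ
    + (C.b₃ (fibreEnergy B ξ) * ξ (B.inverse η)) • ζ

variable [FiniteDimensional ℝ E] {G : E → E →L[ℝ] E →L[ℝ] ℝ} {U : Set E}

namespace IsMetricOn

variable {c : ℝ → E} {p : ℝ → E →L[ℝ] ℝ} {s : ℝ} {u : E} {ζ : E →L[ℝ] ℝ}

/-- The derivative of `g⁻¹(p, η)` along a curve of covectors `p` with covariant derivative `ζ`, for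
a fixed covector `η`. -/
theorem hasDerivAt_inverse_apply (h : IsMetricOn G U) (hc : HasDerivAt c u s) (hy : c s ∈ U)
    (hp : HasDerivAt p (ζ + (p s).comp (christoffelL G (c s) u)) s) (η : E →L[ℝ] ℝ) :
    HasDerivAt (fun r => p r ((G (c r)).inverse η))
      (ζ ((G (c s)).inverse η)
        - p s ((G (c s)).inverse (η.comp (christoffelL G (c s) u)))) s := by
  refine (hp.clm_apply (h.hasDerivAt_inverse hc hy η)).congr_deriv ?_
  simp only [add_apply, ContinuousLinearMap.comp_apply, map_sub, map_neg]
  ring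

/-- The derivative of `p♯` along a curve of covectors `p` with covariant derivative `ζ`. -/
theorem hasDerivAt_inverse_covector (h : IsMetricOn G U) (hc : HasDerivAt c u s) (hy : c s ∈ U)
    (hp : HasDerivAt p (ζ + (p s).comp (christoffelL G (c s) u)) s) :
    HasDerivAt (fun r => (G (c r)).inverse (p r))
      ((G (c s)).inverse ζ - christoffelL G (c s) u ((G (c s)).inverse (p s))) s := by
  have hS : HasFDerivAt (fun z => (G z).inverse) _ (c s) :=
    ((h.contDiffAt_inverse hy).differentiableAt (by simp)).hasFDerivAt
  have h1 := hS.comp_hasDerivAt s hc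
  have h2 := (h1.clm_apply (hasDerivAt_const s (p s))).unique (h.hasDerivAt_inverse hc hy (p s))
  refine (h1.clm_apply hp).congr_deriv ?_
  simp only [map_zero, add_zero] at h2
  rw [h2]
  simp only [Function.comp_apply, map_add]
  abel

/-- The energy density changes only with the vertical part `ζ` of the velocity. -/
theorem hasDerivAt_fibreEnergy (h : IsMetricOn G U) (hc : HasDerivAt c u s) (hy : c s ∈ U)
    (hp : HasDerivAt p (ζ + (p s).comp (christoffelL G (c s) u)) s) :
    HasDerivAt (fun r => fibreEnergy (G (c r)) (p r)) (ζ ((G (c s)).inverse (p s))) s := by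
  refine ((hp.clm_apply (h.hasDerivAt_inverse_covector hc hy hp)).const_mul (1 / 2)).congr_deriv ?_
  simp only [add_apply, ContinuousLinearMap.comp_apply, map_sub]
  rw [h.apply_inverse_comm hy (p s) ζ]
  ring

theorem hasDerivAt_comp_fibreEnergy (h : IsMetricOn G U) (hc : HasDerivAt c u s) (hy : c s ∈ U)
    (hp : HasDerivAt p (ζ + (p s).comp (christoffelL G (c s) u)) s) {a : ℝ → ℝ}
    (ha : ContDiffOn ℝ ∞ a (Set.Ici 0)) :
    HasDerivAt (fun r => a (fibreEnergy (G (c r)) (p r)))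
      (derivWithin a (Set.Ici 0) (fibreEnergy (G (c s)) (p s)) * ζ ((G (c s)).inverse (p s)))
      s := by
  refine hasDerivAt_comp_nonneg ha (h.hasDerivAt_fibreEnergy hc hy hp) ?_
  filter_upwards [hc.continuousAt.preimage_mem_nhds (h.isOpen.mem_nhds hy)] with r hr
  exact h.fibreEnergy_nonneg hr (p r)

theorem hasDerivAt_fibreH (h : IsMetricOn G U) (hc : HasDerivAt c u s) (hy : c s ∈ U)
    (hp : HasDerivAt p (ζ + (p s).comp (christoffelL G (c s) u)) s) (C : Coefficients)
    (η : E →L[ℝ] ℝ) :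
    HasDerivAt (fun r => fibreH (G (c r)) C (p r) 0 η)
      (fibreDH (G (c s)) C (p s) η ζ - christoffelL G (c s) u (fibreH (G (c s)) C (p s) 0 η)
        - fibreH (G (c s)) C (p s) 0 (η.comp (christoffelL G (c s) u))) s := by
  have h1 := ((h.hasDerivAt_comp_fibreEnergy hc hy hp C.smooth_a₂).smul
    (h.hasDerivAt_inverse hc hy η)).neg.sub
    (((h.hasDerivAt_comp_fibreEnergy hc hy hp C.smooth_b₂).mul
    (h.hasDerivAt_inverse_apply hc hy hp η)).smul (h.hasDerivAt_inverse_covector hc hy hp))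
  have h2 : (fun r => fibreH (G (c r)) C (p r) 0 η) = fun r =>
      -(C.a₂ (fibreEnergy (G (c r)) (p r)) • (G (c r)).inverse η)
        - (C.b₂ (fibreEnergy (G (c r)) (p r)) * p r ((G (c r)).inverse η)) •
          (G (c r)).inverse (p r) := by
    funext r
    simp [fibreH]
  rw [h2]
  refine h1.congr_deriv ?_
  simp only [fibreH, fibreDH, Pi.mul_apply, map_sub, map_smul, map_zero, mul_zero, zero_smul,
    smul_zero, zero_add]
  module

theorem hasDerivAt_fibreV (h : IsMetricOn G U) (hc : HasDerivAt c u s) (hy : c s ∈ U)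
    (hp : HasDerivAt p (ζ + (p s).comp (christoffelL G (c s) u)) s) (C : Coefficients)
    (η : E →L[ℝ] ℝ) :
    HasDerivAt (fun r => fibreV (G (c r)) C (p r) 0 η)
      (fibreDV (G (c s)) C (p s) η ζ + (fibreV (G (c s)) C (p s) 0 η).comp (christoffelL G (c s) u)
        - fibreV (G (c s)) C (p s) 0 (η.comp (christoffelL G (c s) u))) s := by
  have h1 := ((h.hasDerivAt_comp_fibreEnergy hc hy hp C.smooth_a₃).smul
    (hasDerivAt_const s η)).add
    (((h.hasDerivAt_comp_fibreEnergy hc hy hp C.smooth_b₃).mul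
    (h.hasDerivAt_inverse_apply hc hy hp η)).smul hp)
  have h2 : (fun r => fibreV (G (c r)) C (p r) 0 η) = fun r =>
      C.a₃ (fibreEnergy (G (c r)) (p r)) • η
        + (C.b₃ (fibreEnergy (G (c r)) (p r)) * p r ((G (c r)).inverse η)) • p r := by
    funext r
    simp [fibreV]
  rw [h2]
  refine h1.congr_deriv ?_
  simp only [fibreV, fibreDV, Pi.mul_apply, map_zero, mul_zero, zero_smul, smul_zero, zero_add,
    ContinuousLinearMap.add_comp, ContinuousLinearMap.smul_comp]
  module

/-- The derivative of `J` in the direction `u^H + ζ^V`, applied to a vertical vector. -/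
theorem fderiv_localJ_vertical (h : IsMetricOn G U) (C : Coefficients) {y : E} (hy : y ∈ U)
    (ξ η ζ : E →L[ℝ] ℝ) (u : E) :
    fderiv ℝ (localJ G C) (y, ξ) (u, ζ + ξ.comp (christoffelL G y u)) (0, η) =
      (fibreDH (G y) C ξ η ζ - christoffelL G y u (fibreH (G y) C ξ 0 η)
        - fibreH (G y) C ξ 0 (η.comp (christoffelL G y u)),
      fibreDV (G y) C ξ η ζ + (fibreV (G y) C ξ 0 η).comp (christoffelL G y u)
        - fibreV (G y) C ξ 0 (η.comp (christoffelL G y u))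
        + (ζ + ξ.comp (christoffelL G y u)).comp (christoffelL G y (fibreH (G y) C ξ 0 η))
        + ξ.comp (fderiv ℝ (christoffelL G) y u (fibreH (G y) C ξ 0 η)
          + christoffelL G y (fibreDH (G y) C ξ η ζ - christoffelL G y u (fibreH (G y) C ξ 0 η)
        - fibreH (G y) C ξ 0 (η.comp (christoffelL G y u))))) := by
  set c : ℝ → E := fun r => y + r • u with hcdef
  set p : ℝ → E →L[ℝ] ℝ := fun r => ξ + r • (ζ + ξ.comp (christoffelL G y u)) with hpdef
  have c0 : c 0 = y := by simp [hcdef]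
  have p0 : p 0 = ξ := by simp [hpdef]
  have hc : HasDerivAt c u 0 :=
    (((hasDerivAt_id (0 : ℝ)).smul_const u).const_add y).congr_deriv (one_smul _ _)
  have hp : HasDerivAt p (ζ + (p 0).comp (christoffelL G (c 0) u)) 0 := by
    rw [c0, p0]
    exact (((hasDerivAt_id (0 : ℝ)).smul_const
      (ζ + ξ.comp (christoffelL G y u))).const_add ξ).congr_deriv (one_smul _ _)
  have hy' : c 0 ∈ U := by rwa [c0]
  have h1 := h.hasDerivAt_fibreH hc hy' hp C η
  have h2 := h.hasDerivAt_fibreV hc hy' hp C η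
  have h3 := (h.hasFDerivAt_christoffelL hy').comp_hasDerivAt 0 hc
  have h4 := h1.prodMk (h2.add (hp.clm_comp (h3.clm_apply h1)))
  have h5 : HasFDerivAt (localJ G C) (fderiv ℝ (localJ G C) (c 0, p 0)) (c 0, p 0) :=
    (h.differentiableAt_localJ C hy').hasFDerivAt
  have h6 := (h5.comp_hasDerivAt (0 : ℝ) (hc.prodMk hp)).clm_apply
    (hasDerivAt_const (0 : ℝ) ((0, η) : E × (E →L[ℝ] ℝ)))
  have h7 : (fun r => localJ G C (c r, p r) (0, η)) = fun r =>
      (fibreH (G (c r)) C (p r) 0 η, fibreV (G (c r)) C (p r) 0 η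
        + (p r).comp (christoffelL G (c r) (fibreH (G (c r)) C (p r) 0 η))) := by
    funext r
    simp [localJ_apply]
  simp only [Function.comp_def] at h6 h4
  rw [h7] at h6
  have h8 := h6.unique h4
  simp only [c0, p0, map_zero, add_zero] at h8
  rw [h8]
  ext1
  · rfl
  · simp only []
    abel

end IsMetricOn

end VerticalDerivative

/-! ### The Nijenhuis tensor on vertical vectors -/

section VerticalNijenhuis

set_option synthInstance.maxHeartbeats 200000

variable {E : Type*} [NormedAddCommGroup E] [NormedSpace ℝ E]

/-- The coefficient of the horizontal part of `N(θ^V, η^V)` in the direction of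
`g⁻¹(p, θ) η♯ - g⁻¹(p, η) θ♯`. -/
def horizontalCoeff (C : Coefficients) (t : ℝ) : ℝ :=
  C.a₄ t * (derivWithin C.a₂ (Set.Ici 0) t - C.b₂ t)
    + C.a₂ t * (derivWithin C.a₃ (Set.Ici 0) t - C.b₃ t)
    - C.a₃ t * (derivWithin C.a₂ (Set.Ici 0) t - C.b₂ t)
    - 2 * t * C.b₃ t * derivWithin C.a₂ (Set.Ici 0) t

/-- The coefficient of the curvature-free vertical part of `N(θ^V, η^V)` in the direction of
`g⁻¹(p, θ) η - g⁻¹(p, η) θ`. -/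
def verticalCoeff (C : Coefficients) (t : ℝ) : ℝ :=
  2 * t * C.b₃ t * derivWithin C.a₃ (Set.Ici 0) t
    + C.a₁ t * (derivWithin C.a₂ (Set.Ici 0) t - C.b₂ t)

/-- The covector `g⁻¹(p, θ) η - g⁻¹(p, η) θ`, which is orthogonal to `p`. -/
def fibreWedge (B : E →L[ℝ] E →L[ℝ] ℝ) (ξ θ η : E →L[ℝ] ℝ) : E →L[ℝ] ℝ :=
  ξ (B.inverse θ) • η - ξ (B.inverse η) • θ

theorem two_mul_fibreEnergy (B : E →L[ℝ] E →L[ℝ] ℝ) (ξ : E →L[ℝ] ℝ) :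
    ξ (B.inverse ξ) = 2 * fibreEnergy B ξ := by
  simp only [fibreEnergy]
  ring

theorem fibreWedge_orthogonal (B : E →L[ℝ] E →L[ℝ] ℝ) (ξ θ η : E →L[ℝ] ℝ) :
    ξ (B.inverse (fibreWedge B ξ θ η)) = 0 := by
  simp only [fibreWedge, map_sub, map_smul, smul_eq_mul]
  ring

theorem fibreDH_antisymm {B : E →L[ℝ] E →L[ℝ] ℝ} (C : Coefficients) (ξ : E →L[ℝ] ℝ)
    {θ η : E →L[ℝ] ℝ} (hB : ∀ α β : E →L[ℝ] ℝ, α (B.inverse β) = β (B.inverse α)) :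
    fibreDH B C ξ θ η - fibreDH B C ξ η θ =
      (derivWithin C.a₂ (Set.Ici 0) (fibreEnergy B ξ) - C.b₂ (fibreEnergy B ξ)) •
        B.inverse (fibreWedge B ξ θ η) := by
  simp only [fibreDH, fibreWedge, map_sub, map_smul, hB η ξ, hB θ ξ, hB η θ]
  module

theorem fibreDV_antisymm {B : E →L[ℝ] E →L[ℝ] ℝ} (C : Coefficients) (ξ : E →L[ℝ] ℝ)
    {θ η : E →L[ℝ] ℝ} (hB : ∀ α β : E →L[ℝ] ℝ, α (B.inverse β) = β (B.inverse α)) :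
    fibreDV B C ξ θ η - fibreDV B C ξ η θ =
      -((derivWithin C.a₃ (Set.Ici 0) (fibreEnergy B ξ) - C.b₃ (fibreEnergy B ξ)) •
        fibreWedge B ξ θ η) := by
  simp only [fibreDV, fibreWedge, hB η ξ, hB θ ξ, hB η θ]
  module

theorem fibreDH_fibreV_antisymm {B : E →L[ℝ] E →L[ℝ] ℝ} (C : Coefficients) (ξ : E →L[ℝ] ℝ)
    {θ η : E →L[ℝ] ℝ} (hB : ∀ α β : E →L[ℝ] ℝ, α (B.inverse β) = β (B.inverse α)) :
    fibreDH B C ξ η (fibreV B C ξ 0 θ) - fibreDH B C ξ θ (fibreV B C ξ 0 η) =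
      -(C.a₃ (fibreEnergy B ξ) *
          (derivWithin C.a₂ (Set.Ici 0) (fibreEnergy B ξ) - C.b₂ (fibreEnergy B ξ))
        + 2 * fibreEnergy B ξ * C.b₃ (fibreEnergy B ξ)
          * derivWithin C.a₂ (Set.Ici 0) (fibreEnergy B ξ)) •
        B.inverse (fibreWedge B ξ θ η) := by
  simp only [fibreDH, fibreV, fibreWedge, map_sub, map_add, map_smul, map_zero, mul_zero,
    zero_smul, smul_zero, zero_add, add_apply, smul_apply, smul_eq_mul, hB η ξ, hB θ ξ, hB η θ,
    two_mul_fibreEnergy]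
  module

theorem fibreDV_fibreV_antisymm {B : E →L[ℝ] E →L[ℝ] ℝ} (C : Coefficients) (ξ : E →L[ℝ] ℝ)
    {θ η : E →L[ℝ] ℝ} (hB : ∀ α β : E →L[ℝ] ℝ, α (B.inverse β) = β (B.inverse α)) :
    fibreDV B C ξ η (fibreV B C ξ 0 θ) - fibreDV B C ξ θ (fibreV B C ξ 0 η) =
      (C.a₃ (fibreEnergy B ξ) *
          (derivWithin C.a₃ (Set.Ici 0) (fibreEnergy B ξ) - C.b₃ (fibreEnergy B ξ))
        + 2 * fibreEnergy B ξ * C.b₃ (fibreEnergy B ξ)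
          * derivWithin C.a₃ (Set.Ici 0) (fibreEnergy B ξ)) • fibreWedge B ξ θ η := by
  simp only [fibreDV, fibreV, fibreWedge, map_zero, mul_zero,
    zero_smul, smul_zero, zero_add, add_apply, smul_apply, smul_eq_mul, hB η ξ, hB θ ξ, hB η θ,
    two_mul_fibreEnergy]
  module

variable [FiniteDimensional ℝ E] {G : E → E →L[ℝ] E →L[ℝ] ℝ} {U : Set E}

theorem localJ_horizontal_add_vertical (C : Coefficients) (y X : E) (ξ θ : E →L[ℝ] ℝ) :
    localJ G C (y, ξ) (X, θ + ξ.comp (christoffelL G y X)) =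
      (fibreH (G y) C ξ X θ,
        fibreV (G y) C ξ X θ + ξ.comp (christoffelL G y (fibreH (G y) C ξ X θ))) := by
  rw [localJ_apply]
  simp only [add_sub_cancel_right]

/-- The Nijenhuis tensor on two vertical vectors. The last term of the second component belongs to
the horizontal lift of the first component; the curvature comes from the derivatives of the
Christoffel symbols. -/
theorem IsMetricOn.flatNijenhuis_localJ_vertical (h : IsMetricOn G U) (C : Coefficients) {y : E}
    (hy : y ∈ U) (ξ θ η : E →L[ℝ] ℝ) :
    (flatNijenhuis (localJ G C) (y, ξ) (0, θ) (0, η)).1 =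
      horizontalCoeff C (fibreEnergy (G y) ξ) • (G y).inverse (fibreWedge (G y) ξ θ η) ∧
    ∀ w, (flatNijenhuis (localJ G C) (y, ξ) (0, θ) (0, η)).2 w =
      verticalCoeff C (fibreEnergy (G y) ξ) * fibreWedge (G y) ξ θ η w
      + ξ (localCurvature G y (fibreH (G y) C ξ 0 θ) (fibreH (G y) C ξ 0 η) w)
      + ξ (christoffelL G y (horizontalCoeff C (fibreEnergy (G y) ξ) •
          (G y).inverse (fibreWedge (G y) ξ θ η)) w) := by
  have hB := h.apply_inverse_comm hy
  have hJv : ∀ α : E →L[ℝ] ℝ, localJ G C (y, ξ) (0, α) = (fibreH (G y) C ξ 0 α,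
      fibreV (G y) C ξ 0 α + ξ.comp (christoffelL G y (fibreH (G y) C ξ 0 α))) := fun α => by
    have := localJ_horizontal_add_vertical (G := G) C y 0 ξ α
    simpa using this
  have hD0 : ∀ α β : E →L[ℝ] ℝ, fderiv ℝ (localJ G C) (y, ξ) (0, β) (0, α) =
      (fibreDH (G y) C ξ α β, (fibreDV (G y) C ξ α β
        + β.comp (christoffelL G y (fibreH (G y) C ξ 0 α)))
        + ξ.comp (christoffelL G y (fibreDH (G y) C ξ α β))) := fun α β => by
    have := h.fderiv_localJ_vertical C hy ξ α β 0
    simp only [map_zero, ContinuousLinearMap.comp_zero, add_zero, zero_apply, sub_zero] at this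
    rw [this]
    ext1
    · simp [fibreH]
    · simp [fibreV, fibreH]
  -- the combination of the two `J`-terms, split into its horizontal and vertical parts
  have hcomb : localJ G C (y, ξ) (fderiv ℝ (localJ G C) (y, ξ) (0, η) (0, θ))
      - localJ G C (y, ξ) (fderiv ℝ (localJ G C) (y, ξ) (0, θ) (0, η)) =
      localJ G C (y, ξ) (fibreDH (G y) C ξ θ η - fibreDH (G y) C ξ η θ,
        (fibreDV (G y) C ξ θ η - fibreDV (G y) C ξ η θ)
        + ξ.comp (christoffelL G y (fibreDH (G y) C ξ θ η - fibreDH (G y) C ξ η θ)))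
      + localJ G C (y, ξ) (0, η.comp (christoffelL G y (fibreH (G y) C ξ 0 θ)))
      - localJ G C (y, ξ) (0, θ.comp (christoffelL G y (fibreH (G y) C ξ 0 η))) := by
    rw [hD0, hD0, ← map_sub, ← map_add, ← map_sub]
    congr 1
    ext1
    · simp
    · simp only [Prod.snd_sub, Prod.snd_add, map_sub, ContinuousLinearMap.comp_sub]
      abel
  have hD := fun α β => h.fderiv_localJ_vertical C hy ξ β (fibreV (G y) C ξ 0 α)
    (fibreH (G y) C ξ 0 α)
  have key : flatNijenhuis (localJ G C) (y, ξ) (0, θ) (0, η) =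
      fderiv ℝ (localJ G C) (y, ξ) (localJ G C (y, ξ) (0, θ)) (0, η)
      - fderiv ℝ (localJ G C) (y, ξ) (localJ G C (y, ξ) (0, η)) (0, θ)
      + (localJ G C (y, ξ) (fderiv ℝ (localJ G C) (y, ξ) (0, η) (0, θ))
      - localJ G C (y, ξ) (fderiv ℝ (localJ G C) (y, ξ) (0, θ) (0, η))) := by
    simp only [flatNijenhuis]
    abel
  have h1 : (flatNijenhuis (localJ G C) (y, ξ) (0, θ) (0, η)).1 =
      horizontalCoeff C (fibreEnergy (G y) ξ) • (G y).inverse (fibreWedge (G y) ξ θ η) := by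
    have e1 := fibreDH_fibreV_antisymm C ξ (θ := θ) (η := η) hB
    rw [key, hcomb, localJ_horizontal_add_vertical, hJv, hJv, hJv, hJv, hD, hD,
      fibreDH_antisymm C ξ hB, fibreDV_antisymm C ξ hB]
    simp only [Prod.fst_sub, Prod.fst_add]
    rw [h.christoffel_symm hy (fibreH (G y) C ξ 0 η) (fibreH (G y) C ξ 0 θ)]
    have e2 : ∀ k l : ℝ, fibreH (G y) C ξ (k • (G y).inverse (fibreWedge (G y) ξ θ η))
        (-(l • fibreWedge (G y) ξ θ η)) =
        (C.a₄ (fibreEnergy (G y) ξ) * k + C.a₂ (fibreEnergy (G y) ξ) * l) •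
          (G y).inverse (fibreWedge (G y) ξ θ η) := fun k l => by
      simp only [fibreH, map_neg, map_smul, fibreWedge_orthogonal]
      module
    rw [e2, sub_eq_iff_eq_add.1 e1]
    simp only [horizontalCoeff]
    module
  refine ⟨h1, fun w => ?_⟩
  rw [← h1]
  have e1 := fibreDV_fibreV_antisymm C ξ (θ := θ) (η := η) hB
  have e3 : ∀ k l : ℝ, fibreV (G y) C ξ (k • (G y).inverse (fibreWedge (G y) ξ θ η))
      (-(l • fibreWedge (G y) ξ θ η)) =
      (C.a₁ (fibreEnergy (G y) ξ) * k - C.a₃ (fibreEnergy (G y) ξ) * l) •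
        fibreWedge (G y) ξ θ η := fun k l => by
    simp only [fibreV, map_neg, map_smul, fibreWedge_orthogonal, h.apply_inverse hy]
    module
  rw [key, hcomb, localJ_horizontal_add_vertical, hJv, hJv, hJv, hJv, hD, hD,
    fibreDH_antisymm C ξ hB, fibreDV_antisymm C ξ hB]
  simp only [Prod.snd_sub, Prod.snd_add, Prod.fst_sub, Prod.fst_add]
  rw [e3, sub_eq_iff_eq_add.1 e1]
  simp only [localCurvature, verticalCoeff, add_apply, sub_apply, smul_apply, smul_eq_mul,
    ContinuousLinearMap.comp_apply, map_add, map_sub]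
  rw [h.christoffel_symm hy (fibreH (G y) C ξ 0 η) (fibreH (G y) C ξ 0 θ)]
  ring

end VerticalNijenhuis

/-! ### Consequences of the coefficient equations -/

section CoefficientEquations

/-- A homogeneous linear system of two ordinary differential equations: a solution which vanishes
at the right end of an interval vanishes at its left end. -/
theorem linear_system_eq_zero_left {f g f' g' k₁ k₂ k₃ k₄ : ℝ → ℝ} {a b : ℝ} (hab : a ≤ b)
    (hf : ∀ t ∈ Set.Icc a b, HasDerivAt f (f' t) t) (hg : ∀ t ∈ Set.Icc a b, HasDerivAt g (g' t) t)
    (hk₁ : ContinuousOn k₁ (Set.Icc a b)) (hk₂ : ContinuousOn k₂ (Set.Icc a b))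
    (hk₃ : ContinuousOn k₃ (Set.Icc a b)) (hk₄ : ContinuousOn k₄ (Set.Icc a b))
    (hf' : ∀ t ∈ Set.Icc a b, f' t = k₁ t * f t + k₂ t * g t)
    (hg' : ∀ t ∈ Set.Icc a b, g' t = k₃ t * f t + k₄ t * g t)
    (hfb : f b = 0) (hgb : g b = 0) : f a = 0 ∧ g a = 0 := by
  have bound : ∀ k : ℝ → ℝ, ContinuousOn k (Set.Icc a b) →
      ∃ M : ℝ, 0 ≤ M ∧ ∀ t ∈ Set.Icc a b, |k t| ≤ M := fun k hk => by
    obtain ⟨M, hM⟩ := isCompact_Icc.exists_bound_of_continuousOn hk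
    exact ⟨max M 0, le_max_right _ _, fun t ht => (hM t ht).trans (le_max_left _ _)⟩
  obtain ⟨M₁, h₁, hM₁⟩ := bound _ hk₁
  obtain ⟨M₂, h₂, hM₂⟩ := bound _ hk₂
  obtain ⟨M₃, h₃, hM₃⟩ := bound _ hk₃
  obtain ⟨M₄, h₄, hM₄⟩ := bound _ hk₄
  set M := 2 * (M₁ + M₂ + M₃ + M₄)
  set F : ℝ → ℝ := fun t => Real.exp (M * t) * (f t ^ 2 + g t ^ 2)
  have hF : ∀ t ∈ Set.Icc a b, HasDerivAt F (Real.exp (M * t) * M * (f t ^ 2 + g t ^ 2)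
      + Real.exp (M * t) * (2 * f t * f' t + 2 * g t * g' t)) t := fun t ht => by
    have h1 : HasDerivAt (fun t => Real.exp (M * t)) (Real.exp (M * t) * M) t := by
      simpa using ((hasDerivAt_id t).const_mul M).exp
    have h2 := ((hf t ht).pow 2).add ((hg t ht).pow 2)
    refine (h1.mul h2).congr_deriv ?_
    simp
  have hmono : MonotoneOn F (Set.Icc a b) := by
    refine monotoneOn_of_deriv_nonneg (convex_Icc a b)
      (fun t ht => (hF t ht).continuousAt.continuousWithinAt)
      (fun t ht => (hF t (interior_subset ht)).differentiableAt.differentiableWithinAt)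
      fun t ht => ?_
    have ht' := interior_subset ht
    rw [(hF t ht').deriv, hf' t ht', hg' t ht']
    have key : ∀ (k K x y : ℝ), |k| ≤ K → -(K * (x ^ 2 + y ^ 2)) ≤ 2 * (k * (x * y)) := by
      intro k K x y hk
      have h1 : |k * (x * y)| ≤ K * |x * y| := by
        rw [abs_mul]; exact mul_le_mul_of_nonneg_right hk (abs_nonneg _)
      have h2 : 2 * |x * y| ≤ x ^ 2 + y ^ 2 := by
        rw [abs_mul]
        nlinarith [sq_nonneg (|x| - |y|), sq_abs x, sq_abs y]
      have h3 := neg_abs_le (k * (x * y))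
      have h4 : 0 ≤ K := (abs_nonneg k).trans hk
      nlinarith
    have e1 := key _ _ (f t) (f t) (hM₁ t ht')
    have e2 := key _ _ (f t) (g t) (hM₂ t ht')
    have e3 := key _ _ (f t) (g t) (hM₃ t ht')
    have e4 := key _ _ (g t) (g t) (hM₄ t ht')
    have e5 : 0 ≤ M * (f t ^ 2 + g t ^ 2) + (2 * f t * (k₁ t * f t + k₂ t * g t)
        + 2 * g t * (k₃ t * f t + k₄ t * g t)) := by
      simp only [M]
      nlinarith [mul_nonneg h₁ (sq_nonneg (g t)), mul_nonneg h₄ (sq_nonneg (f t)),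
        mul_nonneg h₂ (add_nonneg (sq_nonneg (f t)) (sq_nonneg (g t))),
        mul_nonneg h₃ (add_nonneg (sq_nonneg (f t)) (sq_nonneg (g t)))]
    have := mul_nonneg (Real.exp_pos (M * t)).le e5
    linarith
  have h1 : F a ≤ F b := hmono (Set.left_mem_Icc.2 hab) (Set.right_mem_Icc.2 hab) hab
  have h2 : F b = 0 := by simp [F, hfb, hgb]
  have h3 : f a ^ 2 + g a ^ 2 ≤ 0 := by
    by_contra h
    push Not at h
    have := mul_pos (Real.exp_pos (M * a)) h
    linarith
  constructor <;> nlinarith [sq_nonneg (f a), sq_nonneg (g a)]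

/-- A function continuous on `[0, ∞)` and zero on `(0, s]` vanishes at `0`. -/
theorem eq_zero_at_zero_of_continuousOn {f : ℝ → ℝ} (hf : ContinuousOn f (Set.Ici 0)) {s : ℝ}
    (hs : 0 < s) (h : ∀ t, 0 < t → t ≤ s → f t = 0) : f 0 = 0 := by
  have h1 : Filter.Tendsto f (nhdsWithin 0 (Set.Ioi 0)) (nhds (f 0)) :=
    (hf 0 Set.self_mem_Ici).mono_left (nhdsWithin_mono _ Set.Ioi_subset_Ici_self)
  have h2 : Filter.Tendsto f (nhdsWithin 0 (Set.Ioi 0)) (nhds 0) := by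
    refine tendsto_const_nhds.congr' ?_
    filter_upwards [Ioc_mem_nhdsGT hs] with t ht using (h t ht.1 ht.2).symm
  exact tendsto_nhds_unique h1 h2

namespace Coefficients

/-- The relations between the coefficients which express `J² = -1`. -/
structure IsComplex (C : Coefficients) : Prop where
  a₄_eq : ∀ t, 0 ≤ t → C.a₄ t = -C.a₃ t
  a₁_mul_a₂ : ∀ t, 0 ≤ t → C.a₁ t * C.a₂ t = 1 + C.a₃ t ^ 2
  mul_eq : ∀ t, 0 ≤ t → (C.a₁ t + 2 * t * C.b₁ t) * (C.a₂ t + 2 * t * C.b₂ t) =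
    1 + (C.a₃ t + 2 * t * C.b₃ t) ^ 2

/-- The equations on the coefficients which make the Nijenhuis tensor of `J` vanish, when the base
has constant sectional curvature `c`. -/
def Integrability (C : Coefficients) (c t : ℝ) : Prop :=
  horizontalCoeff C t = 0 ∧ verticalCoeff C t + c * C.a₂ t * (C.a₂ t + 2 * t * C.b₂ t) = 0

/-- The common denominator of the coefficients `b₁`, `b₂`, `b₃` of an integrable structure. -/
def denom (C : Coefficients) (c t : ℝ) : ℝ :=
  C.a₁ t - 2 * t * derivWithin C.a₁ (Set.Ici 0) t - 2 * c * t * C.a₂ t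
    - 4 * c * t ^ 2 * derivWithin C.a₂ (Set.Ici 0) t

variable {C : Coefficients} {c t : ℝ}

theorem hasDerivWithinAt {a : ℝ → ℝ} (ha : ContDiffOn ℝ ∞ a (Set.Ici 0)) (ht : 0 ≤ t) :
    HasDerivWithinAt a (derivWithin a (Set.Ici 0) t) (Set.Ici 0) t :=
  ((ha.differentiableOn (by simp)) t ht).hasDerivWithinAt

theorem continuousOn_derivWithin {a : ℝ → ℝ} (ha : ContDiffOn ℝ ∞ a (Set.Ici 0)) :
    ContinuousOn (derivWithin a (Set.Ici 0)) (Set.Ici 0) :=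
  ha.continuousOn_derivWithin (uniqueDiffOn_Ici 0) (by simp)

theorem IsComplex.a₁_ne_zero (h : C.IsComplex) (ht : 0 ≤ t) : C.a₁ t ≠ 0 := by
  intro h0
  have := h.a₁_mul_a₂ t ht
  rw [h0] at this
  nlinarith [sq_nonneg (C.a₃ t)]

theorem IsComplex.a₂_ne_zero (h : C.IsComplex) (ht : 0 ≤ t) : C.a₂ t ≠ 0 := by
  intro h0
  have := h.a₁_mul_a₂ t ht
  rw [h0] at this
  nlinarith [sq_nonneg (C.a₃ t)]

theorem IsComplex.a₂_add_ne_zero (h : C.IsComplex) (ht : 0 ≤ t) :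
    C.a₂ t + 2 * t * C.b₂ t ≠ 0 := by
  intro h0
  have := h.mul_eq t ht
  rw [h0] at this
  nlinarith [sq_nonneg (C.a₃ t + 2 * t * C.b₃ t)]

/-- The relation `a₁a₂ = 1 + a₃²`, differentiated. -/
theorem IsComplex.deriv_eq (h : C.IsComplex) (ht : 0 ≤ t) :
    derivWithin C.a₁ (Set.Ici 0) t * C.a₂ t + C.a₁ t * derivWithin C.a₂ (Set.Ici 0) t =
      2 * C.a₃ t * derivWithin C.a₃ (Set.Ici 0) t := by
  have h1 := (hasDerivWithinAt C.smooth_a₁ ht).mul (hasDerivWithinAt C.smooth_a₂ ht)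
  have h2 := ((hasDerivWithinAt C.smooth_a₃ ht).pow 2).const_add 1
  have h3 := h2.congr (f₁ := C.a₁ * C.a₂) (fun s hs => h.a₁_mul_a₂ s hs) (h.a₁_mul_a₂ t ht)
  have h4 := (uniqueDiffOn_Ici (0 : ℝ) t ht).eq_deriv _ h1 h3
  rw [h4]
  simp

/-- The equations for `b₂` and `b₃` are solved by Cramer's rule; after multiplication by the
denominator, both are combinations of the formulas and of the derivative of `a₁a₂ = 1 + a₃²`. -/
theorem integrability_of_formulas (h : C.IsComplex) (ht : 0 ≤ t) (hD : C.denom c t ≠ 0)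
    (h₂ : C.b₂ t * C.denom c t = 2 * t * derivWithin C.a₃ (Set.Ici 0) t ^ 2
      - 2 * t * derivWithin C.a₁ (Set.Ici 0) t * derivWithin C.a₂ (Set.Ici 0) t + c * C.a₂ t ^ 2
      + 2 * c * t * C.a₂ t * derivWithin C.a₂ (Set.Ici 0) t
      + C.a₁ t * derivWithin C.a₂ (Set.Ici 0) t)
    (h₃ : C.b₃ t * C.denom c t = C.a₁ t * derivWithin C.a₃ (Set.Ici 0) t
      + 2 * c * C.a₂ t * C.a₃ t + 4 * c * t * derivWithin C.a₂ (Set.Ici 0) t * C.a₃ t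
      - 2 * c * t * C.a₂ t * derivWithin C.a₃ (Set.Ici 0) t) : C.Integrability c t := by
  have r := h.deriv_eq ht
  constructor
  · apply (mul_eq_zero.1 (?_ : C.denom c t * _ = 0)).resolve_left hD
    simp only [horizontalCoeff, h.a₄_eq t ht]
    simp only [denom] at h₂ h₃ ⊢
    linear_combination 2 * C.a₃ t * h₂
      - (C.a₂ t + 2 * t * derivWithin C.a₂ (Set.Ici 0) t) * h₃
      - 2 * t * derivWithin C.a₃ (Set.Ici 0) t * r
  · apply (mul_eq_zero.1 (?_ : C.denom c t * _ = 0)).resolve_left hD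
    simp only [verticalCoeff]
    simp only [denom] at h₂ h₃ ⊢
    linear_combination 2 * t * derivWithin C.a₃ (Set.Ici 0) t * h₃
      + (2 * t * c * C.a₂ t - C.a₁ t) * h₂
      - c * (2 * t * C.a₂ t + 4 * t ^ 2 * derivWithin C.a₂ (Set.Ici 0) t) * r

theorem Integrability.b₂_mul_denom (hI : C.Integrability c t) (h : C.IsComplex) (ht : 0 ≤ t) :
    C.b₂ t * C.denom c t = 2 * t * derivWithin C.a₃ (Set.Ici 0) t ^ 2
      - 2 * t * derivWithin C.a₁ (Set.Ici 0) t * derivWithin C.a₂ (Set.Ici 0) t + c * C.a₂ t ^ 2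
      + 2 * c * t * C.a₂ t * derivWithin C.a₂ (Set.Ici 0) t
      + C.a₁ t * derivWithin C.a₂ (Set.Ici 0) t := by
  have r := h.deriv_eq ht
  obtain ⟨h1, h2⟩ := hI
  simp only [horizontalCoeff, verticalCoeff, h.a₄_eq t ht] at h1 h2
  apply mul_left_cancel₀ (h.a₂_ne_zero ht)
  simp only [denom]
  linear_combination -(2 * t * derivWithin C.a₃ (Set.Ici 0) t) * h1
    - (C.a₂ t + 2 * t * derivWithin C.a₂ (Set.Ici 0) t) * h2
    + (-2 * t * C.b₂ t + 2 * t * derivWithin C.a₂ (Set.Ici 0) t) * r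

theorem Integrability.b₃_mul_denom (hI : C.Integrability c t) (h : C.IsComplex) (ht : 0 ≤ t) :
    C.b₃ t * C.denom c t = C.a₁ t * derivWithin C.a₃ (Set.Ici 0) t
      + 2 * c * C.a₂ t * C.a₃ t + 4 * c * t * derivWithin C.a₂ (Set.Ici 0) t * C.a₃ t
      - 2 * c * t * C.a₂ t * derivWithin C.a₃ (Set.Ici 0) t := by
  have r := h.deriv_eq ht
  obtain ⟨h1, h2⟩ := hI
  simp only [horizontalCoeff, verticalCoeff, h.a₄_eq t ht] at h1 h2
  apply mul_left_cancel₀ (h.a₂_ne_zero ht)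
  simp only [denom]
  linear_combination -(C.a₁ t - 2 * t * c * C.a₂ t) * h1 - 2 * C.a₃ t * h2 - 2 * t * C.b₃ t * r

/-- The value of `b₁`, for positive `t`: it follows from those of `b₂` and `b₃` and from
`(a₁ + 2tb₁)(a₂ + 2tb₂) = 1 + (a₃ + 2tb₃)²`. -/
theorem Integrability.b₁_mul_denom_of_pos (hI : C.Integrability c t) (h : C.IsComplex) (ht : 0 < t)
    (hD : C.denom c t ≠ 0) :
    C.b₁ t * C.denom c t = 2 * c ^ 2 * t * C.a₂ t ^ 2
      + 2 * c * t * C.a₁ t * derivWithin C.a₂ (Set.Ici 0) t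
      + C.a₁ t * derivWithin C.a₁ (Set.Ici 0) t - c + 3 * c * C.a₃ t ^ 2 := by
  have r := h.deriv_eq ht.le
  have h2 := hI.b₂_mul_denom h ht.le
  have h3 := hI.b₃_mul_denom h ht.le
  have h0 := h.a₁_mul_a₂ t ht.le
  have h1 := h.mul_eq t ht.le
  have hne := mul_ne_zero (mul_ne_zero hD (mul_ne_zero two_ne_zero ht.ne')) (h.a₂_add_ne_zero ht.le)
  have ha := h.a₁_ne_zero ht.le
  apply mul_left_cancel₀ hne
  set D := C.denom c t with hDdef
  simp only [denom] at hDdef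
  generalize derivWithin C.a₁ (Set.Ici 0) t = d1 at *
  generalize derivWithin C.a₂ (Set.Ici 0) t = d2 at *
  generalize derivWithin C.a₃ (Set.Ici 0) t = d3 at *
  generalize C.a₁ t = a1 at *
  generalize C.a₂ t = a2 at *
  generalize C.a₃ t = a3 at *
  generalize C.b₁ t = b1 at *
  generalize C.b₂ t = b2 at *
  generalize C.b₃ t = b3 at *
  -- the given values of `b₁`, `b₂`, `b₃` satisfy the same quadratic relation, identically
  have key : (a1 * D + 2 * t * (2 * c ^ 2 * t * a2 ^ 2 + 2 * c * t * a1 * d2 + a1 * d1 - c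
      + 3 * c * a3 ^ 2)) * (a2 * D + 2 * t * (2 * t * d3 ^ 2 - 2 * t * d1 * d2 + c * a2 ^ 2
      + 2 * c * t * a2 * d2 + a1 * d2)) = D ^ 2 + (a3 * D + 2 * t * (a1 * d3 + 2 * c * a2 * a3
      + 4 * c * t * d2 * a3 - 2 * c * t * a2 * d3)) ^ 2 := by
    have e2 : a2 = (1 + a3 ^ 2) / a1 := by field_simp; linarith
    have e3 : d2 = (2 * a3 * d3 - d1 * a2) / a1 := by field_simp; linarith
    rw [hDdef, e3, e2]
    field_simp
    ring
  rw [← h2, ← h3] at key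
  linear_combination D ^ 2 * h1 - key

/-- At a zero of the denominator, `a₃` and `a₁ - 2cta₂` vanish. -/
theorem Integrability.of_denom_eq_zero (hI : C.Integrability c t) (h : C.IsComplex) (ht : 0 ≤ t)
    (hD : C.denom c t = 0) : C.a₃ t = 0 ∧ C.a₁ t - 2 * c * t * C.a₂ t = 0 := by
  have r := h.deriv_eq ht
  have h0 := h.a₁_mul_a₂ t ht
  have hα := h.a₂_add_ne_zero ht
  have ha := h.a₁_ne_zero ht
  obtain ⟨h1, h2⟩ := hI
  simp only [horizontalCoeff, verticalCoeff, h.a₄_eq t ht, denom] at h1 h2 hD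
  generalize derivWithin C.a₁ (Set.Ici 0) t = d1 at *
  generalize derivWithin C.a₂ (Set.Ici 0) t = d2 at *
  generalize derivWithin C.a₃ (Set.Ici 0) t = d3 at *
  generalize C.a₁ t = a1 at *
  generalize C.a₂ t = a2 at *
  generalize C.a₃ t = a3 at *
  generalize C.b₂ t = b2 at *
  generalize C.b₃ t = b3 at *
  -- the two equations and `D = 0`, in terms of `s = a₂ + 2ta₂'` and `e = 2ta₃'`
  obtain ⟨s, hs⟩ : ∃ s, s = a2 + 2 * t * d2 := ⟨_, rfl⟩
  obtain ⟨e, he⟩ : ∃ e, e = 2 * t * d3 := ⟨_, rfl⟩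
  obtain ⟨β, hβ⟩ : ∃ β, β = a3 + 2 * t * b3 := ⟨_, rfl⟩
  obtain ⟨α, hα'⟩ : ∃ α, α = a2 + 2 * t * b2 := ⟨_, rfl⟩
  rw [← hα'] at hα
  have e1 : 2 * a3 * α - s * (β + a3) + a2 * e = 0 := by
    rw [hs, he, hβ, hα']; linear_combination 2 * t * h1
  have e2 : e * (β - a3) + a1 * s - (a1 - 2 * c * t * a2) * α = 0 := by
    rw [hs, he, hβ, hα']; linear_combination 2 * t * h2
  have e3 : (a1 - 2 * c * t * a2) * s - 2 * a3 * e = 0 := by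
    rw [hs, he]; linear_combination a2 * hD + 2 * t * r
  -- a definite quadratic form in `s` and `e` vanishes
  have e4 : (a1 * s - a3 * e) ^ 2 + e ^ 2 = 0 := by
    linear_combination a1 * s * e2 + a1 * α * e3 + a1 * e * e1 - e ^ 2 * h0
  have e5 : e = 0 := by nlinarith [sq_nonneg (a1 * s - a3 * e), sq_nonneg e]
  have e6 : s = 0 := by
    rw [e5] at e4
    have : a1 * s = 0 := by nlinarith [sq_nonneg (a1 * s)]
    exact (mul_eq_zero.1 this).resolve_left ha
  rw [e5, e6] at e1 e2
  constructor
  · have : a3 * α = 0 := by linarith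
    exact (mul_eq_zero.1 this).resolve_right hα
  · have : (a1 - 2 * c * t * a2) * α = 0 := by linarith
    exact (mul_eq_zero.1 this).resolve_right hα

/-- The denominator never vanishes. At a zero `t > 0` the functions `a₃` and
`v = a₂(a₁ - 2cta₂) = 1 + a₃² - 2cta₂²` vanish; but they solve a homogeneous linear system of
differential equations on `(0, ∞)`, so `v` vanishes on `(0, t]`, whereas `v(0) = 1 + a₃(0)²`. -/
theorem denom_ne_zero (h : C.IsComplex) (hI : ∀ t, 0 ≤ t → C.Integrability c t) (ht : 0 ≤ t) :
    C.denom c t ≠ 0 := by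
  intro hD
  rcases ht.eq_or_lt with rfl | hpos
  · exact h.a₁_ne_zero le_rfl (by simpa [denom] using hD)
  obtain ⟨h3, hm⟩ := (hI t ht).of_denom_eq_zero h ht hD
  set v : ℝ → ℝ := fun s => 1 + C.a₃ s ^ 2 - 2 * c * s * C.a₂ s ^ 2 with hv
  have hvt : v t = 0 := by
    simp only [hv]
    linear_combination C.a₂ t * hm - h.a₁_mul_a₂ t ht
  have hv0 : v 0 = 0 := by
    refine eq_zero_at_zero_of_continuousOn (s := t) ?_ hpos fun ε hε hεt => ?_
    · exact (continuousOn_const.add (C.smooth_a₃.continuousOn.pow 2)).sub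
        ((continuousOn_const.mul continuousOn_id).mul (C.smooth_a₂.continuousOn.pow 2))
    have hIcc : ∀ s ∈ Set.Icc ε t, 0 < s := fun s hs => hε.trans_le hs.1
    have hsub : Set.Icc ε t ⊆ Set.Ici 0 := fun s hs => (hIcc s hs).le
    have hd : ∀ {a : ℝ → ℝ}, ContDiffOn ℝ ∞ a (Set.Ici 0) → ∀ s ∈ Set.Icc ε t,
        HasDerivAt a (derivWithin a (Set.Ici 0) s) s := fun ha s hs =>
      (hasDerivWithinAt ha (hIcc s hs).le).hasDerivAt (Ici_mem_nhds (hIcc s hs))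
    have ca1 := C.smooth_a₁.continuousOn.mono hsub
    have ca2 := C.smooth_a₂.continuousOn.mono hsub
    have ca3 := C.smooth_a₃.continuousOn.mono hsub
    have cb2 := C.smooth_b₂.continuousOn.mono hsub
    have cb3 := C.smooth_b₃.continuousOn.mono hsub
    -- `a₂ + 2tb₂`, `a₃ + 2tb₃` and the determinant of the system
    set α : ℝ → ℝ := fun s => C.a₂ s + 2 * s * C.b₂ s
    set β : ℝ → ℝ := fun s => C.a₃ s + 2 * s * C.b₃ s
    set δ : ℝ → ℝ := fun s => 1 + β s ^ 2
    have cid : ContinuousOn (fun s : ℝ => s) (Set.Icc ε t) := continuousOn_id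
    have cα : ContinuousOn α (Set.Icc ε t) := ca2.add ((continuousOn_const.mul cid).mul cb2)
    have cβ : ContinuousOn β (Set.Icc ε t) := ca3.add ((continuousOn_const.mul cid).mul cb3)
    have cδ : ContinuousOn δ (Set.Icc ε t) := continuousOn_const.add (cβ.pow 2)
    have hδ : ∀ s, δ s ≠ 0 := fun s => by
      have : 0 < δ s := by positivity
      exact this.ne'
    have hs2 : ∀ s ∈ Set.Icc ε t, (2 * s * δ s) ≠ 0 := fun s hs =>
      mul_ne_zero (mul_ne_zero two_ne_zero (hIcc s hs).ne') (hδ s)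
    have ha2 : ∀ s ∈ Set.Icc ε t, C.a₂ s ≠ 0 := fun s hs => h.a₂_ne_zero (hIcc s hs).le
    have c2δ : ContinuousOn (fun s => 2 * s * δ s) (Set.Icc ε t) :=
      (continuousOn_const.mul cid).mul cδ
    -- Cramer's rule for the pair of equations, in the unknowns `a₃'` and `a₂ + 2ta₂'`
    have hdet : ∀ s ∈ Set.Icc ε t,
        2 * s * δ s * derivWithin C.a₃ (Set.Ici 0) s * C.a₂ s =
          α s * (-2 * C.a₁ s * C.a₂ s * C.a₃ s + (β s + C.a₃ s) * v s) ∧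
        δ s * (C.a₂ s + 2 * s * derivWithin C.a₂ (Set.Ici 0) s) =
          α s * (v s + 2 * C.a₃ s * (β s - C.a₃ s)) := fun s hs => by
      have hs0 := (hIcc s hs).le
      obtain ⟨e1, e2⟩ := hI s hs0
      have e0 := h.a₁_mul_a₂ s hs0
      simp only [horizontalCoeff, verticalCoeff, h.a₄_eq s hs0] at e1 e2
      simp only [δ, α, β, hv]
      constructor
      · linear_combination C.a₂ s * (2 * s * C.a₁ s * e1
          + (2 * C.a₃ s + 2 * s * C.b₃ s) * (2 * s) * e2)
          + (-(2 * s * derivWithin C.a₃ (Set.Ici 0) s) * C.a₂ s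
          + (C.a₂ s + 2 * s * C.b₂ s) * (2 * C.a₃ s + 2 * s * C.b₃ s)) * e0
      · linear_combination C.a₂ s * (2 * s) * e2 - (2 * s * C.b₃ s) * (2 * s) * e1
          + (-(C.a₂ s + 2 * s * derivWithin C.a₂ (Set.Ici 0) s)
          + (C.a₂ s + 2 * s * C.b₂ s)) * e0
    have hk : ∀ s ∈ Set.Icc ε t, derivWithin C.a₃ (Set.Ici 0) s =
        -2 * α s * C.a₁ s / (2 * s * δ s) * C.a₃ s
          + α s * (β s + C.a₃ s) / (2 * s * δ s) / C.a₂ s * v s := fun s hs => by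
      have h1 : derivWithin C.a₃ (Set.Ici 0) s =
          α s * (-2 * C.a₁ s * C.a₂ s * C.a₃ s + (β s + C.a₃ s) * v s) /
            (2 * s * δ s * C.a₂ s) := by
        rw [eq_div_iff (mul_ne_zero (hs2 s hs) (ha2 s hs))]
        linear_combination (hdet s hs).1
      have h2 := ha2 s hs
      have h3 := hδ s
      have h4 := (hIcc s hs).ne'
      rw [h1]
      field_simp
    have hk' : ∀ s ∈ Set.Icc ε t, C.a₂ s + 2 * s * derivWithin C.a₂ (Set.Ici 0) s =
        α s * (v s + 2 * C.a₃ s * (β s - C.a₃ s)) / δ s := fun s hs => by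
      rw [eq_div_iff (hδ s)]
      linear_combination (hdet s hs).2
    have := linear_system_eq_zero_left (f := C.a₃) (g := v) (a := ε) (b := t)
      (f' := derivWithin C.a₃ (Set.Ici 0))
      (g' := fun s => 2 * C.a₃ s * derivWithin C.a₃ (Set.Ici 0) s
        - 2 * c * C.a₂ s * (C.a₂ s + 2 * s * derivWithin C.a₂ (Set.Ici 0) s))
      (k₁ := fun s => -2 * α s * C.a₁ s / (2 * s * δ s))
      (k₂ := fun s => α s * (β s + C.a₃ s) / (2 * s * δ s) / C.a₂ s)
      (k₃ := fun s => 2 * C.a₃ s * (-2 * α s * C.a₁ s / (2 * s * δ s))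
        - 2 * c * C.a₂ s * (α s * 2 * (β s - C.a₃ s) / δ s))
      (k₄ := fun s => 2 * C.a₃ s * (α s * (β s + C.a₃ s) / (2 * s * δ s) / C.a₂ s)
        - 2 * c * C.a₂ s * (α s / δ s))
      hεt (hd C.smooth_a₃) ?_ ?_ ?_ ?_ ?_ ?_ ?_ h3 hvt
    · exact this.2
    · intro s hs
      have h1 := (((hd C.smooth_a₃ s hs).pow 2).const_add 1).sub
        (((hasDerivAt_id s).const_mul (2 * c)).mul ((hd C.smooth_a₂ s hs).pow 2))
      refine h1.congr_deriv ?_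
      simp
      ring
    · exact ((continuousOn_const.mul cα).mul ca1).div c2δ hs2
    · exact ((cα.mul (cβ.add ca3)).div c2δ hs2).div ca2 ha2
    · exact ((continuousOn_const.mul ca3).mul
        (((continuousOn_const.mul cα).mul ca1).div c2δ hs2)).sub ((continuousOn_const.mul ca2).mul
        (((cα.mul continuousOn_const).mul (cβ.sub ca3)).div cδ fun s _ => hδ s))
    · exact ((continuousOn_const.mul ca3).mul
        (((cα.mul (cβ.add ca3)).div c2δ hs2).div ca2 ha2)).sub ((continuousOn_const.mul ca2).mul
        (cα.div cδ fun s _ => hδ s))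
    · exact hk
    · intro s hs
      rw [hk s hs, hk' s hs]
      ring
  have : v 0 = 1 + C.a₃ 0 ^ 2 := by simp [hv]
  nlinarith [sq_nonneg (C.a₃ 0)]

/-- The value of `b₁`; at `t = 0`, where the quadratic relation does not involve `b₁`, it follows by
continuity. -/
theorem b₁_mul_denom (h : C.IsComplex) (hI : ∀ t, 0 ≤ t → C.Integrability c t) (ht : 0 ≤ t) :
    C.b₁ t * C.denom c t = 2 * c ^ 2 * t * C.a₂ t ^ 2
      + 2 * c * t * C.a₁ t * derivWithin C.a₂ (Set.Ici 0) t
      + C.a₁ t * derivWithin C.a₁ (Set.Ici 0) t - c + 3 * c * C.a₃ t ^ 2 := by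
  rcases ht.eq_or_lt with rfl | hpos
  · rw [← sub_eq_zero]
    refine eq_zero_at_zero_of_continuousOn (f := fun t => C.b₁ t * C.denom c t
      - (2 * c ^ 2 * t * C.a₂ t ^ 2 + 2 * c * t * C.a₁ t * derivWithin C.a₂ (Set.Ici 0) t
        + C.a₁ t * derivWithin C.a₁ (Set.Ici 0) t - c + 3 * c * C.a₃ t ^ 2)) ?_ one_pos
      fun t h0 _ => sub_eq_zero.2
        ((hI t h0.le).b₁_mul_denom_of_pos h h0 (denom_ne_zero h hI h0.le))
    have ca1 := C.smooth_a₁.continuousOn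
    have ca2 := C.smooth_a₂.continuousOn
    have ca3 := C.smooth_a₃.continuousOn
    have cb1 := C.smooth_b₁.continuousOn
    have cd1 := continuousOn_derivWithin C.smooth_a₁
    have cd2 := continuousOn_derivWithin C.smooth_a₂
    simp only [denom]
    fun_prop
  · exact (hI t ht).b₁_mul_denom_of_pos h hpos (denom_ne_zero h hI ht)

end Coefficients

end CoefficientEquations

/-! ### Integrability in local coordinates -/

section LocalIntegrability

set_option synthInstance.maxHeartbeats 200000

variable {E : Type*} [NormedAddCommGroup E] [NormedSpace ℝ E] [FiniteDimensional ℝ E]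
  {G : E → E →L[ℝ] E →L[ℝ] ℝ} {U : Set E} {y : E} {C : Coefficients}

omit [FiniteDimensional ℝ E] in
theorem fibreEnergy_smul (B : E →L[ℝ] E →L[ℝ] ℝ) (k : ℝ) (ξ : E →L[ℝ] ℝ) :
    fibreEnergy B (k • ξ) = k ^ 2 * fibreEnergy B ξ := by
  simp only [fibreEnergy, map_smul, smul_apply, smul_eq_mul]
  ring

omit [FiniteDimensional ℝ E] in
theorem fibreH_vertical (B : E →L[ℝ] E →L[ℝ] ℝ) (C : Coefficients) (ξ θ : E →L[ℝ] ℝ) :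
    fibreH B C ξ 0 θ = -(C.a₂ (fibreEnergy B ξ) • B.inverse θ)
      - (C.b₂ (fibreEnergy B ξ) * ξ (B.inverse θ)) • B.inverse ξ := by
  simp [fibreH]

omit [FiniteDimensional ℝ E] in
theorem fibreV_vertical (B : E →L[ℝ] E →L[ℝ] ℝ) (C : Coefficients) (ξ θ : E →L[ℝ] ℝ) :
    fibreV B C ξ 0 θ = C.a₃ (fibreEnergy B ξ) • θ
      + (C.b₃ (fibreEnergy B ξ) * ξ (B.inverse θ)) • ξ := by
  simp [fibreV]

namespace IsMetricOn

theorem fibreEnergy_pos (h : IsMetricOn G U) (hy : y ∈ U) {ξ : E →L[ℝ] ℝ} (hξ : ξ ≠ 0) :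
    0 < fibreEnergy (G y) ξ :=
  mul_pos (by norm_num) (h.apply_inverse_self_pos hy hξ)

/-- In dimension at least two there are a covector of energy one and a nonzero covector orthogonal
to it. -/
theorem exists_orthogonal (h : IsMetricOn G U) (hy : y ∈ U) (hn : 1 < Module.finrank ℝ E) :
    ∃ ξ θ : E →L[ℝ] ℝ, fibreEnergy (G y) ξ = 1 ∧ θ ≠ 0 ∧ ξ ((G y).inverse θ) = 0 := by
  have hdim : Module.finrank ℝ (E →L[ℝ] ℝ) = Module.finrank ℝ E := by
    have e1 : (E →ₗ[ℝ] ℝ) ≃ₗ[ℝ] (E →L[ℝ] ℝ) := LinearMap.toContinuousLinearMap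
    rw [← e1.finrank_eq]
    exact Subspace.dual_finrank_eq (K := ℝ) (V := E)
  have : FiniteDimensional ℝ (E →L[ℝ] ℝ) := Module.finite_of_finrank_pos (by omega)
  have : Nontrivial (E →L[ℝ] ℝ) := Module.nontrivial_of_finrank_pos (R := ℝ) (by omega)
  obtain ⟨ξ, hξ⟩ := exists_ne (0 : E →L[ℝ] ℝ)
  have hpos := h.fibreEnergy_pos hy hξ
  have hker := LinearMap.ker_ne_bot_of_finrank_lt
    (f := (ξ.comp (G y).inverse : (E →L[ℝ] ℝ) →ₗ[ℝ] ℝ)) (by rw [hdim]; simpa using hn)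
  obtain ⟨θ, hθ, hθ0⟩ := (Submodule.ne_bot_iff _).1 hker
  refine ⟨(Real.sqrt (fibreEnergy (G y) ξ))⁻¹ • ξ, θ, ?_, hθ0, ?_⟩
  · rw [fibreEnergy_smul, inv_pow, Real.sq_sqrt hpos.le, inv_mul_cancel₀ hpos.ne']
  · have : ξ ((G y).inverse θ) = 0 := hθ
    simp [this]

/-- The relations between the coefficients, read off from `J² = -1` on vertical vectors. -/
theorem isComplex (h : IsMetricOn G U) (hy : y ∈ U) (hn : 1 < Module.finrank ℝ E)
    (hJ : ∀ ξ v, localJ G C (y, ξ) (localJ G C (y, ξ) v) = -v) : C.IsComplex := by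
  have hJ' : ∀ ξ θ : E →L[ℝ] ℝ, fibreH (G y) C ξ (fibreH (G y) C ξ 0 θ) (fibreV (G y) C ξ 0 θ) = 0
      ∧ fibreV (G y) C ξ (fibreH (G y) C ξ 0 θ) (fibreV (G y) C ξ 0 θ) = -θ := by
    intro ξ θ
    have h1 := hJ ξ (0, θ)
    have h2 := localJ_horizontal_add_vertical (G := G) C y 0 ξ θ
    simp only [map_zero, ContinuousLinearMap.comp_zero, add_zero] at h2
    rw [h2, localJ_horizontal_add_vertical] at h1
    have h3 := congrArg Prod.fst h1
    have h4 := congrArg Prod.snd h1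
    simp only [Prod.fst_neg, neg_zero, Prod.snd_neg] at h3 h4
    rw [h3] at h4
    simp only [map_zero, ContinuousLinearMap.comp_zero, add_zero] at h4
    exact ⟨h3, h4⟩
  obtain ⟨ξ₀, θ, hξ₀, hθ, horth⟩ := h.exists_orthogonal hy hn
  have hSθ : (G y).inverse θ ≠ 0 := fun h0 => hθ (by rw [← h.apply_inverse hy θ, h0, map_zero])
  have hξ₀' : ξ₀ ≠ 0 := by
    rintro rfl
    simp [fibreEnergy] at hξ₀
  have henergy : ∀ t, 0 ≤ t → fibreEnergy (G y) (Real.sqrt t • ξ₀) = t := fun t ht => by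
    rw [fibreEnergy_smul, hξ₀, Real.sq_sqrt ht, mul_one]
  have horthogonal : ∀ t, 0 ≤ t → C.a₁ t * C.a₂ t = 1 + C.a₃ t ^ 2 ∧
      C.a₂ t * (C.a₃ t + C.a₄ t) = 0 := by
    intro t ht
    obtain ⟨h1, h2⟩ := hJ' (Real.sqrt t • ξ₀) θ
    have ho : (Real.sqrt t • ξ₀) ((G y).inverse θ) = 0 := by simp [horth]
    have e1 : fibreH (G y) C (Real.sqrt t • ξ₀) 0 θ = -(C.a₂ t • (G y).inverse θ) := by
      rw [fibreH_vertical, ho, henergy t ht]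
      simp
    have e2 : fibreV (G y) C (Real.sqrt t • ξ₀) 0 θ = C.a₃ t • θ := by
      rw [fibreV_vertical, ho, henergy t ht]
      simp
    rw [e1, e2, fibreH, henergy t ht] at h1
    rw [e1, e2, fibreV, henergy t ht] at h2
    simp only [map_neg, map_smul, ho, h.apply_inverse hy, smul_zero, mul_zero, zero_smul,
      add_zero, neg_zero, sub_zero] at h1 h2
    have h1' : (C.a₂ t * (C.a₃ t + C.a₄ t)) • (G y).inverse θ = 0 := by
      rw [← neg_eq_zero, ← h1]; module
    have h2' : (C.a₁ t * C.a₂ t - (1 + C.a₃ t ^ 2)) • θ = 0 := by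
      have : (C.a₁ t * C.a₂ t - (1 + C.a₃ t ^ 2)) • θ
        = -(C.a₁ t • -(C.a₂ t • θ) + C.a₃ t • C.a₃ t • θ) - θ := by module
      rw [this, h2]
      simp
    exact ⟨by linarith [(smul_eq_zero.1 h2').resolve_right hθ],
      (smul_eq_zero.1 h1').resolve_right hSθ⟩
  have ha2 : ∀ t, 0 ≤ t → C.a₂ t ≠ 0 := fun t ht h0 => by
    have := (horthogonal t ht).1
    rw [h0] at this
    nlinarith [sq_nonneg (C.a₃ t)]
  refine ⟨fun t ht => ?_, fun t ht => (horthogonal t ht).1, fun t ht => ?_⟩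
  · have := (mul_eq_zero.1 (horthogonal t ht).2).resolve_left (ha2 t ht)
    linarith
  · rcases ht.eq_or_lt with rfl | hpos
    · simpa using (horthogonal 0 le_rfl).1
    obtain ⟨-, h2⟩ := hJ' (Real.sqrt t • ξ₀) (Real.sqrt t • ξ₀)
    have hne : Real.sqrt t • ξ₀ ≠ 0 := smul_ne_zero (Real.sqrt_pos.2 hpos).ne' hξ₀'
    have hs := two_mul_fibreEnergy (G y) (Real.sqrt t • ξ₀)
    rw [henergy t ht] at hs
    have he := henergy t ht
    generalize Real.sqrt t • ξ₀ = ξ at *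
    have e1 : fibreH (G y) C ξ 0 ξ = -((C.a₂ t + 2 * t * C.b₂ t) • (G y).inverse ξ) := by
      rw [fibreH_vertical, hs, he]
      module
    have e2 : fibreV (G y) C ξ 0 ξ = (C.a₃ t + 2 * t * C.b₃ t) • ξ := by
      rw [fibreV_vertical, hs, he]
      module
    rw [e1, e2, fibreV, he] at h2
    simp only [map_neg, map_smul, hs, h.apply_inverse hy, smul_eq_mul] at h2
    have h2' : ((C.a₁ t + 2 * t * C.b₁ t) * (C.a₂ t + 2 * t * C.b₂ t)
        - (1 + (C.a₃ t + 2 * t * C.b₃ t) ^ 2)) • ξ = 0 := by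
      have := eq_neg_iff_add_eq_zero.1 h2
      rw [← neg_eq_zero, ← this]
      module
    linarith [(smul_eq_zero.1 h2').resolve_right hne]

/-- Every vector is the horizontal part of `J θ^V` for some covector `θ`. -/
theorem fibreH_vertical_surjective (h : IsMetricOn G U) (hy : y ∈ U) (hC : C.IsComplex)
    (ξ : E →L[ℝ] ℝ) (X : E) : ∃ θ, fibreH (G y) C ξ 0 θ = X := by
  have ht := h.fibreEnergy_nonneg hy ξ
  have h2 := hC.a₂_ne_zero ht
  have h3 := hC.a₂_add_ne_zero ht
  refine ⟨-((C.a₂ (fibreEnergy (G y) ξ))⁻¹ • (G y X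
    - (C.b₂ (fibreEnergy (G y) ξ) * ξ X / (C.a₂ (fibreEnergy (G y) ξ)
      + 2 * fibreEnergy (G y) ξ * C.b₂ (fibreEnergy (G y) ξ))) • ξ)), ?_⟩
  rw [fibreH_vertical]
  simp only [map_neg, map_smul, map_sub, h.inverse_apply hy, two_mul_fibreEnergy, smul_eq_mul]
  generalize fibreEnergy (G y) ξ = t at *
  generalize hα : C.a₂ t + 2 * t * C.b₂ t = α at h3 ⊢
  match_scalars
  · field_simp
  · field_simp
    linear_combination -C.b₂ t * ξ X * hα

/-- The curvature term of a space of constant curvature one, on the horizontal parts of `J θ^V` and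
`J η^V`, is a multiple of the covector `fibreWedge`. -/
theorem wedge_fibreH (h : IsMetricOn G U) (hy : y ∈ U) (C : Coefficients) (ξ θ η : E →L[ℝ] ℝ)
    (w : E) :
    ξ (fibreH (G y) C ξ 0 θ) * G y (fibreH (G y) C ξ 0 η) w
      - ξ (fibreH (G y) C ξ 0 η) * G y (fibreH (G y) C ξ 0 θ) w =
    C.a₂ (fibreEnergy (G y) ξ) * (C.a₂ (fibreEnergy (G y) ξ)
      + 2 * fibreEnergy (G y) ξ * C.b₂ (fibreEnergy (G y) ξ)) * fibreWedge (G y) ξ θ η w := by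
  simp only [fibreH_vertical, fibreWedge, map_neg, map_smul, map_sub, h.apply_inverse hy,
    two_mul_fibreEnergy, smul_eq_mul, sub_apply, neg_apply, smul_apply]
  ring

/-- The Nijenhuis tensor vanishes at a point over which the curvature is constant, if the
coefficients satisfy the integrability equations. -/
theorem flatNijenhuis_localJ_eq_zero (h : IsMetricOn G U) (hy : y ∈ U) (hC : C.IsComplex)
    {ξ : E →L[ℝ] ℝ} {c : ℝ} (hsq : ∀ᶠ z in nhds (y, ξ), ∀ v, localJ G C z (localJ G C z v) = -v)
    (hI : C.Integrability c (fibreEnergy (G y) ξ))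
    (hR : ∀ u v w, localCurvature G y u v w = c • (G y v w • u - G y u w • v))
    (v w : E × (E →L[ℝ] ℝ)) : flatNijenhuis (localJ G C) (y, ξ) v w = 0 := by
  refine flatNijenhuis_eq_zero_of_span (h.differentiableAt_localJ C hy) hsq {v | v.1 = 0}
    (fun v => ?_) (fun a ha b hb => ?_) v w
  · obtain ⟨θ, hθ⟩ := h.fibreH_vertical_surjective hy hC ξ v.1
    refine ⟨(0, v.2 - (localJ G C (y, ξ) (0, θ)).2), rfl, (0, θ), rfl, ?_⟩
    ext1
    · rw [Prod.fst_add, localJ_apply]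
      simp [hθ]
    · simp
  · obtain ⟨a1, θ⟩ := a
    obtain ⟨b1, η⟩ := b
    obtain rfl : a1 = 0 := ha
    obtain rfl : b1 = 0 := hb
    obtain ⟨h1, h2⟩ := h.flatNijenhuis_localJ_vertical C hy ξ θ η
    rw [hI.1, zero_smul] at h1
    ext1
    · exact h1
    · ext w
      have h3 := h.wedge_fibreH hy C ξ θ η w
      have h4 := hI.2
      rw [h2, hI.1, hR]
      simp only [zero_smul, map_zero, zero_apply, map_smul, map_sub, smul_eq_mul, add_zero,
        Prod.snd_zero]
      linear_combination c * h3 + fibreWedge (G y) ξ θ η w * h4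

/-- If the Nijenhuis tensor vanishes on the vertical vectors over a point, then the coefficients
satisfy the integrability equations for a constant `c`, and the curvature at that point is that of
a space of constant curvature `c`. The vertical equation says
`ξ(R(X, Y)w) = κ(t) (ξ(X) g(Y, w) - ξ(Y) g(X, w))` with `t` the energy of `ξ`; as the left hand side
is homogeneous in `ξ`, the function `κ` is constant. -/
theorem exists_integrability (h : IsMetricOn G U) (hy : y ∈ U) (hn : 1 < Module.finrank ℝ E)
    (hC : C.IsComplex)
    (hN : ∀ ξ θ η : E →L[ℝ] ℝ, flatNijenhuis (localJ G C) (y, ξ) (0, θ) (0, η) = 0) :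
    ∃ c, (∀ t, 0 ≤ t → C.Integrability c t) ∧
      ∀ u v w, localCurvature G y u v w = c • (G y v w • u - G y u w • v) := by
  obtain ⟨ξ₀, θ₀, hξ₀, hθ₀, horth⟩ := h.exists_orthogonal hy hn
  have henergy : ∀ t, 0 ≤ t → fibreEnergy (G y) (Real.sqrt t • ξ₀) = t := fun t ht => by
    rw [fibreEnergy_smul, hξ₀, Real.sq_sqrt ht, mul_one]
  have hSθ₀ : (G y).inverse θ₀ ≠ 0 := fun h0 =>
    hθ₀ (by rw [← h.apply_inverse hy θ₀, h0, map_zero])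
  have hH : ∀ t, 0 < t → horizontalCoeff C t = 0 := by
    intro t ht
    have h1 := (h.flatNijenhuis_localJ_vertical C hy (Real.sqrt t • ξ₀) ξ₀ θ₀).1
    rw [hN, henergy t ht.le] at h1
    have h2 : (G y).inverse (fibreWedge (G y) (Real.sqrt t • ξ₀) ξ₀ θ₀)
        = (Real.sqrt t * 2) • (G y).inverse θ₀ := by
      simp only [fibreWedge, smul_apply, horth, two_mul_fibreEnergy, hξ₀, smul_eq_mul, mul_one,
        mul_zero, zero_smul, sub_zero, map_smul]
    rw [h2, smul_smul] at h1
    have h3 := (smul_eq_zero.1 h1.symm).resolve_right hSθ₀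
    exact (mul_eq_zero.1 h3).resolve_right
      (mul_ne_zero (Real.sqrt_pos.2 ht).ne' two_ne_zero)
  have hκ : ∀ ξ : E →L[ℝ] ℝ, ξ ≠ 0 → ∀ X Y w,
      C.a₂ (fibreEnergy (G y) ξ) * (C.a₂ (fibreEnergy (G y) ξ)
        + 2 * fibreEnergy (G y) ξ * C.b₂ (fibreEnergy (G y) ξ)) * ξ (localCurvature G y X Y w)
      = -verticalCoeff C (fibreEnergy (G y) ξ) * (ξ X * G y Y w - ξ Y * G y X w) := by
    intro ξ hξ X Y w
    obtain ⟨θ, rfl⟩ := h.fibreH_vertical_surjective hy hC ξ X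
    obtain ⟨η, rfl⟩ := h.fibreH_vertical_surjective hy hC ξ Y
    have h1 := (h.flatNijenhuis_localJ_vertical C hy ξ θ η).2 w
    rw [hN, hH _ (h.fibreEnergy_pos hy hξ)] at h1
    simp only [zero_smul, map_zero, zero_apply, add_zero, Prod.snd_zero] at h1
    rw [h.wedge_fibreH hy]
    linear_combination -(C.a₂ (fibreEnergy (G y) ξ) * (C.a₂ (fibreEnergy (G y) ξ)
        + 2 * fibreEnergy (G y) ξ * C.b₂ (fibreEnergy (G y) ξ))) * h1
  have hden : ∀ t, 0 ≤ t → C.a₂ t * (C.a₂ t + 2 * t * C.b₂ t) ≠ 0 := fun t ht =>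
    mul_ne_zero (hC.a₂_ne_zero ht) (hC.a₂_add_ne_zero ht)
  have hξ₀' : ξ₀ ≠ 0 := by
    rintro rfl
    simp [fibreEnergy] at hξ₀
  obtain ⟨c, hc⟩ : ∃ c, c = -verticalCoeff C 1 / (C.a₂ 1 * (C.a₂ 1 + 2 * 1 * C.b₂ 1)) := ⟨_, rfl⟩
  have h1c : -verticalCoeff C 1 = c * (C.a₂ 1 * (C.a₂ 1 + 2 * 1 * C.b₂ 1)) := by
    rw [hc, div_mul_cancel₀ _ (hden 1 zero_le_one)]
  -- the value at a general energy `t`, compared with that at energy one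
  have hV : ∀ t, 0 < t → verticalCoeff C t + c * C.a₂ t * (C.a₂ t + 2 * t * C.b₂ t) = 0 := by
    intro t ht
    have hst : Real.sqrt t ≠ 0 := (Real.sqrt_pos.2 ht).ne'
    have e1 := hκ ξ₀ hξ₀' ((G y).inverse ξ₀) ((G y).inverse θ₀) ((G y).inverse θ₀)
    have e2 := hκ (Real.sqrt t • ξ₀) (smul_ne_zero hst hξ₀') ((G y).inverse ξ₀)
      ((G y).inverse θ₀) ((G y).inverse θ₀)
    rw [henergy t ht.le] at e2
    rw [hξ₀, h1c] at e1
    simp only [smul_apply, smul_eq_mul, horth, mul_zero, sub_zero, h.apply_inverse hy,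
      two_mul_fibreEnergy, hξ₀] at e1 e2
    have hP : θ₀ ((G y).inverse θ₀) ≠ 0 := (h.apply_inverse_self_pos hy hθ₀).ne'
    have e3 : ξ₀ (localCurvature G y ((G y).inverse ξ₀) ((G y).inverse θ₀) ((G y).inverse θ₀))
        = c * (2 * 1 * (2 * fibreEnergy (G y) θ₀)) := by
      apply mul_left_cancel₀ (hden 1 zero_le_one)
      linear_combination e1
    rw [e3] at e2
    have hne : Real.sqrt t * (2 * θ₀ ((G y).inverse θ₀)) ≠ 0 :=
      mul_ne_zero hst (mul_ne_zero two_ne_zero hP)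
    apply mul_left_cancel₀ hne
    simp only [two_mul_fibreEnergy]
    linear_combination e2
  refine ⟨c, fun t ht => ?_, fun u v w => ?_⟩
  · rcases ht.eq_or_lt with rfl | hpos
    · have ca1 := C.smooth_a₁.continuousOn
      have ca2 := C.smooth_a₂.continuousOn
      have ca3 := C.smooth_a₃.continuousOn
      have ca4 := C.smooth_a₄.continuousOn
      have cb2 := C.smooth_b₂.continuousOn
      have cb3 := C.smooth_b₃.continuousOn
      have cd2 := Coefficients.continuousOn_derivWithin C.smooth_a₂
      have cd3 := Coefficients.continuousOn_derivWithin C.smooth_a₃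
      have cH : ContinuousOn (horizontalCoeff C) (Set.Ici 0) := by
        unfold horizontalCoeff
        fun_prop
      have cV : ContinuousOn (fun t => verticalCoeff C t
          + c * C.a₂ t * (C.a₂ t + 2 * t * C.b₂ t)) (Set.Ici 0) := by
        unfold verticalCoeff
        fun_prop
      exact ⟨eq_zero_at_zero_of_continuousOn cH one_pos fun t ht _ => hH t ht,
        eq_zero_at_zero_of_continuousOn cV one_pos fun t ht _ => hV t ht⟩
    · exact ⟨hH t hpos, hV t hpos⟩
  · refine h.ext_inner hy fun z => ?_
    by_cases hz : z = 0
    · simp [hz]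
    have hGz : G y z ≠ 0 := fun h0 => (h.pos y hy z hz).ne' (by rw [h0]; rfl)
    have e1 := hκ (G y z) hGz u v w
    have e2 := hV _ (h.fibreEnergy_pos hy hGz)
    rw [h.symm y hy _ z, h.symm y hy _ z]
    apply mul_left_cancel₀ (hden _ (h.fibreEnergy_nonneg hy (G y z)))
    rw [e1]
    simp only [map_smul, map_sub, smul_eq_mul]
    linear_combination -(G y z u * G y v w - G y z v * G y u w) * e2

end IsMetricOn

/-- The coefficients determine the curvature. -/
theorem Coefficients.Integrability.unique {c c' t : ℝ} (ht : 0 ≤ t) (hC : C.IsComplex)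
    (h : C.Integrability c t) (h' : C.Integrability c' t) : c = c' := by
  apply mul_right_cancel₀ (mul_ne_zero (hC.a₂_ne_zero ht) (hC.a₂_add_ne_zero ht))
  linear_combination h.2 - h'.2

end LocalIntegrability

/-! ### Naturality under changes of coordinates -/

section Naturality

set_option synthInstance.maxHeartbeats 200000

variable {E : Type*} [NormedAddCommGroup E] [NormedSpace ℝ E]

/-- A change of coordinates `τ` near `y` which is an isometry from the metric `G` to the metric
`G'`; `A` is the family of the inverses of its derivatives. -/
structure IsChartChange (G G' : E → E →L[ℝ] E →L[ℝ] ℝ) (τ : E → E) (A : E → E →L[ℝ] E) (y : E) :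
    Prop where
  contDiffAt : ContDiffAt ℝ ∞ τ y
  differentiableAt : DifferentiableAt ℝ A y
  left_inv : ∀ᶠ z in nhds y, ∀ v, A z (fderiv ℝ τ z v) = v
  isometry : ∀ᶠ z in nhds y, ∀ u v, G z u v = G' (τ z) (fderiv ℝ τ z u) (fderiv ℝ τ z v)

namespace IsChartChange

variable {G G' : E → E →L[ℝ] E →L[ℝ] ℝ} {τ : E → E} {A : E → E →L[ℝ] E} {y : E} {U U' : Set E}

theorem hasFDerivAt_fderiv (h : IsChartChange G G' τ A y) :
    HasFDerivAt (fderiv ℝ τ) (fderiv ℝ (fderiv ℝ τ) y) y :=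
  ((h.contDiffAt.fderiv_right (m := ∞) (by simp)).differentiableAt (by simp)).hasFDerivAt

theorem hasFDerivAt_self (h : IsChartChange G G' τ A y) : HasFDerivAt τ (fderiv ℝ τ y) y :=
  (h.contDiffAt.differentiableAt (by simp)).hasFDerivAt

theorem fderiv_left_inv (h : IsChartChange G G' τ A y) (u v : E) :
    fderiv ℝ A y u (fderiv ℝ τ y v) = -A y (fderiv ℝ (fderiv ℝ τ) y u v) := by
  have h1 := h.differentiableAt.hasFDerivAt.clm_apply
    (h.hasFDerivAt_fderiv.clm_apply (hasFDerivAt_const v y))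
  have h2 : HasFDerivAt (fun z => A z (fderiv ℝ τ z v)) (0 : E →L[ℝ] E) y :=
    (hasFDerivAt_const v y).congr_of_eventuallyEq (h.left_inv.mono fun z hz => hz v)
  have h3 := congrArg (fun l : E →L[ℝ] E => l u) (h1.unique h2)
  simp at h3
  rw [eq_neg_iff_add_eq_zero, add_comm]
  exact h3

variable [FiniteDimensional ℝ E]

theorem right_inv (h : IsChartChange G G' τ A y) (v : E) : fderiv ℝ τ y (A y v) = v := by
  have h1 : (A y : E →ₗ[ℝ] E) * (fderiv ℝ τ y : E →ₗ[ℝ] E) = 1 :=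
    LinearMap.ext fun v => h.left_inv.self_of_nhds v
  exact congrArg (fun l : E →ₗ[ℝ] E => l v) (mul_eq_one_comm.1 h1)

omit [FiniteDimensional ℝ E] in
/-- The isometry equation, differentiated. -/
theorem fderiv_metric (h : IsChartChange G G' τ A y) (hG : IsMetricOn G U) (hG' : IsMetricOn G' U')
    (hy : y ∈ U) (hy' : τ y ∈ U') (w u v : E) :
    fderiv ℝ G y w u v = fderiv ℝ G' (τ y) (fderiv ℝ τ y w) (fderiv ℝ τ y u) (fderiv ℝ τ y v)
      + G' (τ y) (fderiv ℝ (fderiv ℝ τ) y w u) (fderiv ℝ τ y v)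
      + G' (τ y) (fderiv ℝ τ y u) (fderiv ℝ (fderiv ℝ τ) y w v) := by
  have h1 := ((hG.hasFDerivAt_self hy).clm_apply (hasFDerivAt_const u y)).clm_apply
    (hasFDerivAt_const v y)
  have h2 := (((hG'.hasFDerivAt_self hy').comp y h.hasFDerivAt_self).clm_apply
    (h.hasFDerivAt_fderiv.clm_apply (hasFDerivAt_const u y))).clm_apply
    (h.hasFDerivAt_fderiv.clm_apply (hasFDerivAt_const v y))
  have h3 := h2.congr_of_eventuallyEq (f₁ := fun z => G z u v)
    (h.isometry.mono fun z hz => hz u v)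
  have h4 := congrArg (fun l : E →L[ℝ] ℝ => l w) (h1.unique h3)
  simp at h4
  rw [h4]
  ring

/-- The transformation law of the Christoffel symbols. -/
theorem christoffel_eq (h : IsChartChange G G' τ A y) (hG : IsMetricOn G U)
    (hG' : IsMetricOn G' U') (hy : y ∈ U) (hy' : τ y ∈ U') (u v : E) :
    christoffelL G' (τ y) (fderiv ℝ τ y u) (fderiv ℝ τ y v) =
      fderiv ℝ τ y (christoffelL G y u v) - fderiv ℝ (fderiv ℝ τ) y u v := by
  have hsymm : ∀ a b, fderiv ℝ (fderiv ℝ τ) y a b = fderiv ℝ (fderiv ℝ τ) y b a := fun a b =>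
    (h.contDiffAt.isSymmSndFDerivAt (by simpa using ENat.LEInfty.out)).eq a b
  refine hG'.ext_inner hy' fun w' => ?_
  obtain ⟨w, rfl⟩ : ∃ w, fderiv ℝ τ y w = w' := ⟨A y w', h.right_inv w'⟩
  have h1 := hG.inner_christoffel hy u v w
  rw [h.isometry.self_of_nhds, h.fderiv_metric hG hG' hy hy', h.fderiv_metric hG hG' hy hy',
    h.fderiv_metric hG hG' hy hy', hsymm w u, hsymm w v, hsymm v u,
    hG'.symm _ hy' (fderiv ℝ τ y v)] at h1
  rw [hG'.inner_christoffel hy', map_sub, sub_apply, h1]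
  ring

theorem inverse_eq (h : IsChartChange G G' τ A y) (hG : IsMetricOn G U)
    (hG' : IsMetricOn G' U') (hy : y ∈ U) (hy' : τ y ∈ U') (θ : E →L[ℝ] ℝ) :
    (G' (τ y)).inverse (θ.comp (A y)) = fderiv ℝ τ y ((G y).inverse θ) := by
  refine hG'.ext_inner hy' fun w' => ?_
  obtain ⟨w, rfl⟩ : ∃ w, fderiv ℝ τ y w = w' := ⟨A y w', h.right_inv w'⟩
  rw [hG'.apply_inverse hy', ← h.isometry.self_of_nhds, hG.apply_inverse hy,
    ContinuousLinearMap.comp_apply, h.left_inv.self_of_nhds]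

omit [FiniteDimensional ℝ E] in
/-- The derivative of the map `(z, ξ) ↦ (τ z, ξ ∘ A z)` induced by `τ` on cotangent vectors. -/
theorem hasFDerivAt_cotangent (h : IsChartChange G G' τ A y) (ξ : E →L[ℝ] ℝ) :
    ∃ D : E × (E →L[ℝ] ℝ) →L[ℝ] E × (E →L[ℝ] ℝ),
      HasFDerivAt (fun z : E × (E →L[ℝ] ℝ) => (τ z.1, z.2.comp (A z.1))) D (y, ξ) ∧
      ∀ u ζ, D (u, ζ) = (fderiv ℝ τ y u, ζ.comp (A y) + ξ.comp (fderiv ℝ A y u)) := by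
  have h1 : HasFDerivAt (fun z : E × (E →L[ℝ] ℝ) => τ z.1) _ (y, ξ) :=
    HasFDerivAt.comp (g := τ) (y, ξ) h.hasFDerivAt_self hasFDerivAt_fst
  have h2 : HasFDerivAt (fun z : E × (E →L[ℝ] ℝ) => A z.1) _ (y, ξ) :=
    HasFDerivAt.comp (g := A) (y, ξ) h.differentiableAt.hasFDerivAt hasFDerivAt_fst
  have h3 := hasFDerivAt_snd (𝕜 := ℝ) (p := ((y, ξ) : E × (E →L[ℝ] ℝ)))
  refine ⟨_, h1.prodMk (h3.clm_comp h2), fun u ζ => ?_⟩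
  ext1
  · simp
  · ext w
    simp [add_comm]

/-- The induced map on cotangent vectors takes the tangent vector with horizontal part `X` and
vertical part `θ` to the one with horizontal part `dτ X` and vertical part `θ ∘ (dτ)⁻¹`. -/
theorem cotangent_horizontal_add_vertical (h : IsChartChange G G' τ A y) (hG : IsMetricOn G U)
    (hG' : IsMetricOn G' U') (hy : y ∈ U) (hy' : τ y ∈ U') (ξ θ : E →L[ℝ] ℝ) (X : E) :
    (θ + ξ.comp (christoffelL G y X)).comp (A y) + ξ.comp (fderiv ℝ A y X) =
      θ.comp (A y) + (ξ.comp (A y)).comp (christoffelL G' (τ y) (fderiv ℝ τ y X)) := by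
  ext w'
  obtain ⟨w, rfl⟩ : ∃ w, fderiv ℝ τ y w = w' := ⟨A y w', h.right_inv w'⟩
  simp only [add_apply, ContinuousLinearMap.comp_apply, h.fderiv_left_inv,
    h.christoffel_eq hG hG' hy hy', map_sub, map_neg, h.left_inv.self_of_nhds]
  ring

/-- The natural tensor field `J` is invariant under changes of coordinates. -/
theorem localJ_natural (h : IsChartChange G G' τ A y) (hG : IsMetricOn G U)
    (hG' : IsMetricOn G' U') (hy : y ∈ U) (hy' : τ y ∈ U') (C : Coefficients) (ξ : E →L[ℝ] ℝ)
    {D : E × (E →L[ℝ] ℝ) →L[ℝ] E × (E →L[ℝ] ℝ)}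
    (hD : HasFDerivAt (fun z : E × (E →L[ℝ] ℝ) => (τ z.1, z.2.comp (A z.1))) D (y, ξ))
    (v : E × (E →L[ℝ] ℝ)) :
    D (localJ G C (y, ξ) v) = localJ G' C (τ y, ξ.comp (A y)) (D v) := by
  obtain ⟨D', hD1, hD2⟩ := h.hasFDerivAt_cotangent ξ
  obtain rfl := hD.unique hD1
  have hS := h.inverse_eq hG hG' hy hy'
  have hL := h.left_inv.self_of_nhds
  have hen : fibreEnergy (G' (τ y)) (ξ.comp (A y)) = fibreEnergy (G y) ξ := by
    rw [fibreEnergy, hS, ContinuousLinearMap.comp_apply, hL, fibreEnergy]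
  have hH : ∀ X θ, fibreH (G' (τ y)) C (ξ.comp (A y)) (fderiv ℝ τ y X) (θ.comp (A y)) =
      fderiv ℝ τ y (fibreH (G y) C ξ X θ) := fun X θ => by
    simp only [fibreH, hen, hS, ContinuousLinearMap.comp_apply, hL, map_add, map_sub, map_smul]
  have hB : ∀ X, G' (τ y) (fderiv ℝ τ y X) = (G y X).comp (A y) := fun X => by
    ext w'
    obtain ⟨w, rfl⟩ : ∃ w, fderiv ℝ τ y w = w' := ⟨A y w', h.right_inv w'⟩
    rw [← h.isometry.self_of_nhds, ContinuousLinearMap.comp_apply, hL]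
  have hV : ∀ X θ, fibreV (G' (τ y)) C (ξ.comp (A y)) (fderiv ℝ τ y X) (θ.comp (A y)) =
      (fibreV (G y) C ξ X θ).comp (A y) := fun X θ => by
    simp only [fibreV, hen, hS, hB, ContinuousLinearMap.comp_apply, hL,
      ContinuousLinearMap.add_comp, ContinuousLinearMap.smul_comp]
  obtain ⟨X, ζ⟩ := v
  obtain ⟨θ, rfl⟩ : ∃ θ, ζ = θ + ξ.comp (christoffelL G y X) :=
    ⟨ζ - ξ.comp (christoffelL G y X), by abel⟩
  rw [localJ_horizontal_add_vertical, hD2, hD2,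
    h.cotangent_horizontal_add_vertical hG hG' hy hy',
    h.cotangent_horizontal_add_vertical hG hG' hy hy', localJ_horizontal_add_vertical, hH, hV]

end IsChartChange

end Naturality

/-! ### Charts of the base -/

section BaseCharts

open VectorField Set

variable {E : Type*} [NormedAddCommGroup E] [NormedSpace ℝ E]
  {M : Type*} [TopologicalSpace M] [ChartedSpace E M] [IsManifold 𝓘(ℝ, E) ∞ M]

/-- As tangent vectors at a point are their coordinates in the preferred chart at that point, the
derivative of the inverse of a chart is a coordinate change. -/
theorem mfderiv_extChartAt_symm {x₀ : M} {y : E} (hy : y ∈ (extChartAt 𝓘(ℝ, E) x₀).target)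
    (v : E) :
    (mfderiv 𝓘(ℝ, E) 𝓘(ℝ, E) (extChartAt 𝓘(ℝ, E) x₀).symm y : E →L[ℝ] E) v =
      tangentCoordChange 𝓘(ℝ, E) x₀ ((extChartAt 𝓘(ℝ, E) x₀).symm y)
        ((extChartAt 𝓘(ℝ, E) x₀).symm y) v := by
  have h1 := (extChartAt 𝓘(ℝ, E) x₀).map_target hy
  rw [extChartAt_source] at h1
  have h2 := TangentBundle.symmL_trivializationAt (I := 𝓘(ℝ, E)) h1
  rw [TangentBundle.symmL_trivializationAt_eq_core h1] at h2
  rw [PartialEquiv.right_inv _ hy] at h2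
  simp only [modelWithCornersSelf_coe, range_id, mfderivWithin_univ] at h2
  exact (congrArg (fun l : E →L[ℝ] E => l v) h2).symm

theorem metricInChart_apply (g : SmoothMetric E M) {x₀ : M} {y : E}
    (hy : y ∈ (extChartAt 𝓘(ℝ, E) x₀).target) (u v : E) :
    metricInChart g x₀ y u v = (g.inner ((extChartAt 𝓘(ℝ, E) x₀).symm y) : E →L[ℝ] E →L[ℝ] ℝ)
      (tangentCoordChange 𝓘(ℝ, E) x₀ ((extChartAt 𝓘(ℝ, E) x₀).symm y)
        ((extChartAt 𝓘(ℝ, E) x₀).symm y) u)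
      (tangentCoordChange 𝓘(ℝ, E) x₀ ((extChartAt 𝓘(ℝ, E) x₀).symm y)
        ((extChartAt 𝓘(ℝ, E) x₀).symm y) v) := by
  rw [← mfderiv_extChartAt_symm hy, ← mfderiv_extChartAt_symm hy]
  rfl

theorem metricInChart_self (g : SmoothMetric E M) (x : M) :
    metricInChart g x (extChartAt 𝓘(ℝ, E) x x) = g.inner x := by
  ext u v
  rw [metricInChart_apply g (mem_extChartAt_target x), extChartAt_to_inv,
    tangentCoordChange_self (mem_extChartAt_source x),
    tangentCoordChange_self (mem_extChartAt_source x)]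
  rfl

theorem contDiffOn_metricInChart (g : SmoothMetric E M) (x₀ : M) (u v : E) :
    ContDiffOn ℝ ∞ (fun y => metricInChart g x₀ y u v) (extChartAt 𝓘(ℝ, E) x₀).target := by
  rw [← contMDiffOn_iff_contDiffOn]
  have h0 : ContMDiffOn 𝓘(ℝ, E) 𝓘(ℝ, E) ∞ (extChartAt 𝓘(ℝ, E) x₀).symm
    (extChartAt 𝓘(ℝ, E) x₀).target := contMDiffOn_extChartAt_symm x₀
  have ho := isOpen_extChartAt_target (I := 𝓘(ℝ, E)) x₀
  have h1 : ∀ w : E, ContMDiffOn 𝓘(ℝ, E) 𝓘(ℝ, E).tangent ∞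
      (fun y : E => (⟨(extChartAt 𝓘(ℝ, E) x₀).symm y,
        mfderiv 𝓘(ℝ, E) 𝓘(ℝ, E) (extChartAt 𝓘(ℝ, E) x₀).symm y w⟩ : TangentBundle 𝓘(ℝ, E) M))
      (extChartAt 𝓘(ℝ, E) x₀).target := fun w => by
    have h2 := h0.contMDiffOn_tangentMapWithin (m := ∞) (by simp) ho.uniqueMDiffOn
    have h3 : ContMDiffOn 𝓘(ℝ, E) 𝓘(ℝ, E).tangent ∞
        (fun y : E => (⟨y, w⟩ : TangentBundle 𝓘(ℝ, E) E)) (extChartAt 𝓘(ℝ, E) x₀).target :=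
      (contMDiff_vectorSpace_iff_contDiff.2 contDiff_const).contMDiffOn
    refine (h2.comp h3 fun y hy => hy).congr fun y hy => ?_
    simp only [Function.comp_apply, tangentMapWithin]
    rw [mfderivWithin_of_isOpen ho hy]
  have h4 := ContMDiffOn.clm_bundle_apply₂ (n := ∞) (IB := 𝓘(ℝ, E)) (F₃ := ℝ)
    (E₃ := fun _ : M => ℝ) (g.contMDiff.comp_contMDiffOn h0) (h1 u) (h1 v)
  intro y hy
  exact ((contMDiffWithinAt_totalSpace.1 (h4 y hy)).2)

variable [FiniteDimensional ℝ E]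

theorem isMetricOn_metricInChart (g : SmoothMetric E M) (x₀ : M) :
    IsMetricOn (metricInChart g x₀) (extChartAt 𝓘(ℝ, E) x₀).target where
  isOpen := isOpen_extChartAt_target x₀
  contDiffOn := by
    refine contDiffOn_clm_apply.2 fun u => contDiffOn_clm_apply.2 fun v => ?_
    exact contDiffOn_metricInChart g x₀ u v
  symm y hy u v := by
    rw [metricInChart_apply g hy, metricInChart_apply g hy]
    exact g.symm _ _ _
  pos y hy v hv := by
    rw [metricInChart_apply g hy]
    refine g.pos _ _ fun h0 => hv ?_
    have h1 := tangentCoordChange_comp (I := 𝓘(ℝ, E)) (w := x₀)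
      (x := (extChartAt 𝓘(ℝ, E) x₀).symm y) (y := x₀) (z := (extChartAt 𝓘(ℝ, E) x₀).symm y)
      (v := v) ⟨⟨(extChartAt 𝓘(ℝ, E) x₀).map_target hy, mem_extChartAt_source _⟩,
        (extChartAt 𝓘(ℝ, E) x₀).map_target hy⟩
    rw [tangentCoordChange_self ((extChartAt 𝓘(ℝ, E) x₀).map_target hy)] at h1
    rw [← h1]
    refine (congrArg _ h0).trans (map_zero _)

omit [FiniteDimensional ℝ E] in
/-- The transition maps between the preferred charts are isometries between the coordinate
expressions of the metric. -/
theorem isChartChange (g : SmoothMetric E M) (x₀ x₁ : M) {y : E}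
    (hy : y ∈ (extChartAt 𝓘(ℝ, E) x₀).target)
    (hy' : (extChartAt 𝓘(ℝ, E) x₀).symm y ∈ (extChartAt 𝓘(ℝ, E) x₁).source) :
    IsChartChange (metricInChart g x₀) (metricInChart g x₁)
      (extChartAt 𝓘(ℝ, E) x₁ ∘ (extChartAt 𝓘(ℝ, E) x₀).symm)
      (fun z => tangentCoordChange 𝓘(ℝ, E) x₁ x₀ ((extChartAt 𝓘(ℝ, E) x₀).symm z)) y := by
  have key : ∀ (x₀ x₁ : M) {y : E}, y ∈ (extChartAt 𝓘(ℝ, E) x₀).target →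
      (extChartAt 𝓘(ℝ, E) x₀).symm y ∈ (extChartAt 𝓘(ℝ, E) x₁).source →
      ContDiffAt ℝ ∞ (extChartAt 𝓘(ℝ, E) x₁ ∘ (extChartAt 𝓘(ℝ, E) x₀).symm) y := by
    intro x₀ x₁ y hy hy'
    have h1 := contDiffWithinAt_ext_coord_change (n := ∞) (I := 𝓘(ℝ, E)) x₁ x₀ (y := y)
      ⟨hy, hy'⟩
    rwa [modelWithCornersSelf_coe, range_id, contDiffWithinAt_univ] at h1
  have hev : ∀ᶠ z in nhds y, z ∈ (extChartAt 𝓘(ℝ, E) x₀).target ∧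
      (extChartAt 𝓘(ℝ, E) x₀).symm z ∈ (extChartAt 𝓘(ℝ, E) x₁).source :=
    ((isOpen_extChartAt_target x₀).eventually_mem hy).and
      ((continuousAt_extChartAt_symm'' hy).eventually_mem
        ((isOpen_extChartAt_source x₁).mem_nhds hy'))
  have hfd : ∀ z, z ∈ (extChartAt 𝓘(ℝ, E) x₀).target →
      fderiv ℝ (extChartAt 𝓘(ℝ, E) x₁ ∘ (extChartAt 𝓘(ℝ, E) x₀).symm) z =
        tangentCoordChange 𝓘(ℝ, E) x₀ x₁ ((extChartAt 𝓘(ℝ, E) x₀).symm z) := fun z hz => by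
    rw [tangentCoordChange_def, PartialEquiv.right_inv _ hz]
    simp
  constructor
  · exact key x₀ x₁ hy hy'
  · have h2 := (((key x₁ x₀ ((extChartAt 𝓘(ℝ, E) x₁).map_source hy') (by
      rw [PartialEquiv.left_inv _ hy']
      exact (extChartAt 𝓘(ℝ, E) x₀).map_target hy)).fderiv_right (m := ∞) (by simp)).comp y
      (key x₀ x₁ hy hy')).differentiableAt (by simp)
    refine h2.congr_of_eventuallyEq (Filter.Eventually.of_forall fun z => ?_)
    simp
  · filter_upwards [hev] with z hz v
    rw [hfd z hz.1, tangentCoordChange_comp ⟨⟨(extChartAt 𝓘(ℝ, E) x₀).map_target hz.1, hz.2⟩,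
      (extChartAt 𝓘(ℝ, E) x₀).map_target hz.1⟩,
      tangentCoordChange_self ((extChartAt 𝓘(ℝ, E) x₀).map_target hz.1)]
  · filter_upwards [hev] with z hz u v
    rw [metricInChart_apply g hz.1, metricInChart_apply g (by
      exact (extChartAt 𝓘(ℝ, E) x₁).map_source hz.2), hfd z hz.1, Function.comp_apply,
      PartialEquiv.left_inv _ hz.2]
    have h3 : ∀ v, _ := fun v => tangentCoordChange_comp (I := 𝓘(ℝ, E)) (w := x₀) (x := x₁)
      (y := (extChartAt 𝓘(ℝ, E) x₀).symm z) (z := (extChartAt 𝓘(ℝ, E) x₀).symm z)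
      (v := v) ⟨⟨(extChartAt 𝓘(ℝ, E) x₀).map_target hz.1, hz.2⟩, mem_extChartAt_source _⟩
    rw [h3, h3]

end BaseCharts

/-! ### Charts of the cotangent bundle -/

section CotangentCharts

open VectorField Set

variable {E : Type*} [NormedAddCommGroup E] [NormedSpace ℝ E]
  {M : Type*} [TopologicalSpace M] [ChartedSpace E M] [IsManifold 𝓘(ℝ, E) ∞ M]

/-- The chart of the cotangent bundle around `p` is induced by the chart of the base around the
base point of `p`. -/
theorem cotangent_extChartAt_apply (p q : CotangentBundle E M)
    (hq : q.1 ∈ (extChartAt 𝓘(ℝ, E) p.1).source) :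
    extChartAt (cotangentModel E) p q = (extChartAt 𝓘(ℝ, E) p.1 q.1,
      (show E →L[ℝ] ℝ from q.2).comp (tangentCoordChange 𝓘(ℝ, E) p.1 q.1 q.1)) := by
  rw [FiberBundle.extChartAt]
  rw [extChartAt_source] at hq
  refine Prod.ext rfl ?_
  ext v
  have h2 := TangentBundle.symmL_trivializationAt_eq_core (I := 𝓘(ℝ, E)) hq
  have h3 := congrArg (fun l : E →L[ℝ] E => (show E →L[ℝ] ℝ from q.2) (l v)) h2
  have h4 := Trivial.continuousLinearMapAt_trivialization ℝ M ℝ q.1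
  refine Eq.trans ?_ h3
  exact congrArg (fun l : ℝ →L[ℝ] ℝ => l ((show E →L[ℝ] ℝ from q.2)
    ((trivializationAt E (TangentSpace 𝓘(ℝ, E)) p.1).symmL ℝ q.1 v))) h4

theorem cotangent_extChartAt_target (p : CotangentBundle E M) :
    (extChartAt (cotangentModel E) p).target = (extChartAt 𝓘(ℝ, E) p.1).target ×ˢ univ := by
  rw [FiberBundle.extChartAt_target]
  ext z
  have h1 := (extChartAt 𝓘(ℝ, E) p.1).map_target (x := z.1)
  rw [extChartAt_source] at h1
  simpa using h1

theorem cotangent_extChartAt_source (p : CotangentBundle E M) :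
    (extChartAt (cotangentModel E) p).source =
      TotalSpace.proj ⁻¹' (extChartAt 𝓘(ℝ, E) p.1).source := by
  rw [FiberBundle.extChartAt]
  ext z
  have h1 : ((trivializationAt (E →L[ℝ] ℝ)
    (fun x : M => TangentSpace 𝓘(ℝ, E) x →L[ℝ] ℝ) p.1) z).1 = z.1 := rfl
  simp [h1]

theorem cotangent_extChartAt_symm_apply (p : CotangentBundle E M) (z : E × (E →L[ℝ] ℝ))
    (hz : z.1 ∈ (extChartAt 𝓘(ℝ, E) p.1).target) :
    (extChartAt (cotangentModel E) p).symm z = ⟨(extChartAt 𝓘(ℝ, E) p.1).symm z.1,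
      show E →L[ℝ] ℝ from
        z.2.comp (tangentCoordChange 𝓘(ℝ, E) ((extChartAt 𝓘(ℝ, E) p.1).symm z.1) p.1
          ((extChartAt 𝓘(ℝ, E) p.1).symm z.1))⟩ := by
  have hs := (extChartAt 𝓘(ℝ, E) p.1).map_target hz
  rw [← (extChartAt (cotangentModel E) p).left_inv (x := ⟨(extChartAt 𝓘(ℝ, E) p.1).symm z.1,
      show E →L[ℝ] ℝ from
        z.2.comp (tangentCoordChange 𝓘(ℝ, E) ((extChartAt 𝓘(ℝ, E) p.1).symm z.1) p.1
          ((extChartAt 𝓘(ℝ, E) p.1).symm z.1))⟩) (by rw [cotangent_extChartAt_source]; exact hs)]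
  congr 1
  rw [cotangent_extChartAt_apply _ _ hs]
  refine Prod.ext ((extChartAt 𝓘(ℝ, E) p.1).right_inv hz).symm ?_
  ext v
  have h1 := tangentCoordChange_comp (I := 𝓘(ℝ, E)) (w := p.1) (y := p.1)
    (x := (extChartAt 𝓘(ℝ, E) p.1).symm z.1) (z := (extChartAt 𝓘(ℝ, E) p.1).symm z.1)
    (v := v) ⟨⟨hs, mem_extChartAt_source _⟩, hs⟩
  rw [tangentCoordChange_self hs] at h1
  exact congrArg z.2 h1.symm

theorem cotangent_extChartAt_self (p : CotangentBundle E M) :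
    extChartAt (cotangentModel E) p p = (extChartAt 𝓘(ℝ, E) p.1 p.1, p.2) := by
  rw [cotangent_extChartAt_apply p p (mem_extChartAt_source _)]
  refine Prod.ext rfl ?_
  ext v
  exact congrArg (show E →L[ℝ] ℝ from p.2) (tangentCoordChange_self (mem_extChartAt_source _))

theorem cotangent_extChartAt_symm_fst (p : CotangentBundle E M) (z : E × (E →L[ℝ] ℝ))
    (hz : z.1 ∈ (extChartAt 𝓘(ℝ, E) p.1).target) :
    ((extChartAt (cotangentModel E) p).symm z).1 = (extChartAt 𝓘(ℝ, E) p.1).symm z.1 := by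
  rw [cotangent_extChartAt_symm_apply p z hz]

/-- The transition maps of the cotangent bundle are the maps induced by those of the base. -/
theorem cotangent_transition_apply (p q : CotangentBundle E M) (z : E × (E →L[ℝ] ℝ))
    (hz : z.1 ∈ (extChartAt 𝓘(ℝ, E) p.1).target)
    (hz' : (extChartAt 𝓘(ℝ, E) p.1).symm z.1 ∈ (extChartAt 𝓘(ℝ, E) q.1).source) :
    extChartAt (cotangentModel E) q ((extChartAt (cotangentModel E) p).symm z) =
      ((extChartAt 𝓘(ℝ, E) q.1 ∘ (extChartAt 𝓘(ℝ, E) p.1).symm) z.1,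
        z.2.comp (tangentCoordChange 𝓘(ℝ, E) q.1 p.1 ((extChartAt 𝓘(ℝ, E) p.1).symm z.1))) := by
  have hs := (extChartAt 𝓘(ℝ, E) p.1).map_target hz
  rw [cotangent_extChartAt_symm_apply p z hz, cotangent_extChartAt_apply _ _ hz']
  refine Prod.ext rfl ?_
  ext v
  exact congrArg z.2 (tangentCoordChange_comp (I := 𝓘(ℝ, E)) (w := q.1) (y := p.1)
    (x := (extChartAt 𝓘(ℝ, E) p.1).symm z.1) (z := (extChartAt 𝓘(ℝ, E) p.1).symm z.1)
    (v := v) ⟨⟨hz', mem_extChartAt_source _⟩, hs⟩)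

theorem mdifferentiableAt_cotangent_extChartAt_symm (p : CotangentBundle E M)
    (z : E × (E →L[ℝ] ℝ)) (hz : z ∈ (extChartAt (cotangentModel E) p).target) :
    MDifferentiableAt 𝓘(ℝ, E × (E →L[ℝ] ℝ)) (cotangentModel E)
      (extChartAt (cotangentModel E) p).symm z := by
  have h1 := mdifferentiableWithinAt_extChartAt_symm hz
  rwa [ModelWithCorners.range_eq_univ, mdifferentiableWithinAt_univ] at h1

/-- The derivative of the inverse of a chart of the cotangent bundle at a point is that of the
transition map to the preferred chart at its image. -/
theorem mfderiv_cotangent_extChartAt_symm (p : CotangentBundle E M) (z : E × (E →L[ℝ] ℝ))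
    (hz : z.1 ∈ (extChartAt 𝓘(ℝ, E) p.1).target) :
    (mfderiv 𝓘(ℝ, E × (E →L[ℝ] ℝ)) (cotangentModel E) (extChartAt (cotangentModel E) p).symm z :
      E × (E →L[ℝ] ℝ) →L[ℝ] E × (E →L[ℝ] ℝ)) =
      fderiv ℝ (extChartAt (cotangentModel E) ((extChartAt (cotangentModel E) p).symm z) ∘
        (extChartAt (cotangentModel E) p).symm) z := by
  have h1 := (mdifferentiableAt_cotangent_extChartAt_symm p z
    (by rw [cotangent_extChartAt_target]; exact ⟨hz, mem_univ _⟩)).mfderiv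
  simp only [modelWithCornersSelf_coe, range_id, fderivWithin_univ] at h1
  exact h1

end CotangentCharts

/-! ### Vector fields in charts -/

section FieldInChart

open Set VectorField

variable {F : Type*} [NormedAddCommGroup F] [NormedSpace ℝ F] {H : Type*} [TopologicalSpace H]
  (I : ModelWithCorners ℝ F H) {N : Type*} [TopologicalSpace N] [ChartedSpace H N]

/-- The coordinate expression of the vector field `X` in the preferred chart around `p`. -/
def fieldInChart (X : ∀ q : N, TangentSpace I q) (p : N) (z : F) : F :=
  mpullbackWithin 𝓘(ℝ, F) I (extChartAt I p).symm X (range I) z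

variable [IsManifold I 1 N]

theorem fieldInChart_self (X : ∀ q : N, TangentSpace I q) (p : N) :
    fieldInChart I X p (extChartAt I p p) = X p := by
  rw [fieldInChart, mpullbackWithin_apply, mfderivWithin_range_extChartAt_symm,
    extChartAt_to_inv]
  erw [ContinuousLinearMap.inverse_id]
  rfl

theorem mlieBracket_eq_lieBracket_fieldInChart [I.Boundaryless] (X Y : ∀ q : N, TangentSpace I q)
    (p : N) : mlieBracket I X Y p =
      lieBracket ℝ (fieldInChart I X p) (fieldInChart I Y p) (extChartAt I p p) := by
  have h1 : (mfderiv I 𝓘(ℝ, F) (extChartAt I p) p : F →L[ℝ] F) = ContinuousLinearMap.id ℝ F :=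
    mfderiv_extChartAt_self
  have h2 := congrArg (fun l : F →L[ℝ] F => l.inverse (lieBracketWithin ℝ (fieldInChart I X p)
    (fieldInChart I Y p) ((extChartAt I p).symm ⁻¹' univ ∩ range I) (extChartAt I p p))) h1
  refine Eq.trans (b := _) h2 ?_
  simp only [preimage_univ, univ_inter, ModelWithCorners.range_eq_univ, lieBracketWithin_univ,
    ContinuousLinearMap.inverse_id]
  rfl

end FieldInChart

section FieldInChartSmooth

open Set VectorField

variable {F : Type*} [NormedAddCommGroup F] [NormedSpace ℝ F] {H : Type*} [TopologicalSpace H]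
  (I : ModelWithCorners ℝ F H) {N : Type*} [TopologicalSpace N] [ChartedSpace H N]

theorem differentiableAt_fieldInChart [IsManifold I ∞ N] [I.Boundaryless] [CompleteSpace F]
    {X : ∀ q : N, TangentSpace I q}
    (hX : ContMDiff I I.tangent ∞ (fun p => (⟨p, X p⟩ : TangentBundle I N))) (p : N) :
    DifferentiableAt ℝ (fieldInChart I X p) (extChartAt I p p) := by
  have : IsManifold I 2 N := inferInstance
  have h1 := ((hX p).mdifferentiableAt (by simp)).mdifferentiableWithinAt (s := univ)
    |>.differentiableWithinAt_mpullbackWithin_vectorField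
  rw [preimage_univ, univ_inter] at h1
  have h2 : DifferentiableWithinAt ℝ (fieldInChart I X p) (range I) (extChartAt I p p) := h1
  rwa [ModelWithCorners.range_eq_univ, differentiableWithinAt_univ] at h2

end FieldInChartSmooth

/-! ### The natural tensor field in charts -/

section NaturalInChart

open Set VectorField

set_option synthInstance.maxHeartbeats 200000

variable {E : Type*} [NormedAddCommGroup E] [NormedSpace ℝ E] [FiniteDimensional ℝ E]
  {M : Type*} [TopologicalSpace M] [ChartedSpace E M] [IsManifold 𝓘(ℝ, E) ∞ M]

/-- The sum of lifts defining `J`, with the lifts written out as pairs of coordinates. -/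
theorem localJ_eq_sum (G : E → E →L[ℝ] E →L[ℝ] ℝ) (C : Coefficients) (y : E) (ξ : E →L[ℝ] ℝ)
    (B : E →L[ℝ] E →L[ℝ] ℝ) (hB : G y = B) (X : E) (θ ζ : E →L[ℝ] ℝ)
    (hθ : θ = ζ - ξ.comp (christoffelOf G y X)) (t : ℝ) (ht : t = 1 / 2 * ξ (B.inverse ξ)) :
    (C.a₁ t • ((0, B X) : E × (E →L[ℝ] ℝ)) + (C.b₁ t * ξ X) • ((0, ξ) : E × (E →L[ℝ] ℝ))
        + C.a₄ t • ((X, ξ.comp (christoffelOf G y X)) : E × (E →L[ℝ] ℝ))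
        + (C.b₄ t * ξ X) • ((B.inverse ξ, ξ.comp (christoffelOf G y (B.inverse ξ))) :
            E × (E →L[ℝ] ℝ)))
      + (C.a₃ t • ((0, θ) : E × (E →L[ℝ] ℝ))
        + (C.b₃ t * ξ (B.inverse θ)) • ((0, ξ) : E × (E →L[ℝ] ℝ))
        - C.a₂ t • ((B.inverse θ, ξ.comp (christoffelOf G y (B.inverse θ))) : E × (E →L[ℝ] ℝ))
        - (C.b₂ t * ξ (B.inverse θ)) • ((B.inverse ξ,
            ξ.comp (christoffelOf G y (B.inverse ξ))) : E × (E →L[ℝ] ℝ))) =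
      localJ G C (y, ξ) (X, ζ) := by
  simp only [← christoffelL_apply] at hθ ⊢
  have hζ : ζ = θ + ξ.comp (christoffelL G y X) := by rw [hθ]; abel
  rw [hζ, localJ_horizontal_add_vertical, hB, fibreH, fibreV]
  have ht' : fibreEnergy B ξ = t := by rw [ht, fibreEnergy]
  rw [ht']
  refine Prod.ext ?_ ?_
  · simp only [Prod.fst_add, Prod.fst_sub, Prod.smul_mk, smul_zero]
    abel
  · ext w
    simp only [Prod.snd_add, Prod.snd_sub, Prod.smul_mk, add_apply, sub_apply, map_add, map_sub,
      map_smul, smul_apply, ContinuousLinearMap.comp_apply, smul_eq_mul]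
    ring

theorem naturalJ_eq_localJ (g : SmoothMetric E M) (C : Coefficients) (p : CotangentBundle E M)
    (v : TangentSpace (cotangentModel E) p) :
    naturalJ g C p v =
      localJ (metricInChart g p.1) C (extChartAt 𝓘(ℝ, E) p.1 p.1, p.2) v :=
  localJ_eq_sum (metricInChart g p.1) C (extChartAt 𝓘(ℝ, E) p.1 p.1) p.2 (g.inner p.1)
    (metricInChart_self g p.1) (Prod.fst (α := E) (β := E →L[ℝ] ℝ) v) (vPart g p v)
    (Prod.snd (α := E) (β := E →L[ℝ] ℝ) v) rfl (energy g p) rfl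

theorem curvature_eq_localCurvature (g : SmoothMetric E M) (x : M)
    (u v w : TangentSpace 𝓘(ℝ, E) x) :
    curvature g x u v w =
      localCurvature (metricInChart g x) (extChartAt 𝓘(ℝ, E) x x) u v w := by
  have h1 : ∀ v w : E, fderiv ℝ (fun z => christoffel g x z v w) (extChartAt 𝓘(ℝ, E) x x) =
      ((fderiv ℝ (christoffelL (metricInChart g x)) (extChartAt 𝓘(ℝ, E) x x)).flip v).flip w := by
    intro v w
    have h2 := (((isMetricOn_metricInChart g x).contDiffAt_christoffelL
      (mem_extChartAt_target x)).differentiableAt (by simp)).hasFDerivAt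
    have h3 := (h2.clm_apply (hasFDerivAt_const v _)).clm_apply (hasFDerivAt_const w _)
    simp only [christoffelL_apply] at h3
    unfold christoffel
    rw [h3.fderiv]
    ext u
    simp
  have h2 : ∀ u v : E, christoffel g x (extChartAt 𝓘(ℝ, E) x x) u v =
    christoffelL (metricInChart g x) (extChartAt 𝓘(ℝ, E) x x) u v := fun u v => by
      rw [christoffelL_apply]; rfl
  have h3 := fun u v w : E => congrArg (fun l : E →L[ℝ] E => l u) (h1 v w)
  have h4 : (_ : E) = _ := congrArg₂ (fun a b : E => a - b) (h3 u v w) (h3 v u w)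
  have h5 : ∀ u v w : E, (christoffel g x (extChartAt 𝓘(ℝ, E) x x) u
      (christoffel g x (extChartAt 𝓘(ℝ, E) x x) v w) : E) =
      christoffelL (metricInChart g x) (extChartAt 𝓘(ℝ, E) x x) u
        (christoffelL (metricInChart g x) (extChartAt 𝓘(ℝ, E) x x) v w) := fun u v w => by
    rw [h2, h2]
  exact congrArg₂ (fun a b : E => a - b) (congrArg₂ (fun a b : E => a + b) h4 (h5 u v w)) (h5 v u w)

/-- The derivative of a chart of the cotangent bundle intertwines the coordinate expression of `J`
in that chart with `J`. -/
theorem mfderiv_localJ (g : SmoothMetric E M) (C : Coefficients) (p : CotangentBundle E M)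
    {z : E × (E →L[ℝ] ℝ)} (hz : z.1 ∈ (extChartAt 𝓘(ℝ, E) p.1).target) (v : E × (E →L[ℝ] ℝ)) :
    mfderiv 𝓘(ℝ, E × (E →L[ℝ] ℝ)) (cotangentModel E) (extChartAt (cotangentModel E) p).symm z
        (localJ (metricInChart g p.1) C z v) =
      naturalJ g C ((extChartAt (cotangentModel E) p).symm z)
        (mfderiv 𝓘(ℝ, E × (E →L[ℝ] ℝ)) (cotangentModel E)
          (extChartAt (cotangentModel E) p).symm z v) := by
  set q := (extChartAt (cotangentModel E) p).symm z with hq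
  have hq1 : q.1 = (extChartAt 𝓘(ℝ, E) p.1).symm z.1 := cotangent_extChartAt_symm_fst p z hz
  have hs : (extChartAt 𝓘(ℝ, E) p.1).symm z.1 ∈ (extChartAt 𝓘(ℝ, E) q.1).source := by
    rw [← hq1]
    exact mem_extChartAt_source q.1
  have hc := isChartChange g p.1 q.1 hz hs
  obtain ⟨D, hD, -⟩ := hc.hasFDerivAt_cotangent z.2
  have hev : ∀ᶠ z' in nhds z, z'.1 ∈ (extChartAt 𝓘(ℝ, E) p.1).target ∧
      (extChartAt 𝓘(ℝ, E) p.1).symm z'.1 ∈ (extChartAt 𝓘(ℝ, E) q.1).source :=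
    continuousAt_fst.eventually (((isOpen_extChartAt_target p.1).eventually_mem hz).and
      ((continuousAt_extChartAt_symm'' hz).eventually_mem
        ((isOpen_extChartAt_source q.1).mem_nhds hs)))
  have hD' : HasFDerivAt (extChartAt (cotangentModel E) q ∘ (extChartAt (cotangentModel E) p).symm)
      D z := hD.congr_of_eventuallyEq (hev.mono fun z' hz' =>
        cotangent_transition_apply p q z' hz'.1 hz'.2)
  have hm : (mfderiv 𝓘(ℝ, E × (E →L[ℝ] ℝ)) (cotangentModel E)
      (extChartAt (cotangentModel E) p).symm z : E × (E →L[ℝ] ℝ) →L[ℝ] E × (E →L[ℝ] ℝ)) = D :=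
    (mfderiv_cotangent_extChartAt_symm p z hz).trans hD'.fderiv
  have hτ : (extChartAt 𝓘(ℝ, E) q.1 q.1, (show E →L[ℝ] ℝ from q.2)) =
      ((extChartAt 𝓘(ℝ, E) q.1 ∘ (extChartAt 𝓘(ℝ, E) p.1).symm) z.1,
        z.2.comp (tangentCoordChange 𝓘(ℝ, E) q.1 p.1 ((extChartAt 𝓘(ℝ, E) p.1).symm z.1))) := by
    rw [← cotangent_transition_apply p q z hz hs, ← hq]
    exact (cotangent_extChartAt_self q).symm
  have h1 := hc.localJ_natural (isMetricOn_metricInChart g p.1) (isMetricOn_metricInChart g q.1)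
    hz ((extChartAt 𝓘(ℝ, E) q.1).map_source hs) C z.2 hD v
  rw [← hτ] at h1
  have h2 := h1.trans (naturalJ_eq_localJ g C q (D v)).symm
  rw [← hm] at h2
  exact h2

end NaturalInChart

/-! ### The Nijenhuis tensor in charts -/

section NijenhuisInChart

open Set VectorField Filter

set_option synthInstance.maxHeartbeats 200000

variable {E : Type*} [NormedAddCommGroup E] [NormedSpace ℝ E] [FiniteDimensional ℝ E]
  {M : Type*} [TopologicalSpace M] [ChartedSpace E M] [IsManifold 𝓘(ℝ, E) ∞ M]

omit [FiniteDimensional ℝ E] in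
theorem isInvertible_mfderiv_cotangent_extChartAt_symm (p : CotangentBundle E M)
    {z : E × (E →L[ℝ] ℝ)} (hz : z.1 ∈ (extChartAt 𝓘(ℝ, E) p.1).target) :
    (mfderiv 𝓘(ℝ, E × (E →L[ℝ] ℝ)) (cotangentModel E)
      (extChartAt (cotangentModel E) p).symm z).IsInvertible := by
  have h1 := isInvertible_mfderivWithin_extChartAt_symm (I := cotangentModel E) (x := p) (y := z)
    (by rw [cotangent_extChartAt_target]; exact ⟨hz, mem_univ _⟩)
  rwa [ModelWithCorners.range_eq_univ, mfderivWithin_univ] at h1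

theorem localJ_localJ {g : SmoothMetric E M} {C : Coefficients}
    (hJ : IsAlmostComplex (cotangentModel E) (naturalJ g C)) (p : CotangentBundle E M)
    {z : E × (E →L[ℝ] ℝ)} (hz : z.1 ∈ (extChartAt 𝓘(ℝ, E) p.1).target) (v : E × (E →L[ℝ] ℝ)) :
    localJ (metricInChart g p.1) C z (localJ (metricInChart g p.1) C z v) = -v := by
  set m : E × (E →L[ℝ] ℝ) →L[ℝ] E × (E →L[ℝ] ℝ) :=
    mfderiv 𝓘(ℝ, E × (E →L[ℝ] ℝ)) (cotangentModel E) (extChartAt (cotangentModel E) p).symm z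
    with hm
  have h1 : ∀ w, m (localJ (metricInChart g p.1) C z w) =
      naturalJ g C ((extChartAt (cotangentModel E) p).symm z) (m w) := mfderiv_localJ g C p hz
  have h2 : m (localJ (metricInChart g p.1) C z (localJ (metricInChart g p.1) C z v)) = -m v := by
    rw [h1, h1]
    exact hJ _ (m v)
  have hi : m.IsInvertible := isInvertible_mfderiv_cotangent_extChartAt_symm p hz
  exact hi.injective (h2.trans (map_neg m v).symm)

theorem fieldInChart_naturalJ (g : SmoothMetric E M) (C : Coefficients) (p : CotangentBundle E M)
    (X : ∀ q : CotangentBundle E M, TangentSpace (cotangentModel E) q)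
    {z : E × (E →L[ℝ] ℝ)} (hz : z.1 ∈ (extChartAt 𝓘(ℝ, E) p.1).target) :
    fieldInChart (cotangentModel E) (fun q => naturalJ g C q (X q)) p z =
      localJ (metricInChart g p.1) C z (fieldInChart (cotangentModel E) X p z) := by
  set m : E × (E →L[ℝ] ℝ) →L[ℝ] E × (E →L[ℝ] ℝ) :=
    mfderiv 𝓘(ℝ, E × (E →L[ℝ] ℝ)) (cotangentModel E) (extChartAt (cotangentModel E) p).symm z
    with hm
  have hi : m.IsInvertible := isInvertible_mfderiv_cotangent_extChartAt_symm p hz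
  have h1 : ∀ w, m (localJ (metricInChart g p.1) C z w) =
      naturalJ g C ((extChartAt (cotangentModel E) p).symm z) (m w) := mfderiv_localJ g C p hz
  have h2 : ∀ Y : ∀ q : CotangentBundle E M, TangentSpace (cotangentModel E) q,
      m (fieldInChart (cotangentModel E) Y p z) =
        (Y ((extChartAt (cotangentModel E) p).symm z) : E × (E →L[ℝ] ℝ)) := fun Y => by
    have h3 : fieldInChart (cotangentModel E) Y p z =
        m.inverse (Y ((extChartAt (cotangentModel E) p).symm z)) := by
      rw [fieldInChart, ModelWithCorners.range_eq_univ, mpullbackWithin_univ]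
      rfl
    rw [h3]
    exact hi.self_apply_inverse _
  refine hi.injective ((h2 _).trans ((h1 _).trans ?_).symm)
  rw [h2]

/-- The Nijenhuis tensor of `J` is the tensorial expression `flatNijenhuis` in cotangent
coordinates. -/
theorem nijenhuis_naturalJ {g : SmoothMetric E M} {C : Coefficients}
    (hJ : IsAlmostComplex (cotangentModel E) (naturalJ g C))
    {X Y : ∀ q : CotangentBundle E M, TangentSpace (cotangentModel E) q}
    (hX : ContMDiff (cotangentModel E) (cotangentModel E).tangent ∞
      (fun p => (⟨p, X p⟩ : TangentBundle (cotangentModel E) (CotangentBundle E M))))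
    (hY : ContMDiff (cotangentModel E) (cotangentModel E).tangent ∞
      (fun p => (⟨p, Y p⟩ : TangentBundle (cotangentModel E) (CotangentBundle E M))))
    (p : CotangentBundle E M) :
    nijenhuis (cotangentModel E) (naturalJ g C) X Y p =
      flatNijenhuis (localJ (metricInChart g p.1) C)
        (extChartAt 𝓘(ℝ, E) p.1 p.1, p.2) (X p) (Y p) := by
  set z : E × (E →L[ℝ] ℝ) := (extChartAt 𝓘(ℝ, E) p.1 p.1, p.2) with hzdef
  have hz : z.1 ∈ (extChartAt 𝓘(ℝ, E) p.1).target := mem_extChartAt_target p.1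
  have hz0 : extChartAt (cotangentModel E) p p = z := cotangent_extChartAt_self p
  have hev : ∀ X : ∀ q : CotangentBundle E M, TangentSpace (cotangentModel E) q,
      fieldInChart (cotangentModel E) (fun q => naturalJ g C q (X q)) p =ᶠ[nhds z]
        fun z => localJ (metricInChart g p.1) C z (fieldInChart (cotangentModel E) X p z) :=
    fun X => (continuousAt_fst.eventually
      ((isOpen_extChartAt_target p.1).eventually_mem hz)).mono fun z' hz' =>
        fieldInChart_naturalJ g C p X hz'
  have hdX := differentiableAt_fieldInChart (cotangentModel E) hX p
  have hdY := differentiableAt_fieldInChart (cotangentModel E) hY p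
  rw [hz0] at hdX hdY
  have hX0 := fieldInChart_self (cotangentModel E) X p
  have hY0 := fieldInChart_self (cotangentModel E) Y p
  rw [hz0] at hX0 hY0
  have key := lieBracket_nijenhuis_eq ((isMetricOn_metricInChart g p.1).differentiableAt_localJ C
    hz) (localJ_localJ hJ p hz) hdX hdY
  rw [hX0, hY0] at key
  have h1 := mlieBracket_eq_lieBracket_fieldInChart (N := CotangentBundle E M) (cotangentModel E)
    (p := p)
  rw [hz0] at h1
  have h2 := (h1 (fun q => naturalJ g C q (X q)) (fun q => naturalJ g C q (Y q))).trans
    ((hev X).lieBracket_vectorField_eq (hev Y))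
  have h3 := (naturalJ_eq_localJ g C p _).trans (congrArg
    (fun v : E × (E →L[ℝ] ℝ) => localJ (metricInChart g p.1) C z v)
    ((h1 (fun q => naturalJ g C q (X q)) Y).trans ((hev X).lieBracket_vectorField_eq .rfl)))
  have h4 := (naturalJ_eq_localJ g C p _).trans (congrArg
    (fun v : E × (E →L[ℝ] ℝ) => localJ (metricInChart g p.1) C z v)
    ((h1 X (fun q => naturalJ g C q (Y q))).trans
      ((Filter.EventuallyEq.refl (nhds z)
        (fieldInChart (cotangentModel E) X p)).lieBracket_vectorField_eq (hev Y))))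
  have hsub : ∀ {a b a' b' : E × (E →L[ℝ] ℝ)}, a = a' → b = b' → a - b = a' - b' :=
    fun h h' => congrArg₂ _ h h'
  exact (hsub (hsub (hsub h2 h3) h4) (h1 X Y)).trans key

/-- Every tangent vector is the value of a smooth vector field. -/
theorem exists_contMDiff_vectorField {F : Type*} [NormedAddCommGroup F] [NormedSpace ℝ F]
    [FiniteDimensional ℝ F] {H : Type*} [TopologicalSpace H] (I : ModelWithCorners ℝ F H)
    {N : Type*} [TopologicalSpace N] [T2Space N] [ChartedSpace H N] [IsManifold I ∞ N] (p : N)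
    (v : TangentSpace I p) :
    ∃ X : ∀ q : N, TangentSpace I q,
      ContMDiff I I.tangent ∞ (fun p => (⟨p, X p⟩ : TangentBundle I N)) ∧ X p = v := by
  obtain ⟨s, hs, hX⟩ := FiberBundle.exists_contMDiffOn_extend (k := ∞) I F v
  obtain ⟨u, hus, hu, hpu⟩ := mem_nhds_iff.1 hs
  obtain ⟨f, -, hf⟩ := (SmoothBumpFunction.nhds_basis_tsupport (I := I) p).mem_iff.1
    (hu.mem_nhds hpu)
  refine ⟨fun q => f q • FiberBundle.extend F v q, ?_, ?_⟩
  · exact ContMDiffOn.smul_section_of_tsupport (f.contMDiff.contMDiffOn) hu hf (hX.mono hus)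
  · simp

instance t2Space_cotangentBundle [T2Space M] : T2Space (CotangentBundle E M) := by
  refine ⟨fun p q hpq => ?_⟩
  by_cases h : p.1 = q.1
  · have hp := mem_extChartAt_source (I := cotangentModel E) p
    have hq : q ∈ (extChartAt (cotangentModel E) p).source := by
      rw [cotangent_extChartAt_source, mem_preimage, ← h]
      exact mem_extChartAt_source p.1
    obtain ⟨u, v, hu, hv, hpu, hqv, huv⟩ := t2_separation
      fun h' => hpq ((extChartAt (cotangentModel E) p).injOn hp hq h')
    have hc := continuousOn_extChartAt (I := cotangentModel E) p
    have ho := isOpen_extChartAt_source (I := cotangentModel E) p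
    exact ⟨_, _, hc.isOpen_inter_preimage ho hu, hc.isOpen_inter_preimage ho hv, ⟨hp, hpu⟩,
      ⟨hq, hqv⟩, (huv.preimage _).mono inter_subset_right inter_subset_right⟩
  · obtain ⟨u, v, hu, hv, hpu, hqv, huv⟩ := t2_separation h
    have hc := FiberBundle.continuous_proj (E →L[ℝ] ℝ)
      (fun x : M => TangentSpace 𝓘(ℝ, E) x →L[ℝ] ℝ)
    exact ⟨_, _, hu.preimage hc, hv.preimage hc, hpu, hqv, huv.preimage _⟩

end NijenhuisInChart

/-! ### Integrability of the natural tensor field -/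

section Characterization

open Set VectorField Filter

variable {E : Type*} [NormedAddCommGroup E] [NormedSpace ℝ E] [FiniteDimensional ℝ E]
  {M : Type*} [TopologicalSpace M] [ChartedSpace E M] [IsManifold 𝓘(ℝ, E) ∞ M]
  {g : SmoothMetric E M} {C : Coefficients}

theorem sectionalCurvature_eq (g : SmoothMetric E M) (x : M) (u v : TangentSpace 𝓘(ℝ, E) x) :
    sectionalCurvature g x u v =
      metricInChart g x (extChartAt 𝓘(ℝ, E) x x)
        (localCurvature (metricInChart g x) (extChartAt 𝓘(ℝ, E) x x) u v v) u /
        (metricInChart g x (extChartAt 𝓘(ℝ, E) x x) u u *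
          metricInChart g x (extChartAt 𝓘(ℝ, E) x x) v v -
          metricInChart g x (extChartAt 𝓘(ℝ, E) x x) u v ^ 2) := by
  rw [metricInChart_self, sectionalCurvature, curvature_eq_localCurvature]
  rfl

/-- The Nijenhuis tensor vanishes if and only if its coordinate expression does so at every
point. -/
theorem isIntegrable_iff_flatNijenhuis [T2Space M]
    (hJ : IsAlmostComplex (cotangentModel E) (naturalJ g C)) :
    IsIntegrable (cotangentModel E) (naturalJ g C) ↔
      ∀ (x : M) (ξ : E →L[ℝ] ℝ) (v w : E × (E →L[ℝ] ℝ)),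
        flatNijenhuis (localJ (metricInChart g x) C) (extChartAt 𝓘(ℝ, E) x x, ξ) v w = 0 := by
  refine ⟨fun h x ξ v w => ?_, fun h X Y hX hY p => ?_⟩
  · let p : CotangentBundle E M := ⟨x, ξ⟩
    obtain ⟨X, hX, rfl⟩ := exists_contMDiff_vectorField (cotangentModel E) p v
    obtain ⟨Y, hY, rfl⟩ := exists_contMDiff_vectorField (cotangentModel E) p w
    exact (nijenhuis_naturalJ hJ hX hY p).symm.trans (h X Y hX hY p)
  · rw [nijenhuis_naturalJ hJ hX hY p]
    exact h p.1 p.2 (X p) (Y p)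

theorem isComplex_of_isAlmostComplex [Nonempty M] (hn : 1 < Module.finrank ℝ E)
    (hJ : IsAlmostComplex (cotangentModel E) (naturalJ g C)) : C.IsComplex := by
  obtain ⟨x⟩ := ‹Nonempty M›
  exact (isMetricOn_metricInChart g x).isComplex (mem_extChartAt_target x) hn fun ξ v =>
    localJ_localJ hJ ⟨x, ξ⟩ (mem_extChartAt_target x) v

theorem isIntegrable_iff_exists_integrability [T2Space M] [Nonempty M]
    (hn : 1 < Module.finrank ℝ E) (hJ : IsAlmostComplex (cotangentModel E) (naturalJ g C)) :
    IsIntegrable (cotangentModel E) (naturalJ g C) ↔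
      ∃ c, HasConstantSectionalCurvature g c ∧ ∀ t, 0 ≤ t → C.Integrability c t := by
  have hC := isComplex_of_isAlmostComplex hn hJ
  have hG := isMetricOn_metricInChart g
  rw [isIntegrable_iff_flatNijenhuis hJ]
  constructor
  · intro h
    have h1 := fun x : M => (hG x).exists_integrability (mem_extChartAt_target x) hn hC
      fun ξ θ η => h x ξ (0, θ) (0, η)
    obtain ⟨x₀⟩ := ‹Nonempty M›
    obtain ⟨c, hI, -⟩ := h1 x₀
    refine ⟨c, fun x u v huv => ?_, hI⟩
    -- the equations on the coefficients determine the curvature, hence it is the same everywhere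
    obtain ⟨c', hI', hR⟩ := h1 x
    obtain rfl := (hI 0 le_rfl).unique le_rfl hC (hI' 0 le_rfl)
    rw [sectionalCurvature_eq]
    exact (hG x).sectional_of_localCurvature_eq (mem_extChartAt_target x) hR huv
  · rintro ⟨c, hc, hI⟩ x ξ v w
    refine (hG x).flatNijenhuis_localJ_eq_zero (mem_extChartAt_target x) hC ?_
      (hI _ ((hG x).fibreEnergy_nonneg (mem_extChartAt_target x) ξ))
      ((hG x).localCurvature_eq_of_sectional (mem_extChartAt_target x) fun u v huv => ?_) v w
    · exact (continuousAt_fst.eventually ((isOpen_extChartAt_target x).eventually_mem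
        (mem_extChartAt_target x))).mono fun z hz => localJ_localJ hJ ⟨x, ξ⟩ hz
    · exact (sectionalCurvature_eq g x u v).symm.trans (hc x u v huv)

end Characterization

end GeneralNaturalLift

end

theorem mainTheorem2 {E : Type*} [NormedAddCommGroup E] [NormedSpace ℝ E] [FiniteDimensional ℝ E]
    (hn : 2 < Module.finrank ℝ E)
    {M : Type*} [TopologicalSpace M] [T2Space M] [ConnectedSpace M] [ChartedSpace E M]
    [IsManifold 𝓘(ℝ, E) ∞ M]
    (g : SmoothMetric E M) (C : Coefficients)
    (hJ : IsAlmostComplex (cotangentModel E) (naturalJ g C)) :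
    IsIntegrable (cotangentModel E) (naturalJ g C) ↔
      ∃ c : ℝ, HasConstantSectionalCurvature g c ∧
        ∀ t : ℝ, 0 ≤ t →
          let a₁ := C.a₁ t
          let a₂ := C.a₂ t
          let a₃ := C.a₃ t
          let a₁' := derivWithin C.a₁ (Set.Ici 0) t
          let a₂' := derivWithin C.a₂ (Set.Ici 0) t
          let a₃' := derivWithin C.a₃ (Set.Ici 0) t
          let D := a₁ - 2 * t * a₁' - 2 * c * t * a₂ - 4 * c * t ^ 2 * a₂'
          D ≠ 0 ∧
          C.b₁ t = (2 * c ^ 2 * t * a₂ ^ 2 + 2 * c * t * a₁ * a₂' + a₁ * a₁' - c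
            + 3 * c * a₃ ^ 2) / D ∧
          C.b₂ t = (2 * t * a₃' ^ 2 - 2 * t * a₁' * a₂' + c * a₂ ^ 2 + 2 * c * t * a₂ * a₂'
            + a₁ * a₂') / D ∧
          C.b₃ t = (a₁ * a₃' + 2 * c * a₂ * a₃ + 4 * c * t * a₂' * a₃
            - 2 * c * t * a₂ * a₃') / D := by
  have hC := isComplex_of_isAlmostComplex (by lia) hJ
  rw [isIntegrable_iff_exists_integrability (by lia) hJ]
  refine exists_congr fun c => and_congr_right fun _ => ⟨fun hI t ht => ?_, fun h t ht => ?_⟩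
  · have hD := Coefficients.denom_ne_zero hC hI ht
    exact ⟨hD, (eq_div_iff hD).2 (Coefficients.b₁_mul_denom hC hI ht),
      (eq_div_iff hD).2 ((hI t ht).b₂_mul_denom hC ht),
      (eq_div_iff hD).2 ((hI t ht).b₃_mul_denom hC ht)⟩
  · obtain ⟨hD, -, h₂, h₃⟩ := h t ht
    exact Coefficients.integrability_of_formulas hC ht hD ((eq_div_iff hD).1 h₂)
      ((eq_div_iff hD).1 h₃)
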